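/- Let $p\ge 1$, $q\ge 0$ be integers, $Q=\{1,\dots,q\}$ and $\nu>p$. Let $$\mathbb U^p=\{z=(z',z_p)\in\mathbb C^{p-1}\times\mathbb C:\ \rho(z):=\operatorname{Im}z_p-|z'|^2>0\}$$ with Lebesgue measure $dz$. Let $\xi_1,\dots,\xi_q,\bar\xi_1,\dots,\bar\xi_q$ be anticommuting generators of a complex Grassmann algebra. For $I=\{i_1<\dots<i_k\}\subset Q$ put $\xi_I=\xi_{i_1}\cdots\xi_{i_k}$ and $\xi_I^*=\bar\xi_{i_k}\cdots\bar\xi_{i_1}$. A super function on $\mathbb U^{p|q}$ is $F=\sum_{I,J\subset Q}F_{I,J}\,\xi_I\xi_J^*$ with functions $F_{I,J}$ on $\mathbb U^p$, and $F^*=\sum_{I,J}\overline{F_{I,J}}\,\xi_J\xi_I^*$. The Berezin integral of a super function is the Lebesgue integral over $\mathbb U^p$ of its top coefficient, normalized by $\int d\xi\,\xi_Q^*\xi_Q=1$. Put $\xi\bar\xi=\sum_j\xi_j\bar\xi_j$, and for $\Phi=\sum_M\Phi_M\xi_M$ and a super function $G$ let $$(\Phi|G)_\nu=\frac{\Gamma(\nu)}{4\pi^p\,\Gamma(\nu+q-p)}\int_{\mathbb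 U^{p|q}}dz\,d\xi\,(\rho(z)-\xi\bar\xi)^{\nu+q-p-1}\,\Phi^*G ,$$ where the power is expanded by the (finite) binomial series. The super Bergman space $H^2_\nu(\mathbb U^{p|q})$ consists of all $\Psi=\sum_M\psi_M\xi_M$ with $\psi_M$ holomorphic on $\mathbb U^p$ and $(\Psi|\Psi)_\nu<\infty$. For a super function $F$, the Toeplitz operator $T_F^\nu$ on $H^2_\nu(\mathbb U^{p|q})$ is $T_F^\nu\Psi=P^\nu(F\Psi)$ with $P^\nu$ the orthogonal projection onto $H^2_\nu(\mathbb U^{p|q})$. That is, $\Psi\in\operatorname{Dom}T_F^\nu$ and $T_F^\nu\Psi=\Theta$ mean: $\Psi,\Theta\in H^2_\nu(\mathbb U^{p|q})$ and, for every $\Phi\in H^2_\nu(\mathbb U^{p|q})$, the integral $(\Phi|F\Psi)_\nu$ converges absolutely and equals $(\Phi|\Theta)_\nu$. Let $(L_2(\mathbb R^{p-1}\times\mathbb R_+))^{2^q}$ consist of the families $(f_M)_{M\subset Q}$, with inner product $\sum_M\frac{\Gamma(\nu)}{\Gamma(\nu+|M|)}(f_M,g_M)_{L_2}$. With $c_\nu=\frac{\Gamma(\nu)}{\pi^p\Gamma(\nu-p)}$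 put, for $\xi>0$, $$(R_{0,\nu}f)(u',v',\xi,v)=\pi^{-\frac{p-1}4}\,e^{-\xi v-\frac{|v'|^2}2}\Big(\frac{4(2\xi)^{\nu-p}}{c_\nu\Gamma(\nu-p)}\Big)^{1/2}f(u',\xi),$$ and, for $z=(x'+iy',z_p)\in\mathbb U^p$, $$(R_\nu^*f)(z)=(2\pi)^{-p/2}\int_{\mathbb R_+}\int_{\mathbb R^{p-1}}e^{i(x'\cdot\xi'+\xi\operatorname{Re}z_p)}\,(R_{0,\nu}f)\Big(\frac{\xi'}{2\sqrt\xi}-\sqrt\xi\,y',\ \frac{\xi'}{2\sqrt\xi}+\sqrt\xi\,y',\ \xi,\ \rho(z)\Big)\,d\xi'\,d\xi ,$$ and $R_{\nu,(p|q)}^*\big((f_M)_M\big)=\sum_M R_{\nu+|M|}^*(f_M)\,\xi_M$. Let $F$ be a super function with bounded measurable coefficients $F_{I,J}$ which is invariant under the nilpotent group $\mathbb R^{p-1}\times\mathbb R\times\mathbb T^q$, acting by $(b,h,s):(z',z_p,\xi)\mapsto(z'+b,\ z_p+h+2iz'\cdot b+i|b|^2,\ s\xi)$. Then: 1. $F=\sum_{I\subset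 Q}F_I(\operatorname{Im}z',\,\operatorname{Im}z_p-|z'|^2)\,\xi_I\xi_I^*$ for functions $F_I$ on $\mathbb R^{p-1}\times\mathbb R_+$. 2. $R_{\nu,(p|q)}^*$ is a unitary operator from $(L_2(\mathbb R^{p-1}\times\mathbb R_+))^{2^q}$ onto $H^2_\nu(\mathbb U^{p|q})$. Let $R_{\nu,(p|q)}$ be its inverse. 3. $R_{\nu,(p|q)}T_F^\nu R_{\nu,(p|q)}^*$ acts on its domain as multiplication by $\gamma_{F,\nu}=(\gamma_{F,\nu}(u',\xi,M))_{M\subset Q}$, where $$\gamma_{F,\nu}(u',\xi,M)=\frac{(2\xi)^{\nu+|M|-p}}{\pi^{\frac{p-1}2}}\sum_{M\subset K\subset Q}\frac{(-1)^{|K\setminus M|}}{\Gamma(\nu+|K|-p)}\int_{\mathbb R^{p-1}\times\mathbb R_+}F_{K\setminus M}\Big(\frac{-u'+v'}{2\sqrt\xi},v\Big)e^{-2\xi v-|v'|^2}v^{\nu+|K|-p-1}\,dv'\,dv ,$$ and its closure is the maximal operator of multiplication by $\gamma_{F,\nu}$ on $(L_2(\mathbb R^{p-1}\times\mathbb R_+))^{2^q}$,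 with domain $\{f:\gamma_{F,\nu}f\in (L_2)^{2^q}\}$. So the closure of $T_F^\nu$ is unitarily equivalent to multiplication by $\gamma_{F,\nu}$. 4. If, moreover, $\rho^{|I|}F_I$ is bounded for every $I\subset Q$, then $T_F^\nu$ is defined on all of $H^2_\nu(\mathbb U^{p|q})$ and no closure is needed: $R_{\nu,(p|q)}T_F^\nu R_{\nu,(p|q)}^*=\gamma_{F,\nu}I$. -/

import Mathlib

open MeasureTheory
open scoped ComplexConjugate

noncomputable section

namespace SuperSiegel

/-! ### The Siegel domain, with `p = n + 1` -/

/-- The defining function `Im z_p - |z'|²` on `ℂ^{p-1} × ℂ`, where `p = n + 1`. -/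
def height {n : ℕ} (z : (Fin n → ℂ) × ℂ) : ℝ := z.2.im - ∑ k, ‖z.1 k‖ ^ 2

/-- The Siegel domain `𝕌^p ⊂ ℂ^{p-1} × ℂ`, `p = n + 1`. -/
def siegel (n : ℕ) : Set ((Fin n → ℂ) × ℂ) := {z | 0 < height z}

/-- Lebesgue measure on the Siegel domain. -/
def siegelMeasure (n : ℕ) : Measure (siegel n) := volume.comap Subtype.val

/-- Holomorphic functions on the (open) Siegel domain. -/
def IsHolomorphic {n : ℕ} (f : siegel n → ℂ) : Prop :=
  DifferentiableOn ℂ (Function.extend Subtype.val f 0) (siegel n)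

/-! ### The complex Grassmann algebra -/

/-- The complex Grassmann algebra with generators `ξ_1, …, ξ_q, ξ̄_1, …, ξ̄_q`: the exterior algebra
of `ℂ^{2q}`, whose standard basis is ordered as `ξ̄_q, …, ξ̄_1, ξ_1, …, ξ_q`. -/
abbrev Grassmann (q : ℕ) : Type := ExteriorAlgebra ℂ (Fin (q + q) → ℂ)

/-- The generator `ξ_j`. -/
def xi {q : ℕ} (j : Fin q) : Grassmann q :=
  ExteriorAlgebra.ι ℂ (Pi.single (Fin.natAdd q j) 1)

/-- The generator `ξ̄_j`. -/
def xiBar {q : ℕ} (j : Fin q) : Grassmann q :=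
  ExteriorAlgebra.ι ℂ (Pi.single (Fin.castAdd q (Fin.rev j)) 1)

/-- `ξ_I = ξ_{i_1} ⋯ ξ_{i_k}` for `I = {i_1 < ⋯ < i_k}`. -/
def xiProd {q : ℕ} (I : Finset (Fin q)) : Grassmann q := (I.sort.map xi).prod

/-- `ξ_I^* = ξ̄_{i_k} ⋯ ξ̄_{i_1}` for `I = {i_1 < ⋯ < i_k}`. -/
def xiStarProd {q : ℕ} (I : Finset (Fin q)) : Grassmann q := (I.sort.reverse.map xiBar).prod

/-- The Berezin integral over the odd variables: the linear functional that vanishes on products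
of fewer than `2q` generators and is normalized by `ξ_Q^* ξ_Q ↦ 1`, `Q = {1, …, q}`. -/
def berezin (q : ℕ) : Grassmann q →ₗ[ℂ] ℂ :=
  ExteriorAlgebra.liftAlternating (Pi.single (q + q) Matrix.detRowAlternating)

/-- The power `(r - ξ ξ̄)^s`, `ξ ξ̄ = ξ_1 ξ̄_1 + ⋯ + ξ_q ξ̄_q`, for real `r > 0` and `s`: the
binomial series, which is finite because `ξ ξ̄` is nilpotent of order `q + 1`. -/
def superPow (q : ℕ) (r s : ℝ) : Grassmann q :=
  ∑ k ∈ Finset.range (q + 1),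
    (((descPochhammer ℝ k).eval s / (k.factorial : ℝ) * r ^ (s - k) : ℝ) : ℂ) •
      (-∑ j : Fin q, xi j * xiBar j) ^ k

/-! ### Super functions -/

/-- Super functions `F = ∑_{I,J} F_{I,J} ξ_I ξ_J^*` on `𝕌^{p|q}`, `p = n + 1`, given by their
coefficient functions. -/
abbrev SuperFun (n q : ℕ) : Type := Finset (Fin q) → Finset (Fin q) → siegel n → ℂ

/-- The value of a super function in the Grassmann algebra. -/
def SuperFun.val {n q : ℕ} (F : SuperFun n q) (z : siegel n) : Grassmann q :=
  ∑ I, ∑ J, F I J z • (xiProd I * xiStarProd J)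

/-- The involution `F^* = ∑ conj F_{I,J} ξ_J ξ_I^*`. -/
def SuperFun.adj {n q : ℕ} (F : SuperFun n q) : SuperFun n q := fun I J z => conj (F J I z)

/-- The super function `∑_M ψ_M ξ_M`. -/
def SuperFun.ofCoeff {n q : ℕ} (ψ : Finset (Fin q) → siegel n → ℂ) : SuperFun n q :=
  fun I J => if J = ∅ then ψ I else 0

/-! ### The super Bergman space and Toeplitz operators -/

/-- The body of the integrand of `(Φ | G)`, after the odd variables have been integrated out of
`(Im w_p - |w'|² - ω ω̄)^{ν+q-p-1} Φ^* G`. -/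
def pairing {n q : ℕ} (ν : ℝ) (Φ : Finset (Fin q) → siegel n → ℂ) (G : siegel n → Grassmann q)
    (z : siegel n) : ℂ :=
  berezin q (superPow q (height z.1) (ν + q - (n + 1) - 1) *
    (SuperFun.ofCoeff Φ).adj.val z * G z)

/-- The sesquilinear form `(Φ | G)` on `𝕌^{p|q}`, `p = n + 1`, for `Φ = ∑ Φ_M ξ_M`. -/
def form {n q : ℕ} (ν : ℝ) (Φ : Finset (Fin q) → siegel n → ℂ) (G : siegel n → Grassmann q) : ℂ :=
  ((Real.Gamma ν / (4 * Real.pi ^ (n + 1) * Real.Gamma (ν + q - (n + 1))) : ℝ) : ℂ) *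
    ∫ z, pairing ν Φ G z ∂(siegelMeasure n)

/-- The super Bergman space `H²_ν(𝕌^{p|q})`, `p = n + 1`: the super-holomorphic functions
`Ψ = ∑_M ψ_M ξ_M` with `(Ψ | Ψ) < ∞`. -/
def bergman (n q : ℕ) (ν : ℝ) : Set (Finset (Fin q) → siegel n → ℂ) :=
  {ψ | (∀ M, IsHolomorphic (ψ M)) ∧
    Integrable (pairing ν ψ (SuperFun.ofCoeff ψ).val) (siegelMeasure n)}

/-- `Θ` is the orthogonal projection of `G` to the super Bergman space. -/
def IsBergmanProj {n q : ℕ} (ν : ℝ) (G : siegel n → Grassmann q)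
    (Θ : Finset (Fin q) → siegel n → ℂ) : Prop :=
  Θ ∈ bergman n q ν ∧ ∀ Φ ∈ bergman n q ν,
    Integrable (pairing ν Φ G) (siegelMeasure n) ∧
      form ν Φ G = form ν Φ (SuperFun.ofCoeff Θ).val

/-- The super Toeplitz operator as a graph: `Ψ` belongs to its domain, and `Θ = T_F^ν Ψ` is the
orthogonal projection of the product `F Ψ`. -/
def IsToeplitz {n q : ℕ} (ν : ℝ) (F : SuperFun n q) (Ψ Θ : Finset (Fin q) → siegel n → ℂ) : Prop :=
  Ψ ∈ bergman n q ν ∧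
    IsBergmanProj ν (fun z => F.val z * (SuperFun.ofCoeff Ψ).val z) Θ

/-! ### The nilpotent group -/

lemma height_nilAct {n : ℕ} (b : Fin n → ℝ) (h : ℝ) (z : (Fin n → ℂ) × ℂ) :
    height (fun k => z.1 k + (b k : ℂ),
      z.2 + h + 2 * Complex.I * (∑ k, z.1 k * (b k : ℂ)) + Complex.I * ∑ k, (b k : ℂ) ^ 2)
      = height z := by
  have e (k : Fin n) : ‖z.1 k + (b k : ℂ)‖ ^ 2
      = ‖z.1 k‖ ^ 2 + 2 * ((z.1 k).re * b k) + b k ^ 2 := by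
    rw [Complex.sq_norm, Complex.sq_norm, Complex.normSq_apply, Complex.normSq_apply]
    simp only [Complex.add_re, Complex.add_im, Complex.ofReal_re, Complex.ofReal_im]
    ring
  have e2 : (∑ k, (b k : ℂ) ^ 2) = ((∑ k, b k ^ 2 : ℝ) : ℂ) := by push_cast; rfl
  simp only [height, e, Finset.sum_add_distrib, ← Finset.mul_sum, e2]
  simp only [Complex.add_im, Complex.mul_im, Complex.mul_re, Complex.re_sum, Complex.im_sum,
    Complex.I_re, Complex.I_im, Complex.ofReal_re, Complex.ofReal_im, Complex.re_ofNat,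
    Complex.im_ofNat, mul_zero, sub_zero]
  ring

/-- The action of `(b, h) ∈ ℝ^{p-1} × ℝ` on the even variables,
`(z', z_p) ↦ (z' + b, z_p + h + 2 i z'·b + i |b|²)`. -/
def nilAct {n : ℕ} (b : Fin n → ℝ) (h : ℝ) (z : siegel n) : siegel n :=
  ⟨(fun k => z.1.1 k + (b k : ℂ),
    z.1.2 + h + 2 * Complex.I * (∑ k, z.1.1 k * (b k : ℂ)) + Complex.I * ∑ k, (b k : ℂ) ^ 2),
    lt_of_lt_of_eq z.2 (height_nilAct b h z.1).symm⟩

/-- Invariance under the nilpotent group `ℝ^{p-1} × ℝ × 𝕋^q`, where `s ∈ 𝕋^q` acts by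
`ξ_j ↦ s_j ξ_j`, `ξ̄_j ↦ conj s_j ξ̄_j`. -/
def IsNilpotent {n q : ℕ} (F : SuperFun n q) : Prop :=
  ∀ (b : Fin n → ℝ) (h : ℝ) (s : Fin q → Circle) (I J : Finset (Fin q)) (z : siegel n),
    (∏ i ∈ I, (s i : ℂ)) * (∏ j ∈ J, conj (s j : ℂ)) * F I J (nilAct b h z) = F I J z

lemma height_section {n : ℕ} (y : Fin n → ℝ) (v : ℝ) :
    height (fun k => Complex.I * (y k : ℂ), Complex.I * ((v + ∑ k, y k ^ 2 : ℝ) : ℂ)) = v := by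
  simp [height, sq_abs, -Complex.ofReal_sum, -Complex.ofReal_add, -Complex.ofReal_pow]

/-- For a nilpotent `F = ∑_I F_I(Im z', Im z_p - |z'|²) ξ_I ξ_I^*`, the function `F_I(y', v)`,
`v > 0`, read off at the point `z' = i y'`, `z_p = i (v + |y'|²)`. -/
def profile {n q : ℕ} (F : SuperFun n q) (I : Finset (Fin q)) (y : Fin n → ℝ) (v : ℝ) : ℂ :=
  if hv : 0 < v then
    F I I ⟨(fun k => Complex.I * (y k : ℂ), Complex.I * ((v + ∑ k, y k ^ 2 : ℝ) : ℂ)),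
      lt_of_lt_of_eq hv (height_section y v).symm⟩
  else 0

/-! ### The super Bargmann transform of nilpotent type -/

/-- Lebesgue measure on `ℝ^{p-1} × ℝ_+`. -/
abbrev halfMeasure (n : ℕ) : Measure ((Fin n → ℝ) × ℝ) := volume.restrict {t | 0 < t.2}

/-- The space `(L_2(ℝ^{p-1} × ℝ_+))^{2^q}`. -/
abbrev Target (n q : ℕ) : Type := Finset (Fin q) → Lp ℂ 2 (halfMeasure n)

/-- Its inner product `∑_M Γ(ν) / Γ(ν + |M|) (f_M, g_M)`. -/
def targetInner {n q : ℕ} (ν : ℝ) (f g : Target n q) : ℂ :=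
  ∑ M, ((Real.Gamma ν / Real.Gamma (ν + (M.card : ℝ)) : ℝ) : ℂ) * inner ℂ (f M) (g M)

/-- The constant `c_ν = Γ(ν) / (π^p Γ(ν - p))`, `p = n + 1`. -/
def bergmanConst (n : ℕ) (ν : ℝ) : ℝ :=
  Real.Gamma ν / (Real.pi ^ (n + 1) * Real.Gamma (ν - (n + 1)))

/-- The embedding `R_{0,ν}` of `L_2(ℝ^{p-1} × ℝ_+)`: the function of `(u', v', ξ, v)`, `ξ > 0`,
`π^{-(p-1)/4} e^{-ξ v - |v'|²/2} (4 (2ξ)^{ν-p} / (c_ν Γ(ν-p)))^{1/2} f(u', ξ)`. -/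
def bargmannEmbed {n : ℕ} (ν : ℝ) (f : (Fin n → ℝ) × ℝ → ℂ)
    (u v' : Fin n → ℝ) (ξ v : ℝ) : ℂ :=
  ((Real.pi ^ (-(n : ℝ) / 4) * Real.exp (-ξ * v - (∑ k, v' k ^ 2) / 2) *
    Real.sqrt (4 * (2 * ξ) ^ (ν - (n + 1)) /
      (bergmanConst n ν * Real.Gamma (ν - (n + 1)))) : ℝ) : ℂ) * f (u, ξ)

/-- The adjoint Bargmann transform `R_ν^* = U_0^* U_1^* U_2^* U_3^* R_{0,ν}` of nilpotent type.
Here `U_3^*` substitutes `u' = ξ'/(2√ξ) - √ξ y'`, `v' = ξ'/(2√ξ) + √ξ y'`; `U_2^*` and `U_1^*` are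
the inverse unitary Fourier transforms `ξ' ↦ x'` and `ξ ↦ Re z_p`; and `U_0^*` substitutes
`v = Im z_p - |z'|²`. -/
def bargmannAdj {n : ℕ} (ν : ℝ) (f : (Fin n → ℝ) × ℝ → ℂ) (z : siegel n) : ℂ :=
  (((2 * Real.pi) ^ (-((n : ℝ) + 1) / 2) : ℝ) : ℂ) *
    ∫ t : (Fin n → ℝ) × ℝ in {t | 0 < t.2},
      Complex.exp (Complex.I * (((∑ k, (z.1.1 k).re * t.1 k) + z.1.2.re * t.2 : ℝ) : ℂ)) *
        bargmannEmbed ν f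
          (fun k => t.1 k / (2 * Real.sqrt t.2) - Real.sqrt t.2 * (z.1.1 k).im)
          (fun k => t.1 k / (2 * Real.sqrt t.2) + Real.sqrt t.2 * (z.1.1 k).im)
          t.2 (height z.1)

/-- The adjoint super Bargmann transform `R_{ν,(p|q)}^*`,
`(f_M)_M ↦ ∑_M R_{ν+|M|}^*(f_M) ξ_M`. -/
def superBargmannAdj {n q : ℕ} (ν : ℝ) (f : Target n q) : Finset (Fin q) → siegel n → ℂ :=
  fun M => bargmannAdj (ν + (M.card : ℝ)) (f M)

/-- The multiplier `γ_{F,ν}(u', ξ, M)`. The sign is the one in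
`ξ_I ξ_I^* = (-1)^{|I|} ξ_I^* ξ_I`. -/
def gammaNil {n q : ℕ} (ν : ℝ) (F : SuperFun n q) (u : Fin n → ℝ) (ξ : ℝ)
    (M : Finset (Fin q)) : ℂ :=
  ∑ K with M ⊆ K,
    (-1 : ℂ) ^ (K \ M).card *
      (((2 * ξ) ^ (ν + (M.card : ℝ) - (n + 1)) /
        (Real.pi ^ ((n : ℝ) / 2) * Real.Gamma (ν + (K.card : ℝ) - (n + 1))) : ℝ) : ℂ) *
      ∫ t : (Fin n → ℝ) × ℝ in {t | 0 < t.2},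
        profile F (K \ M) (fun k => 1 / (2 * Real.sqrt ξ) * (-u k + t.1 k)) t.2 *
          ((Real.exp (-2 * ξ * t.2 - ∑ k, t.1 k ^ 2) *
            t.2 ^ (ν + (K.card : ℝ) - (n + 1) - 1) : ℝ) : ℂ)

/-- The graph of the (maximal) operator of multiplication by `γ_{F,ν}`. -/
def multGraph {n q : ℕ} (ν : ℝ) (F : SuperFun n q) : Set (Target n q × Target n q) :=
  {x | ∀ M, ∀ᵐ t ∂(halfMeasure n), x.2 M t = gammaNil ν F t.1 t.2 M * x.1 M t}

/-- The graph of `R_{ν,(p|q)} T_F^ν R_{ν,(p|q)}^*`. -/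
def toeplitzGraph {n q : ℕ} (ν : ℝ) (F : SuperFun n q) : Set (Target n q × Target n q) :=
  {x | IsToeplitz ν F (superBargmannAdj ν x.1) (superBargmannAdj ν x.2)}

end SuperSiegel

end

/-! The shear `z_p = w_p + i ∑ w_k²` (`tubeMap`) turns the Siegel domain into the tube `w = x + iY`
over the solid paraboloid `Y_p > 2|Y'|²`. With `Y = (y', h + 2|y'|²)` one has `y' = Im z'` and `h =
ρ(z)`, Lebesgue measure becomes `dy dx`, and the nilpotent group acts by translations of `x`.
Invariant coefficients therefore depend on `y` alone, and the torus kills the coefficients with `I ≠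
J`.

For fixed `y`, a translation of the frequency shows that `R_l^* f` is an inverse Fourier integral in
`x` of `b(y,t) f(t)`, where `t = (u', ξ)` is the rescaled frequency and `b` (`bk`) is a Gaussian
times `e^{-ξh}` and a power of `ξ` (`bargmannAdj_spt`). Parseval in `x` and Fubini turn the form `∫
conj(R_l^* f) a(y) R_l^* g` into `∫ conj(f) g ∫ a(y) k(y,t) dy dt` with `k = kk`
(`integral_conj_bargmannAdj_mul`): a symbol in `y` becomes multiplication by its average against
`k(·,t)`. For `a = 1` a Gaussian and a Gamma integral give the constant `4 / c_l`, so `R_l^*` is an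
isometry up to normalization.

The image is holomorphic because the plane wave times `b` is the exponential of a polynomial in `z`.
It is everything by a Paley–Wiener argument. After damping a function by `(1 - iεz_p)^{-(n+2)}`, its
horizontal slices are integrable, and `e^{Y·ζ}` times the Fourier transform of the slice at `Y` does
not depend on `Y`. Finiteness of the norm forces this density to vanish for `ζ_p ≤ 0`, and dividing
by the kernel produces `f`. The range is closed, so `ε → 0` finishes (`exists_bargmannAdj_eq`).

The Berezin integral kills each monomial that does not contain every generator exactly once. Hence
`(Φ | FΨ)` is a sum over `M` of ordinary forms of weight `ν + |M|` with symbol `sym`, a combination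
of the `ρ^{|I|} F_I` with `I` disjoint from `M` (`pairing_mul_eq`), and the normalized average of
this symbol is `γ(·, M)` (`gammaNil_eq`).

The symbol grows at most like `1 + ρ^q`, and the moments of `k` in `h` are powers of `1/ξ`; so all
integrals converge for `f` supported in `ξ > δ`. Testing against such functions places the Toeplitz
graph inside the multiplication graph (`toeplitzGraph_subset`), which is closed, and cutting off
near `ξ = 0` gives density (`closure_toeplitzGraph`). If every `ρ^{|I|} F_I` is bounded, so is the
symbol, and no cutoff is needed (`toeplitzGraph_of_bounded`). -/

noncomputable section
namespace SuperSiegel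
open FourierTransform SchwartzMap

/-! ### Fourier integrals and the `L²` Fourier transform. -/

section L2
variable {V : Type*} [NormedAddCommGroup V] [InnerProductSpace ℝ V] [FiniteDimensional ℝ V]
  [MeasurableSpace V] [BorelSpace V]

/-- On `L¹ ∩ L²` the Fourier integral represents the `L²` Fourier transform. -/
lemma fourier_ae_eq_fourier_toLp {f : V → ℂ} (hf : Integrable f) (hf2 : MemLp f 2) :
    𝓕 f =ᵐ[volume] (𝓕 (hf2.toLp f) : Lp ℂ 2 (volume : Measure V)) := by
  have hc : Continuous (𝓕 f) :=
    VectorFourier.fourierIntegral_continuous Real.continuous_fourierChar (by simpa using! continuous_inner) hf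
  -- Both sides are compared as distributions: paired with a test function, each moves its Fourier
  -- transform onto the test function.
  apply ae_eq_of_integral_contDiff_smul_eq hc.locallyIntegrable
    ((Lp.memLp _).locallyIntegrable (by norm_num))
  intro g hg hgs
  have hgs' : HasCompactSupport (fun x => (g x : ℂ)) := hgs.comp_left Complex.ofReal_zero
  have hg' : ContDiff ℝ ((⊤ : ℕ∞) : WithTop ℕ∞) (fun x => (g x : ℂ)) :=
    Complex.ofRealCLM.contDiff.comp hg
  set G : 𝓢(V, ℂ) := hgs'.toSchwartzMap hg' with hG
  have hGx (x) : G x = (g x : ℂ) := rfl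
  have h1 := Lp.fourier_toTemperedDistribution_eq (hf2.toLp f)
  have h2 := congrArg (fun T => T G) h1
  simp only [TemperedDistribution.fourier_apply, Lp.toTemperedDistribution_apply] at h2
  have h3 : ∫ x, (𝓕 G) x • (hf2.toLp f) x = ∫ x, (𝓕 G) x • f x :=
    integral_congr_ae (by filter_upwards [hf2.coeFn_toLp] with x hx; rw [hx])
  have h4 : ∫ x, (𝓕 G) x • f x = ∫ x, G x • 𝓕 f x := by
    have := VectorFourier.integral_fourierIntegral_smul_eq_flip (μ := (volume : Measure V))
      (ν := (volume : Measure V)) (L := innerₗ V) (f := G) (g := f) Real.continuous_fourierChar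
      (by simpa using! continuous_inner) G.integrable hf
    rw [flip_innerₗ] at this
    exact this
  calc ∫ x, g x • 𝓕 f x = ∫ x, G x • 𝓕 f x := by simp [hGx]
    _ = _ := by rw [← h4, ← h3, h2]; simp [hGx]

lemma memLp_fourier {f : V → ℂ} (hf : Integrable f) (hf2 : MemLp f 2) : MemLp (𝓕 f) 2 :=
  (memLp_congr_ae (fourier_ae_eq_fourier_toLp hf hf2)).2 (Lp.memLp _)

lemma integral_conj_fourier_mul_fourier {f g : V → ℂ} (hf : Integrable f) (hf2 : MemLp f 2)
    (hg : Integrable g) (hg2 : MemLp g 2) :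
    ∫ x, conj (𝓕 f x) * 𝓕 g x = ∫ x, conj (f x) * g x := by
  have h := Lp.inner_fourier_eq (hf2.toLp f) (hg2.toLp g)
  rw [L2.inner_def, L2.inner_def] at h
  have e1 : ∫ x, conj (𝓕 f x) * 𝓕 g x =
      ∫ x, inner ℂ ((𝓕 (hf2.toLp f) : Lp ℂ 2 (volume : Measure V)) x)
        ((𝓕 (hg2.toLp g) : Lp ℂ 2 (volume : Measure V)) x) := by
    refine integral_congr_ae ?_
    filter_upwards [fourier_ae_eq_fourier_toLp hf hf2, fourier_ae_eq_fourier_toLp hg hg2]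
      with x h1 h2
    rw [h1, h2, RCLike.inner_apply, mul_comm]
  have e2 : ∫ x, conj (f x) * g x = ∫ x, inner ℂ ((hf2.toLp f) x) ((hg2.toLp g) x) := by
    refine integral_congr_ae ?_
    filter_upwards [hf2.coeFn_toLp, hg2.coeFn_toLp] with x h1 h2
    rw [h1, h2, RCLike.inner_apply, mul_comm]
  rw [e1, e2, h]

end L2

/-! ### Plancherel and inversion on `ℝ^{p-1} × ℝ`. -/

section Coordinates
variable {n : ℕ}

/-- The space `ℝ^{p-1} × ℝ`, `p = n + 1`. -/
abbrev HSp (n : ℕ) : Type := (Fin n → ℝ) × ℝ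

/-- The Euclidean pairing on `ℝ^{p-1} × ℝ`. -/
def dot (x y : HSp n) : ℝ := (∑ k, x.1 k * y.1 k) + x.2 * y.2

lemma dot_comm (x y : HSp n) : dot x y = dot y x := by simp [dot, mul_comm]

lemma dot_neg (x y : HSp n) : dot x (-y) = -dot x y := by
  simp [dot, Finset.sum_neg_distrib]; ring

lemma continuous_dot : Continuous fun p : HSp n × HSp n => dot p.1 p.2 := by
  unfold dot; fun_prop

/-- The unnormalized inverse Fourier integral `x ↦ ∫ e^{i x·ζ} G(ζ) dζ`. -/
def ft (G : HSp n → ℂ) (x : HSp n) : ℂ := ∫ ζ, Complex.exp (Complex.I * (dot x ζ : ℂ)) * G ζ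

/-- The inner product space on `ℝ^{p-1} × ℝ`. -/
abbrev EuclSp (n : ℕ) : Type := WithLp 2 (EuclideanSpace ℝ (Fin n) × ℝ)

/-- The coordinate map to the inner product space. -/
def toEucl (n : ℕ) : HSp n ≃ᵐ EuclSp n :=
  ((MeasurableEquiv.toLp 2 (Fin n → ℝ)).prodCongr (MeasurableEquiv.refl ℝ)).trans
    (MeasurableEquiv.toLp 2 (EuclideanSpace ℝ (Fin n) × ℝ))

lemma toEucl_apply (x : HSp n) : toEucl n x = WithLp.toLp 2 (WithLp.toLp 2 x.1, x.2) := rfl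

/-- The product type carries the sup norm, so the Fourier theory of inner product spaces is imported
along this volume preserving relabelling. -/
lemma measurePreserving_toEucl : MeasurePreserving (toEucl n) :=
  (WithLp.volume_preserving_toLp (EuclideanSpace ℝ (Fin n)) ℝ).comp
    ((PiLp.volume_preserving_toLp (Fin n)).prod (MeasurePreserving.id volume))

lemma inner_toEucl (x y : HSp n) : inner ℝ (toEucl n x) (toEucl n y) = dot x y := by
  simp [toEucl_apply, dot, WithLp.prod_inner_apply, PiLp.inner_apply, mul_comm]

lemma continuous_toEucl_symm : Continuous (toEucl n).symm := by
  have : ((toEucl n).symm : EuclSp n → HSp n) = fun v => (WithLp.ofLp v.fst, v.snd) := rfl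
  rw [this]; fun_prop

lemma finrank_EuclSp : Module.finrank ℝ (EuclSp n) = n + 1 := by
  rw [(WithLp.linearEquiv 2 ℝ (EuclideanSpace ℝ (Fin n) × ℝ)).finrank_eq]; simp

/-- The kernel of `𝓕` is `e^{-2πi⟨v,w⟩}`, so `e^{ix·ζ}` corresponds to the argument `-v/(2π)`. The
Jacobian of this dilation is the source of every factor `(2π)^{n+1}` below. -/
lemma ft_toEucl_symm (G : HSp n → ℂ) (v : EuclSp n) :
    ft G ((toEucl n).symm v) = 𝓕 (G ∘ (toEucl n).symm) (-(2 * Real.pi)⁻¹ • v) := by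
  rw [Real.fourier_eq', ← measurePreserving_toEucl.integral_comp (toEucl n).measurableEmbedding, ft]
  refine integral_congr_ae (.of_forall fun ζ => ?_)
  simp only [Function.comp, MeasurableEquiv.symm_apply_apply, smul_eq_mul]
  congr 2
  have : inner ℝ (toEucl n ζ) (-(2 * Real.pi)⁻¹ • v) = -(2 * Real.pi)⁻¹ * dot ((toEucl n).symm v) ζ := by
    rw [inner_smul_right, dot_comm, ← inner_toEucl, MeasurableEquiv.apply_symm_apply]
  rw [this]
  push_cast
  have := Real.pi_ne_zero
  field_simp

lemma memLp_comp_symm {G : HSp n → ℂ} {p : ENNReal} (h : MemLp G p) :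
    MemLp (G ∘ (toEucl n).symm) p :=
  h.comp_measurePreserving (measurePreserving_toEucl.symm _)

lemma integrable_comp_symm {G : HSp n → ℂ} (h : Integrable G) :
    Integrable (G ∘ (toEucl n).symm) :=
  (measurePreserving_toEucl.symm _).integrable_comp_of_integrable h

lemma neg_two_pi_inv_ne : -(2 * Real.pi)⁻¹ ≠ 0 := by
  have := Real.pi_pos; simp

lemma abs_two_pi_pow : |((-(2 * Real.pi)⁻¹) ^ (n + 1))⁻¹| = (2 * Real.pi) ^ (n + 1) := by
  have := Real.pi_pos
  rw [abs_inv, abs_pow, abs_neg, abs_of_pos (by positivity), inv_pow, inv_inv]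

lemma integral_conj_ft_mul_ft {f g : HSp n → ℂ} (hf : Integrable f) (hf2 : MemLp f 2)
    (hg : Integrable g) (hg2 : MemLp g 2) :
    ∫ x, conj (ft f x) * ft g x = ((2 * Real.pi) ^ (n + 1) : ℝ) * ∫ x, conj (f x) * g x := by
  have h := integral_conj_fourier_mul_fourier (integrable_comp_symm hf) (memLp_comp_symm hf2)
    (integrable_comp_symm hg) (memLp_comp_symm hg2)
  rw [← (measurePreserving_toEucl.symm _).integral_comp (toEucl n).symm.measurableEmbedding
    (fun x => conj (f x) * g x)]
  rw [← (measurePreserving_toEucl.symm _).integral_comp (toEucl n).symm.measurableEmbedding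
    (fun x => conj (ft f x) * ft g x)]
  simp only [ft_toEucl_symm]
  rw [Measure.integral_comp_smul volume (fun v : EuclSp n => conj (𝓕 (f ∘ (toEucl n).symm) v) *
    𝓕 (g ∘ (toEucl n).symm) v), h, finrank_EuclSp, abs_two_pi_pow, Complex.real_smul]
  rfl

lemma memLp_ft {f : HSp n → ℂ} (hf : Integrable f) (hf2 : MemLp f 2) : MemLp (ft f) 2 := by
  have h := memLp_fourier (integrable_comp_symm hf) (memLp_comp_symm hf2)
  have h2 : MemLp (fun v => ft f ((toEucl n).symm v)) 2 := by
    simp only [ft_toEucl_symm]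
    rw [show (fun v => 𝓕 (f ∘ (toEucl n).symm) (-(2 * Real.pi)⁻¹ • v)) =
      𝓕 (f ∘ (toEucl n).symm) ∘ (fun v => -(2 * Real.pi)⁻¹ • v) from rfl]
    refine MemLp.comp_of_map ?_ (by fun_prop)
    rw [Measure.map_addHaar_smul _ neg_two_pi_inv_ne]
    exact h.smul_measure (by simp)
  have h3 := h2.comp_measurePreserving measurePreserving_toEucl
  simpa [Function.comp_def] using h3

/-- Plancherel for integrals of norms. -/
lemma lintegral_enorm_ft_sq {f : HSp n → ℂ} (hf : Integrable f) (hf2 : MemLp f 2) :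
    ∫⁻ x, ‖ft f x‖ₑ ^ 2 = ENNReal.ofReal ((2 * Real.pi) ^ (n + 1)) * ∫⁻ x, ‖f x‖ₑ ^ 2 := by
  have key (g : HSp n → ℂ) (hg : MemLp g 2) :
      ∫⁻ x, ‖g x‖ₑ ^ 2 = ENNReal.ofReal (∫ x, conj (g x) * g x).re := by
    have h1 : (∫ x, conj (g x) * g x) = ((∫ x, ‖g x‖ ^ 2 : ℝ) : ℂ) := by
      rw [← integral_complex_ofReal]
      congr 1; ext x; rw [Complex.conj_mul']; norm_cast
    rw [h1, Complex.ofReal_re, ofReal_integral_eq_lintegral_ofReal (hg.integrable_norm_pow two_ne_zero)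
      (.of_forall fun x => by positivity)]
    congr 1; ext x; rw [ENNReal.ofReal_pow (norm_nonneg _), ofReal_norm]
  rw [key _ (memLp_ft hf hf2), key _ hf2, integral_conj_ft_mul_ft hf hf2 hf hf2,
    Complex.re_ofReal_mul, ENNReal.ofReal_mul (by positivity)]

lemma ft_inversion {H : HSp n → ℂ} (hc : Continuous H) (hH : Integrable H)
    (hH' : Integrable (ft H)) (x : HSp n) :
    ft (fun ζ => ft H (-ζ)) x = ((2 * Real.pi) ^ (n + 1) : ℝ) * H x := by
  have hF : Integrable (𝓕 (H ∘ (toEucl n).symm)) := by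
    have h1 : Integrable (fun v => ft H ((toEucl n).symm v)) := integrable_comp_symm hH'
    simp only [ft_toEucl_symm] at h1
    exact (integrable_comp_smul_iff volume _ neg_two_pi_inv_ne).1 h1
  have hi := (hc.comp continuous_toEucl_symm).fourierInv_fourier_eq (integrable_comp_symm hH) hF
  have hi' := congrFun hi (toEucl n x)
  simp only [Function.comp, MeasurableEquiv.symm_apply_apply] at hi'
  rw [← hi', Real.fourierInv_eq']
  have h2 := Measure.integral_comp_smul volume (fun v : EuclSp n =>
    Complex.exp (((2 * Real.pi * inner ℝ v (toEucl n x) : ℝ) : ℂ) * Complex.I) •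
      𝓕 (H ∘ (toEucl n).symm) v) ((2 * Real.pi)⁻¹)
  have hpi := Real.pi_pos
  rw [finrank_EuclSp, abs_inv, abs_pow, abs_of_pos (by positivity), inv_pow, inv_inv,
    Complex.real_smul] at h2
  rw [← h2, ft, ← (measurePreserving_toEucl.symm _).integral_comp
    (toEucl n).symm.measurableEmbedding]
  refine integral_congr_ae (.of_forall fun v => ?_)
  have e1 : -(toEucl n).symm v = (toEucl n).symm (-v) := rfl
  simp only [e1, ft_toEucl_symm, smul_neg, neg_smul, neg_neg, smul_eq_mul, Function.comp_def]
  congr 2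
  rw [inner_smul_left]
  rw [← MeasurableEquiv.apply_symm_apply (toEucl n) v, inner_toEucl, dot_comm]
  simp
  field_simp

end Coordinates
end SuperSiegel

end

noncomputable section
namespace SuperSiegel
open Filter Topology

/-! ### Holomorphic dependence of integrals on parameters. -/

section Holomorphic
variable {E : Type*} [NormedAddCommGroup E] [NormedSpace ℂ E]
  {α : Type*} [MeasurableSpace α] {μ : Measure α}

/-- In finite dimension a functional is a combination of coordinate functionals with its values on a
basis as coefficients. -/
lemma aestronglyMeasurable_of_apply [FiniteDimensional ℂ E] {F' : α → E →L[ℂ] ℂ}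
    (h : ∀ v, AEStronglyMeasurable (fun a => F' a v) μ) : AEStronglyMeasurable F' μ := by
  let b := Module.finBasis ℂ E
  have : F' = fun a => ∑ i, (F' a (b i)) • (LinearMap.toContinuousLinearMap (b.coord i)) := by
    ext a v
    conv_lhs => rw [← b.sum_repr v]
    rw [map_sum]
    simp [mul_comm]
  rw [this]
  exact Finset.aestronglyMeasurable_fun_sum _ fun i _ => (h (b i)).smul_const _

/-- The integral of a locally dominated family of holomorphic functions is holomorphic. -/
lemma differentiableAt_integral_of_dominated [FiniteDimensional ℂ E] {F : E → α → ℂ} {z₀ : E}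
    {r : ℝ} (hr : 0 < r) {bound : α → ℝ} (hbi : Integrable bound μ)
    (hm : ∀ z ∈ Metric.ball z₀ r, AEStronglyMeasurable (F z) μ)
    (hb : ∀ᵐ a ∂μ, ∀ z ∈ Metric.ball z₀ r, ‖F z a‖ ≤ bound a)
    (hd : ∀ᵐ a ∂μ, DifferentiableOn ℂ (F · a) (Metric.ball z₀ r)) :
    DifferentiableAt ℂ (fun z => ∫ a, F z a ∂μ) z₀ := by
  have hz₀ : z₀ ∈ Metric.ball z₀ r := Metric.mem_ball_self hr
  -- Cauchy's estimate on a ball of radius `r / 2` around `z`; the oscillation there is at most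
  -- twice the bound.
  have hbound : ∀ᵐ a ∂μ, ∀ z ∈ Metric.ball z₀ (r / 2), ‖fderiv ℂ (F · a) z‖ ≤
      2 * bound a / (r / 2) := by
    filter_upwards [hb, hd] with a ha hda z hz
    have hsub : Metric.ball z (r / 2) ⊆ Metric.ball z₀ r := by
      intro w hw
      rw [Metric.mem_ball] at *
      linarith [dist_triangle w z z₀]
    refine Complex.norm_fderiv_le_div_of_mapsTo_ball (hda.mono hsub) ?_ (by positivity)
    intro w hw
    rw [Metric.mem_closedBall, dist_eq_norm]
    have h1 := ha w (hsub hw)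
    have h2 := ha z (hsub (Metric.mem_ball_self (by positivity)))
    have := norm_sub_le (F w a) (F z a)
    linarith
  refine (hasFDerivAt_integral_of_dominated_of_fderiv_le (F' := fun z a => fderiv ℂ (F · a) z)
    (Metric.ball_mem_nhds z₀ (half_pos hr)) ?_ ?_ ?_ hbound ((hbi.const_mul 2).div_const _)
    ?_).differentiableAt
  · filter_upwards [Metric.ball_mem_nhds z₀ hr] with z hz using hm z hz
  · exact hbi.mono' (hm z₀ hz₀) (hb.mono fun a ha => ha z₀ hz₀)
  · refine aestronglyMeasurable_of_apply fun v => ?_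
    -- The derivative is measurable as a limit of difference quotients with steps `1/(k+1)`; the
    -- shift by `k₀` keeps the sample points in the ball.
    have hlim : Tendsto (fun k : ℕ => ((k : ℂ) + 1)⁻¹) atTop (𝓝 0) := by
      simpa using tendsto_one_div_add_atTop_nhds_zero_nat (𝕜 := ℂ)
    have hpt : Tendsto (fun k : ℕ => z₀ + ((k : ℂ) + 1)⁻¹ • v) atTop (𝓝 z₀) := by
      simpa using tendsto_const_nhds.add (hlim.smul_const v)
    obtain ⟨k₀, hk₀⟩ := eventually_atTop.1 (hpt.eventually (Metric.ball_mem_nhds z₀ hr))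
    refine aestronglyMeasurable_of_tendsto_ae (atTop : Filter ℕ)
      (f := fun k a => ((k + k₀ : ℕ) + 1 : ℂ) *
        (F (z₀ + (((k + k₀ : ℕ) : ℂ) + 1)⁻¹ • v) a - F z₀ a)) (fun k => ?_) ?_
    · exact ((hm _ (hk₀ _ (by omega))).sub (hm z₀ hz₀)).const_mul _
    · filter_upwards [hd] with a hda
      have hda0 := (hda.differentiableAt (Metric.ball_mem_nhds z₀ hr)).hasFDerivAt
      have := hda0.lim v (l := atTop) (c := fun k : ℕ => ((k : ℂ) + 1)) ?_
      · have h2 := this.comp (tendsto_add_atTop_nat k₀)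
        simpa [Function.comp_def] using h2
      · have hn (k : ℕ) : ‖(k : ℂ) + 1‖ = k + 1 := by
          rw [← Nat.cast_succ, Complex.norm_natCast, Nat.cast_succ]
        simp only [hn]
        exact tendsto_atTop_add_const_right _ _ tendsto_natCast_atTop_atTop
  · filter_upwards [hd] with a hda z hz
    refine (hda.differentiableAt ?_).hasFDerivAt
    refine Metric.isOpen_ball.mem_nhds (Metric.ball_subset_ball (by linarith) hz)

end Holomorphic

instance isAddHaarMeasure_volume_complexProd (n : ℕ) :
    (volume : Measure ((Fin n → ℂ) × ℂ)).IsAddHaarMeasure :=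
  Measure.prod.instIsAddHaarMeasure _ _

instance isAddHaarMeasure_volume_hSp (n : ℕ) : (volume : Measure (HSp n)).IsAddHaarMeasure :=
  Measure.prod.instIsAddHaarMeasure _ _

/-! ### The mean value property in several variables. -/

section MeanValue
variable {n : ℕ}

lemma measurePreserving_smul_of_norm_eq_one {c : ℂ} (hc : ‖c‖ = 1) :
    MeasurePreserving (fun x : (Fin n → ℂ) × ℂ => c • x) := by
  have h1 : MeasurePreserving (fun x : ℂ => c • x) :=
    (rotation ⟨c, by simp [Submonoid.unitSphere, hc]⟩).measurePreserving
  exact (volume_preserving_pi (fun _ : Fin n => h1)).prod h1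

/-- The mean value property on polydiscs. -/
lemma setIntegral_ball_eq_of_differentiableOn {f : (Fin n → ℂ) × ℂ → ℂ} {w : (Fin n → ℂ) × ℂ}
    {r R : ℝ} (hrR : r < R) (hf : DifferentiableOn ℂ f (Metric.ball w R)) :
    ∫ v in Metric.ball w r, f v = (volume.real (Metric.ball w r) : ℂ) * f w := by
  have hpi := Real.pi_pos
  set B := Metric.ball (0 : (Fin n → ℂ) × ℂ) r
  have hshift : ∫ v in Metric.ball w r, f v = ∫ v in B, f (w + v) := by
    have h := (measurePreserving_add_left volume w).setIntegral_preimage_emb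
      (measurableEmbedding_addLeft w) f (Metric.ball w r)
    rw [← h]; congr 2; ext v; simp [B]
  have hvol : volume.real (Metric.ball w r) = volume.real B := by
    simp [Measure.real, B, Measure.addHaar_ball_center]
  -- The sup-norm ball is invariant under `v ↦ e^{iθ} v`. Averaging over `θ` and exchanging
  -- integrals reduces the claim to circle averages of the one-variable functions `s ↦ f (w + s v)`.
  have hrot (θ : ℝ) : ∫ v in B, f (w + Complex.exp (θ * Complex.I) • v) = ∫ v in B, f (w + v) := by
    have hn : ‖Complex.exp (θ * Complex.I)‖ = 1 := Complex.norm_exp_ofReal_mul_I θ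
    have h := (measurePreserving_smul_of_norm_eq_one (n := n) hn).setIntegral_preimage_emb
      (Homeomorph.smulOfNeZero _ (Complex.exp_ne_zero _)).measurableEmbedding
      (fun v => f (w + v)) B
    rw [← h]; congr 2; ext v; simp [B, norm_smul, hn]
  have hmem {θ : ℝ} {v : (Fin n → ℂ) × ℂ} (hv : ‖v‖ ≤ r) :
      w + Complex.exp (θ * Complex.I) • v ∈ Metric.ball w R := by
    have hn : ‖Complex.exp (θ * Complex.I)‖ = 1 := Complex.norm_exp_ofReal_mul_I θ
    simp [norm_smul, hn]; linarith
  have hcirc (v : (Fin n → ℂ) × ℂ) (hv : v ∈ B) :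
      ∫ θ in Set.Ioc 0 (2 * Real.pi), f (w + Complex.exp (θ * Complex.I) • v)
        = 2 * Real.pi * f w := by
    have hv' : ‖v‖ < r := by simpa [B] using hv
    have h := DiffContOnCl.circleAverage (f := fun s : ℂ => f (w + s • v)) (c := 0) (R := 1) ?_
    · rw [Real.circleAverage, intervalIntegral.integral_of_le (by positivity)] at h
      simp only [circleMap, zero_add, Complex.ofReal_one, one_mul, zero_smul, add_zero] at h
      rw [← h, Complex.real_smul]
      push_cast
      rw [← mul_assoc, mul_inv_cancel₀ (by simp [hpi.ne']), one_mul]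
    · refine DifferentiableOn.diffContOnCl (hf.comp (by fun_prop) ?_)
      intro s hs
      have hs' : ‖s‖ ≤ 1 := by simpa using Metric.closure_ball_subset_closedBall hs
      simp only [Metric.mem_ball, dist_self_add_left, norm_smul]
      nlinarith [norm_nonneg v]
  have hint : Integrable (Function.uncurry fun (θ : ℝ) (v : (Fin n → ℂ) × ℂ) =>
      f (w + Complex.exp (θ * Complex.I) • v))
      ((volume.restrict (Set.Ioc 0 (2 * Real.pi))).prod (volume.restrict B)) := by
    rw [Measure.prod_restrict]
    have hco : ContinuousOn (Function.uncurry fun (θ : ℝ) (v : (Fin n → ℂ) × ℂ) =>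
        f (w + Complex.exp (θ * Complex.I) • v))
        (Set.Icc 0 (2 * Real.pi) ×ˢ Metric.closedBall 0 r) := by
      refine hf.continuousOn.comp (by fun_prop) ?_
      rintro ⟨θ, v⟩ ⟨-, hv⟩
      exact hmem (by simpa using hv)
    exact (hco.integrableOn_compact (isCompact_Icc.prod (isCompact_closedBall _ _))).mono_set
      (Set.prod_mono Set.Ioc_subset_Icc_self Metric.ball_subset_closedBall)
  have hswap := integral_integral_swap hint
  simp only [hrot] at hswap
  rw [setIntegral_congr_fun measurableSet_ball hcirc] at hswap
  simp only [setIntegral_const, Complex.real_smul] at hswap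
  rw [hshift, hvol]
  have hv : volume.real (Set.Ioc 0 (2 * Real.pi)) = 2 * Real.pi := by
    simp [Measure.real, hpi.le]
  rw [hv] at hswap
  have : (2 * (Real.pi : ℂ)) ≠ 0 := by simp [hpi.ne']
  apply mul_left_cancel₀ this
  push_cast at hswap
  rw [hswap]; ring

end MeanValue
end SuperSiegel

end

noncomputable section
namespace SuperSiegel
open Filter Topology

/-! ### The Siegel domain as a tube over a paraboloid. -/

section Tube
variable {n : ℕ}

/-- The biholomorphic map of a tube domain onto the Siegel domain. -/
def tubeMap (w : (Fin n → ℂ) × ℂ) : (Fin n → ℂ) × ℂ := (w.1, w.2 + Complex.I * ∑ k, w.1 k ^ 2)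

/-- The point `x + i Y`. -/
def cpt (Y x : HSp n) : (Fin n → ℂ) × ℂ :=
  (fun k => (x.1 k : ℂ) + Complex.I * (Y.1 k : ℂ), (x.2 : ℂ) + Complex.I * (Y.2 : ℂ))

/-- The shear `(y', h) ↦ (y', h + 2|y'|²)`. -/
def par (y : HSp n) : HSp n := (y.1, y.2 + 2 * ∑ k, y.1 k ^ 2)

/-- The real parts cancel, since `Re w_k² = x_k² - y_k²` and `|w_k|² = x_k² + y_k²`. Hence the
height sees only the imaginary part, which is what makes the domain a tube. -/
lemma height_tubeMap_cpt (Y x : HSp n) : height (tubeMap (cpt Y x)) = Y.2 - 2 * ∑ k, Y.1 k ^ 2 := by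
  have e (k : Fin n) : ‖(x.1 k : ℂ) + Complex.I * (Y.1 k : ℂ)‖ ^ 2 = x.1 k ^ 2 + Y.1 k ^ 2 := by
    rw [Complex.sq_norm, Complex.normSq_apply]; simp; ring
  have e2 (k : Fin n) : (((x.1 k : ℂ) + Complex.I * (Y.1 k : ℂ)) ^ 2).re = x.1 k ^ 2 - Y.1 k ^ 2 := by
    rw [sq]; simp; ring
  simp only [height, tubeMap, cpt, e, Complex.add_im, Complex.mul_im, Complex.re_sum, e2,
    Complex.I_re, Complex.I_im, Complex.ofReal_re, Complex.ofReal_im, Finset.sum_add_distrib,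
    Finset.sum_sub_distrib]
  ring

lemma height_tubeMap_cpt_par (y x : HSp n) : height (tubeMap (cpt (par y) x)) = y.2 := by
  rw [height_tubeMap_cpt]; simp [par]

/-- The point of the Siegel domain with tube coordinates `x' + i y'` and
`x_p + i (h + 2|y'|²)`, where `y = (y', h)`, `h > 0`. -/
def spt (y x : HSp n) : siegel n :=
  if h : 0 < y.2 then ⟨tubeMap (cpt (par y) x), lt_of_lt_of_eq h (height_tubeMap_cpt_par y x).symm⟩
  -- A junk value outside the half space, which `halfMeasure` does not charge.
  else ⟨(0, Complex.I), by simp [siegel, height]⟩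

lemma coe_spt {y : HSp n} (hy : 0 < y.2) (x : HSp n) : (spt y x).1 = tubeMap (cpt (par y) x) := by
  simp [spt, hy]

lemma height_spt {y : HSp n} (hy : 0 < y.2) (x : HSp n) : height (spt y x).1 = y.2 := by
  rw [coe_spt hy, height_tubeMap_cpt_par]

lemma exists_eq_spt (z : siegel n) :
    ∃ y x : HSp n, 0 < y.2 ∧ z = spt y x ∧ y = (fun k => (z.1.1 k).im, height z.1) := by
  refine ⟨(fun k => (z.1.1 k).im, height z.1), (fun k => (z.1.1 k).re,
    (z.1.2 - Complex.I * ∑ k, z.1.1 k ^ 2).re), z.2, ?_, rfl⟩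
  apply Subtype.ext
  have hz : 0 < ((fun k => (z.1.1 k).im, height z.1) : HSp n).2 := z.2
  rw [coe_spt hz]
  have h1 (k : Fin n) : ((z.1.1 k).re : ℂ) + Complex.I * ((z.1.1 k).im : ℂ) = z.1.1 k := by
    rw [mul_comm]; exact Complex.re_add_im _
  have e (k : Fin n) : ‖z.1.1 k‖ ^ 2 = (z.1.1 k).re ^ 2 + (z.1.1 k).im ^ 2 := by
    rw [Complex.sq_norm, Complex.normSq_apply]; ring
  have e2 (k : Fin n) : (z.1.1 k ^ 2).re = (z.1.1 k).re ^ 2 - (z.1.1 k).im ^ 2 := by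
    rw [sq]; simp; ring
  refine Prod.ext ?_ ?_
  · ext k; simp [tubeMap, cpt, par, h1]
  · apply Complex.ext
    · have e3 (k : Fin n) : (((z.1.1 k).im : ℂ) ^ 2).im = 0 := by
        rw [← Complex.ofReal_pow, Complex.ofReal_im]
      simp [tubeMap, cpt, par, h1, e3]
    · simp only [tubeMap, cpt, par, h1, height, e]
      simp only [Complex.add_im, Complex.mul_im, Complex.re_sum, e2, Complex.I_re, Complex.I_im,
        Complex.ofReal_re, Complex.ofReal_im, Finset.sum_add_distrib, Finset.sum_sub_distrib]
      ring

lemma continuous_cpt : Continuous fun p : HSp n × HSp n => cpt p.1 p.2 := by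
  unfold cpt; fun_prop

lemma continuous_par : Continuous (par (n := n)) := by unfold par; fun_prop

lemma continuous_tubeMap : Continuous (tubeMap (n := n)) := by unfold tubeMap; fun_prop

lemma continuous_height : Continuous (height (n := n)) := by unfold height; fun_prop

lemma isOpen_siegel : IsOpen (siegel n) := isOpen_lt continuous_const continuous_height

lemma measurableSet_pos : MeasurableSet {t : HSp n | 0 < t.2} :=
  measurableSet_lt measurable_const measurable_snd

/-- A shear translates each fibre, hence preserves volume; the same reason serves `tubeMap`. -/
lemma measurePreserving_par : MeasurePreserving (par (n := n)) := by
  refine (MeasurePreserving.id (volume : Measure (Fin n → ℝ))).skew_product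
    (g := fun a c => c + 2 * ∑ k, a k ^ 2) (by fun_prop) (.of_forall fun a => ?_)
  exact (measurePreserving_add_right volume _).map_eq

lemma measurePreserving_tubeMap : MeasurePreserving (tubeMap (n := n)) := by
  refine (MeasurePreserving.id (volume : Measure (Fin n → ℂ))).skew_product
    (g := fun a c => c + Complex.I * ∑ k, a k ^ 2) (by fun_prop) (.of_forall fun a => ?_)
  exact (measurePreserving_add_right volume _).map_eq

lemma measurePreserving_re_add_I_mul_im :
    MeasurePreserving (fun p : ℝ × ℝ => (p.1 : ℂ) + Complex.I * p.2) := by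
  have h := Complex.volume_preserving_equiv_real_prod.symm
  convert h using 1
  ext p
  simp [Complex.measurableEquivRealProd, Complex.ext_iff]

lemma measurePreserving_prodProdProdComm {α β γ δ : Type*} [MeasureSpace α] [MeasureSpace β]
    [MeasureSpace γ] [MeasureSpace δ] [SigmaFinite (volume : Measure α)]
    [SigmaFinite (volume : Measure β)] [SigmaFinite (volume : Measure γ)]
    [SigmaFinite (volume : Measure δ)] :
    MeasurePreserving (fun p : (α × β) × (γ × δ) => ((p.2.1, p.1.1), (p.2.2, p.1.2))) := by
  have h1 : MeasurePreserving (fun p : β × γ × δ => (p.2.1, (p.1, p.2.2))) :=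
    (volume_preserving_prodAssoc (α₁ := γ) (β₁ := β) (γ₁ := δ)).comp
      ((Measure.measurePreserving_swap.prod (MeasurePreserving.id (volume : Measure δ))).comp
        (volume_preserving_prodAssoc (α₁ := β) (β₁ := γ) (γ₁ := δ)).symm)
  have h2 : MeasurePreserving (fun p : (α × β) × (γ × δ) => ((p.1.1, p.2.1), (p.1.2, p.2.2))) :=
    (volume_preserving_prodAssoc (α₁ := α) (β₁ := γ) (γ₁ := β × δ)).symm.comp
      (((MeasurePreserving.id (volume : Measure α)).prod h1).comp
        (volume_preserving_prodAssoc (α₁ := α) (β₁ := β) (γ₁ := γ × δ)))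
  exact (Measure.measurePreserving_swap.prod Measure.measurePreserving_swap).comp h2

lemma measurePreserving_cpt : MeasurePreserving (fun p : HSp n × HSp n => cpt p.1 p.2) := by
  have h1 : MeasurePreserving (fun p : (Fin n → ℝ) × (Fin n → ℝ) =>
      (fun k => (p.1 k : ℂ) + Complex.I * (p.2 k : ℂ))) :=
    (volume_preserving_pi (fun _ : Fin n => measurePreserving_re_add_I_mul_im)).comp
      (volume_measurePreserving_arrowProdEquivProdArrow ℝ ℝ (Fin n)).symm
  exact (h1.prod measurePreserving_re_add_I_mul_im).comp measurePreserving_prodProdProdComm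

lemma measurable_spt : Measurable fun p : HSp n × HSp n => spt p.1 p.2 := by
  apply Measurable.subtype_mk (f := fun p : HSp n × HSp n => (spt p.1 p.2).1)
  have : (fun p : HSp n × HSp n => (spt p.1 p.2).1) = fun p =>
      if 0 < p.1.2 then tubeMap (cpt (par p.1) p.2) else (0, Complex.I) := by
    ext p : 1; unfold spt; split_ifs <;> rfl
  rw [this]
  refine Measurable.ite (measurableSet_lt measurable_const (by fun_prop)) ?_ measurable_const
  exact (continuous_tubeMap.comp (continuous_cpt.comp
    ((continuous_par.comp continuous_fst).prodMk continuous_snd))).measurable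

/-- Two shears and the identification of `ℂ` with `ℝ²` have no Jacobian, so integrals over the
Siegel domain become iterated integrals over `y` and `x`, ready for Plancherel in `x`. -/
lemma measurePreserving_spt : MeasurePreserving (fun p : HSp n × HSp n => spt p.1 p.2)
    ((halfMeasure n).prod volume) (siegelMeasure n) := by
  have hS : MeasurableSet (siegel n) := isOpen_siegel.measurableSet
  have he : MeasurableEmbedding (Subtype.val : siegel n → _) := MeasurableEmbedding.subtype_coe hS
  have hφ : MeasurePreserving (fun p : HSp n × HSp n => tubeMap (cpt (par p.1) p.2)) :=
    measurePreserving_tubeMap.comp (measurePreserving_cpt.comp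
      (measurePreserving_par.prod (MeasurePreserving.id volume)))
  have hφ' := hφ.restrict_preimage hS
  have hpre : (fun p : HSp n × HSp n => tubeMap (cpt (par p.1) p.2)) ⁻¹' siegel n
      = {t : HSp n | 0 < t.2} ×ˢ Set.univ := by
    ext p; simp [siegel, height_tubeMap_cpt_par]
  have hm : (volume : Measure (HSp n × HSp n)).restrict ({t : HSp n | 0 < t.2} ×ˢ Set.univ) =
      (halfMeasure n).prod volume := by
    rw [Measure.volume_eq_prod, ← Measure.prod_restrict, Measure.restrict_univ]
  rw [hpre, hm] at hφ'
  refine ⟨measurable_spt, ?_⟩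
  rw [← he.comap_map (Measure.map _ _), Measure.map_map measurable_subtype_coe measurable_spt,
    siegelMeasure]
  have hae : (Subtype.val ∘ fun p : HSp n × HSp n => spt p.1 p.2)
      =ᵐ[(halfMeasure n).prod volume] fun p => tubeMap (cpt (par p.1) p.2) := by
    rw [← hm]
    filter_upwards [ae_restrict_mem (measurableSet_pos.prod MeasurableSet.univ)] with p hp
    exact coe_spt hp.1 _
  rw [Measure.map_congr hae, hφ'.map_eq]
  ext A hA
  rw [he.comap_apply, he.comap_apply, Measure.restrict_apply (he.measurableSet_image.2 hA)]
  congr 1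
  simp

end Tube
end SuperSiegel

end

noncomputable section
namespace SuperSiegel
open Filter Topology

/-! ### The real kernel of the transform and the scaling `ζ = (2√ξ u', ξ)`. -/

section Kernel
variable {n : ℕ}

lemma halfMeasure_eq_prod :
    halfMeasure n = (volume : Measure (Fin n → ℝ)).prod (volume.restrict (Set.Ioi (0 : ℝ))) := by
  have : {t : HSp n | 0 < t.2} = Set.univ ×ˢ Set.Ioi 0 := by ext t; simp
  rw [halfMeasure, this, Measure.volume_eq_prod, ← Measure.prod_restrict, Measure.restrict_univ]

lemma ae_half : ∀ᵐ t ∂(halfMeasure n), 0 < t.2 := ae_restrict_mem measurableSet_pos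

lemma lintegral_pow_mul_comp_smul {c : ℝ} (hc : 0 < c) {g : (Fin n → ℝ) → ENNReal}
    (hg : Measurable g) : ∫⁻ u, ENNReal.ofReal (c ^ n) * g (c • u) = ∫⁻ u, g u := by
  have h := Measure.map_addHaar_smul (volume : Measure (Fin n → ℝ)) hc.ne'
  have h2 : ∫⁻ u, g (c • u) = ∫⁻ u, g u ∂(Measure.map (c • ·) volume) :=
    (lintegral_map hg (by fun_prop)).symm
  rw [lintegral_const_mul _ (by fun_prop), h2, h, lintegral_smul_measure]
  simp only [Module.finrank_fintype_fun_eq_card, Fintype.card_fin, smul_eq_mul]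
  rw [← mul_assoc, ← ENNReal.ofReal_mul (by positivity), abs_of_pos (by positivity),
    mul_inv_cancel₀ (by positivity), ENNReal.ofReal_one, one_mul]

lemma lintegral_gaussian_pi :
    ∫⁻ u : Fin n → ℝ, ENNReal.ofReal (Real.exp (-∑ k, u k ^ 2)) =
      ENNReal.ofReal (Real.pi ^ ((n : ℝ) / 2)) := by
  have h1 : Integrable (fun x : ℝ => Real.exp (-x ^ 2)) := by
    simpa using integrable_exp_neg_mul_sq (b := 1) one_pos
  have e (u : Fin n → ℝ) : Real.exp (-∑ k, u k ^ 2) = ∏ k, Real.exp (-u k ^ 2) := by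
    rw [← Finset.sum_neg_distrib, Real.exp_sum]
  simp only [e]
  have h2 : Integrable (fun u : Fin n → ℝ => ∏ k, Real.exp (-u k ^ 2)) :=
    Integrable.fintype_prod (fun _ => h1)
  rw [← ofReal_integral_eq_lintegral_ofReal h2
    (.of_forall fun u => Finset.prod_nonneg fun _ _ => (Real.exp_pos _).le),
    integral_fintype_prod_volume_eq_pow (fun x => Real.exp (-x ^ 2))]
  have h2 := integral_gaussian 1
  simp only [neg_mul, one_mul, div_one] at h2
  rw [h2, Fintype.card_fin, Real.sqrt_eq_rpow, ← Real.rpow_natCast, ← Real.rpow_mul Real.pi_pos.le]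
  congr 2; ring

lemma lintegral_rpow_mul_exp {s r : ℝ} (hs : 0 < s) (hr : 0 < r) :
    ∫⁻ h in Set.Ioi (0 : ℝ), ENNReal.ofReal (h ^ (s - 1) * Real.exp (-(r * h))) =
      ENNReal.ofReal ((1 / r) ^ s * Real.Gamma s) := by
  rw [← Real.integral_rpow_mul_exp_neg_mul_Ioi hs hr, ofReal_integral_eq_lintegral_ofReal]
  · have := integrableOn_rpow_mul_exp_neg_mul_rpow (p := 1) (s := s - 1) (by linarith) one_pos hr
    simpa [IntegrableOn] using this
  · filter_upwards [ae_restrict_mem measurableSet_Ioi] with h hh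
    have : (0 : ℝ) < h := hh
    positivity

/-- The real factor of the embedding `R_{0,ν}` in the coordinates `y = (y', h)` and `t = (u', ξ)`,
where `v' = u' + 2 √ξ y'`. -/
def bk (l : ℝ) (y t : HSp n) : ℝ :=
  Real.pi ^ (-(n : ℝ) / 4) *
    Real.exp (-t.2 * y.2 - (∑ k, (t.1 k + 2 * Real.sqrt t.2 * y.1 k) ^ 2) / 2) *
    Real.sqrt (4 * (2 * t.2) ^ (l - (n + 1)) / (bergmanConst n l * Real.Gamma (l - (n + 1))))

/-- The scaling density `(2√ξ)^{p-1}`. -/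
def dens (t : HSp n) : ℝ := (2 * Real.sqrt t.2) ^ n

lemma dens_nonneg (t : HSp n) : 0 ≤ dens t := by unfold dens; positivity

lemma measurable_dens : Measurable (dens (n := n)) := by unfold dens; fun_prop

lemma measurable_bk (l : ℝ) : Measurable fun p : HSp n × HSp n => bk l p.1 p.2 := by
  unfold bk; fun_prop

/-- The scaled measure `(2√ξ)^{p-1} du' dξ`. -/
def scaledMeasure (n : ℕ) : Measure (HSp n) :=
  (halfMeasure n).withDensity fun t => ENNReal.ofReal (dens t)

/-- The scaling `(u', ξ) ↦ (2√ξ u', ξ)`. -/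
def scaleUp (t : HSp n) : HSp n := ((2 * Real.sqrt t.2) • t.1, t.2)

/-- The scaling `(η, ξ) ↦ (η/(2√ξ), ξ)`. -/
def scaleDown (t : HSp n) : HSp n := (fun k => t.1 k / (2 * Real.sqrt t.2), t.2)

lemma scaleDown_scaleUp {t : HSp n} (ht : 0 < t.2) : scaleDown (scaleUp t) = t := by
  have := (Real.sqrt_pos.2 ht).ne'
  refine Prod.ext ?_ rfl
  ext k; simp [scaleDown, scaleUp]; field_simp

lemma scaleUp_scaleDown {t : HSp n} (ht : 0 < t.2) : scaleUp (scaleDown t) = t := by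
  have := (Real.sqrt_pos.2 ht).ne'
  refine Prod.ext ?_ rfl
  ext k; simp [scaleDown, scaleUp]; field_simp

lemma measurable_scaleUp : Measurable (scaleUp (n := n)) := by unfold scaleUp; fun_prop

lemma measurable_scaleDown : Measurable (scaleDown (n := n)) := by unfold scaleDown; fun_prop

/-- For fixed `ξ` this is a dilation of `ℝ^{p-1}` by `2√ξ`, whose Jacobian is `dens`. -/
lemma measurePreserving_scaleUp :
    MeasurePreserving scaleUp (scaledMeasure n) (halfMeasure n) := by
  refine ⟨measurable_scaleUp, ?_⟩
  ext A hA
  rw [Measure.map_apply measurable_scaleUp hA, scaledMeasure,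
    withDensity_apply _ (measurable_scaleUp hA), ← lintegral_indicator (measurable_scaleUp hA),
    ← lintegral_indicator_one hA, halfMeasure_eq_prod]
  have hm : Measurable ((scaleUp ⁻¹' A).indicator fun t : HSp n => ENNReal.ofReal (dens t)) :=
    measurable_dens.ennreal_ofReal.indicator (measurable_scaleUp hA)
  rw [lintegral_prod_symm _ hm.aemeasurable,
    lintegral_prod_symm _ (measurable_one.indicator hA).aemeasurable]
  refine setLIntegral_congr_fun measurableSet_Ioi fun ξ hξ => ?_
  have hs : 0 < 2 * Real.sqrt ξ := by have := Real.sqrt_pos.2 hξ; positivity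
  have hg : Measurable fun u : Fin n → ℝ => A.indicator (1 : HSp n → ENNReal) (u, ξ) :=
    (measurable_one.indicator hA).comp (by fun_prop)
  rw [← lintegral_pow_mul_comp_smul hs hg]
  refine lintegral_congr fun u => ?_
  by_cases h : scaleUp (u, ξ) ∈ A
  · rw [Set.indicator_of_mem (show (u, ξ) ∈ scaleUp ⁻¹' A from h)]
    have h' : ((2 * Real.sqrt ξ) • u, ξ) ∈ A := h
    simp [h', dens]
  · rw [Set.indicator_of_notMem (show (u, ξ) ∉ scaleUp ⁻¹' A from h)]
    have h' : ((2 * Real.sqrt ξ) • u, ξ) ∉ A := h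
    simp [h']

lemma scaledMeasure_absolutelyContinuous : scaledMeasure n ≪ halfMeasure n :=
  withDensity_absolutelyContinuous _ _

lemma measurePreserving_scaleDown :
    MeasurePreserving scaleDown (halfMeasure n) (scaledMeasure n) := by
  refine ⟨measurable_scaleDown, ?_⟩
  rw [← measurePreserving_scaleUp.map_eq, Measure.map_map measurable_scaleDown measurable_scaleUp]
  have : (scaleDown ∘ scaleUp : HSp n → HSp n) =ᵐ[scaledMeasure n] id := by
    filter_upwards [scaledMeasure_absolutelyContinuous.ae_le ae_half] with t ht
      using scaleDown_scaleUp ht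
  rw [Measure.map_congr this, Measure.map_id]

/-- Needed because `f` is only an almost everywhere class: its composition with `scaleDown` must not
depend on null sets. -/
lemma quasiMeasurePreserving_scaleDown :
    Measure.QuasiMeasurePreserving scaleDown (halfMeasure n) (halfMeasure n) :=
  ⟨measurable_scaleDown, by
    rw [measurePreserving_scaleDown.map_eq]; exact scaledMeasure_absolutelyContinuous⟩

lemma integral_half_eq {F : HSp n → ℂ} (hF : AEStronglyMeasurable F (halfMeasure n)) :
    ∫ ζ, F ζ ∂(halfMeasure n) = ∫ t, (dens t : ℂ) * F (scaleUp t) ∂(halfMeasure n) := by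
  conv_lhs => rw [← measurePreserving_scaleUp.map_eq]
  rw [integral_map measurable_scaleUp.aemeasurable
    (by rw [measurePreserving_scaleUp.map_eq]; exact hF), scaledMeasure,
    integral_withDensity_eq_integral_toReal_smul measurable_dens.ennreal_ofReal
      (.of_forall fun _ => ENNReal.ofReal_lt_top)]
  refine integral_congr_ae (.of_forall fun t => ?_)
  simp only [ENNReal.toReal_ofReal (dens_nonneg t), Complex.real_smul]

lemma integrable_half_iff {F : HSp n → ℂ} (hF : AEStronglyMeasurable F (halfMeasure n)) :
    Integrable F (halfMeasure n) ↔
      Integrable (fun t => (dens t : ℂ) * F (scaleUp t)) (halfMeasure n) := by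
  rw [← measurePreserving_scaleUp.integrable_comp hF, scaledMeasure,
    integrable_withDensity_iff_integrable_smul' measurable_dens.ennreal_ofReal
      (.of_forall fun _ => ENNReal.ofReal_lt_top)]
  simp only [ENNReal.toReal_ofReal (dens_nonneg _), Complex.real_smul, Function.comp_def]

lemma lintegral_half_eq {F : HSp n → ENNReal} (hF : AEMeasurable F (halfMeasure n)) :
    ∫⁻ ζ, F ζ ∂(halfMeasure n) =
      ∫⁻ t, ENNReal.ofReal (dens t) * F (scaleUp t) ∂(halfMeasure n) := by
  conv_lhs => rw [← measurePreserving_scaleUp.map_eq]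
  have hF' : AEMeasurable (fun t => F (scaleUp t)) (scaledMeasure n) :=
    AEMeasurable.comp_quasiMeasurePreserving hF measurePreserving_scaleUp.quasiMeasurePreserving
  rw [lintegral_map' (by rw [measurePreserving_scaleUp.map_eq]; exact hF)
    measurable_scaleUp.aemeasurable, scaledMeasure,
    lintegral_withDensity_eq_lintegral_mul₀' measurable_dens.ennreal_ofReal.aemeasurable hF']
  rfl

end Kernel
end SuperSiegel

end

noncomputable section
namespace SuperSiegel
open Filter Topology

/-! ### Gaussian and Gamma integrals of the kernel. -/

section KernelIntegrals
variable {n : ℕ}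

/-- The constant `c_ν Γ(ν - p) = Γ(ν) / π^p`. -/
def cc (n : ℕ) (l : ℝ) : ℝ := bergmanConst n l * Real.Gamma (l - (n + 1))

lemma bergmanConst_pos {l : ℝ} (hl : (n : ℝ) + 1 < l) : 0 < bergmanConst n l := by
  have h1 : 0 < Real.Gamma l := Real.Gamma_pos_of_pos (by linarith [(Nat.cast_nonneg n : (0:ℝ) ≤ n)])
  have h2 : 0 < Real.Gamma (l - (n + 1)) := Real.Gamma_pos_of_pos (by linarith)
  have := Real.pi_pos
  unfold bergmanConst; positivity

lemma cc_pos {l : ℝ} (hl : (n : ℝ) + 1 < l) : 0 < cc n l :=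
  mul_pos (bergmanConst_pos hl) (Real.Gamma_pos_of_pos (by linarith))

lemma bk_nonneg (l : ℝ) (y t : HSp n) : 0 ≤ bk l y t := by unfold bk; positivity

lemma bk_pos {l : ℝ} (hl : (n : ℝ) + 1 < l) (y : HSp n) {t : HSp n} (ht : 0 < t.2) :
    0 < bk l y t := by
  have := cc_pos hl
  have : 0 < 4 * (2 * t.2) ^ (l - (n + 1)) / cc n l := by positivity
  have := Real.sqrt_pos.2 this
  have := Real.pi_pos
  unfold bk; unfold cc at *; positivity

lemma bk_sq {l : ℝ} (hl : (n : ℝ) + 1 < l) (y : HSp n) {t : HSp n} (ht : 0 < t.2) :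
    bk l y t ^ 2 = Real.pi ^ (-(n : ℝ) / 2) * (4 * (2 * t.2) ^ (l - (n + 1)) / cc n l) *
      (Real.exp (-(2 * t.2 * y.2)) *
        Real.exp (-∑ k, (t.1 k + 2 * Real.sqrt t.2 * y.1 k) ^ 2)) := by
  have h := cc_pos hl
  have h3 : 0 ≤ 4 * (2 * t.2) ^ (l - (n + 1)) / cc n l := by positivity
  unfold bk
  unfold cc at *
  rw [mul_pow, mul_pow, Real.sq_sqrt h3, ← Real.exp_add, sq (Real.exp _), ← Real.exp_add,
    ← Real.rpow_natCast, ← Real.rpow_mul Real.pi_pos.le]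
  rw [show -t.2 * y.2 - (∑ k, (t.1 k + 2 * Real.sqrt t.2 * y.1 k) ^ 2) / 2 +
    (-t.2 * y.2 - (∑ k, (t.1 k + 2 * Real.sqrt t.2 * y.1 k) ^ 2) / 2) =
    -(2 * t.2 * y.2) + -∑ k, (t.1 k + 2 * Real.sqrt t.2 * y.1 k) ^ 2 by ring]
  rw [show -(n : ℝ) / 4 * ((2 : ℕ) : ℝ) = -(n : ℝ) / 2 by push_cast; ring]
  ring

/-- The squared kernel `(2√ξ)^{p-1} b(y, t)²`. -/
def kk (l : ℝ) (y t : HSp n) : ℝ := dens t * bk l y t ^ 2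

lemma kk_nonneg (l : ℝ) (y t : HSp n) : 0 ≤ kk l y t := mul_nonneg (dens_nonneg t) (sq_nonneg _)

lemma measurable_kk (l : ℝ) : Measurable fun p : HSp n × HSp n => kk l p.1 p.2 := by
  unfold kk
  exact (measurable_dens.comp measurable_snd).mul ((measurable_bk l).pow_const 2)

lemma lintegral_shifted_gaussian {c : ℝ} (hc : 0 < c) (u : Fin n → ℝ) :
    ∫⁻ y : Fin n → ℝ, ENNReal.ofReal (c ^ n * Real.exp (-∑ k, (u k + c * y k) ^ 2)) =
      ENNReal.ofReal (Real.pi ^ ((n : ℝ) / 2)) := by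
  have h := lintegral_add_left_eq_self (μ := (volume : Measure (Fin n → ℝ)))
    (fun v => ENNReal.ofReal (Real.exp (-∑ k, v k ^ 2))) u
  have h2 := lintegral_pow_mul_comp_smul hc
    (g := fun v : Fin n → ℝ => ENNReal.ofReal (Real.exp (-∑ k, (u + v) k ^ 2)))
    (by simp only [Pi.add_apply]; fun_prop)
  rw [← lintegral_gaussian_pi, ← h, ← h2]
  refine lintegral_congr fun y => ?_
  rw [ENNReal.ofReal_mul (by positivity)]
  simp

lemma pi_rpow_mul : Real.pi ^ (-(n : ℝ) / 2) * Real.pi ^ ((n : ℝ) / 2) = 1 := by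
  rw [← Real.rpow_add Real.pi_pos, show -(n : ℝ) / 2 + n / 2 = 0 by ring, Real.rpow_zero]

/-- In `y'` the squared kernel is a shifted Gaussian, and its factor `(2√ξ)^n` makes the integral
over `y'` independent of `t`. What remains is a Gamma integral in `h` with rate `2ξ`. -/
lemma lintegral_rpow_mul_kk {l s : ℝ} (hl : (n : ℝ) + 1 < l) (hs : 0 < s) {t : HSp n}
    (ht : 0 < t.2) :
    ∫⁻ y, ENNReal.ofReal (y.2 ^ (s - 1)) * ENNReal.ofReal (kk l y t) ∂(halfMeasure n) =
      ENNReal.ofReal (4 * (2 * t.2) ^ (l - (n + 1)) / cc n l *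
        ((1 / (2 * t.2)) ^ s * Real.Gamma s)) := by
  have hc := cc_pos hl
  have hsq : 0 < 2 * Real.sqrt t.2 := by have := Real.sqrt_pos.2 ht; positivity
  have hk : Measurable fun y : HSp n => kk l y t :=
    (measurable_kk l).comp (by fun_prop : Measurable fun y : HSp n => (y, t))
  have hm : Measurable fun y : HSp n =>
      ENNReal.ofReal (y.2 ^ (s - 1)) * ENNReal.ofReal (kk l y t) := by fun_prop
  rw [halfMeasure_eq_prod, lintegral_prod_symm _ hm.aemeasurable]
  have e (h : ℝ) (hh : h ∈ Set.Ioi (0 : ℝ)) : ∫⁻ y' : Fin n → ℝ,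
      ENNReal.ofReal (h ^ (s - 1)) * ENNReal.ofReal (kk l (y', h) t) =
      ENNReal.ofReal (4 * (2 * t.2) ^ (l - (n + 1)) / cc n l) *
        ENNReal.ofReal (h ^ (s - 1) * Real.exp (-(2 * t.2 * h))) := by
    have hh' : (0 : ℝ) < h := hh
    have e1 (y' : Fin n → ℝ) : ENNReal.ofReal (h ^ (s - 1)) * ENNReal.ofReal (kk l (y', h) t) =
        ENNReal.ofReal (Real.pi ^ (-(n : ℝ) / 2) * (4 * (2 * t.2) ^ (l - (n + 1)) / cc n l) *
          (h ^ (s - 1) * Real.exp (-(2 * t.2 * h)))) *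
        ENNReal.ofReal ((2 * Real.sqrt t.2) ^ n *
          Real.exp (-∑ k, (t.1 k + 2 * Real.sqrt t.2 * y' k) ^ 2)) := by
      rw [← ENNReal.ofReal_mul (by positivity), ← ENNReal.ofReal_mul (by positivity), kk, dens,
        bk_sq hl _ ht]
      congr 1
      ring
    simp only [e1]
    rw [lintegral_const_mul _ (by fun_prop), lintegral_shifted_gaussian hsq,
      ← ENNReal.ofReal_mul (by positivity), ← ENNReal.ofReal_mul (by positivity)]
    congr 1
    linear_combination (4 * (2 * t.2) ^ (l - (n + 1)) / cc n l) *
      (h ^ (s - 1) * Real.exp (-(2 * t.2 * h))) * pi_rpow_mul (n := n)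
  rw [setLIntegral_congr_fun measurableSet_Ioi e, lintegral_const_mul _ (by fun_prop),
    lintegral_rpow_mul_exp hs (by positivity), ← ENNReal.ofReal_mul (by positivity)]

lemma lintegral_gaussian_pi_lt_top {b : ℝ} (hb : 0 < b) :
    ∫⁻ u : Fin n → ℝ, ENNReal.ofReal (Real.exp (-b * ∑ k, u k ^ 2)) < ⊤ := by
  have h2 : Integrable (fun u : Fin n → ℝ => ∏ k, Real.exp (-b * u k ^ 2)) :=
    Integrable.fintype_prod (fun _ => integrable_exp_neg_mul_sq hb)
  have e (u : Fin n → ℝ) : Real.exp (-b * ∑ k, u k ^ 2) = ∏ k, Real.exp (-b * u k ^ 2) := by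
    rw [Finset.mul_sum, Real.exp_sum]
  simp only [e]
  exact h2.lintegral_lt_top

/-- The kernel `b(y, t)` with the Gaussian of width `1/2` replaced by one of width `b`. -/
def gk (l b : ℝ) (y t : HSp n) : ℝ :=
  Real.exp (-t.2 * y.2 - b * (∑ k, (t.1 k + 2 * Real.sqrt t.2 * y.1 k) ^ 2)) *
    Real.sqrt (4 * (2 * t.2) ^ (l - (n + 1)) / cc n l)

lemma bk_eq_gk (l : ℝ) (y t : HSp n) :
    bk l y t = Real.pi ^ (-(n : ℝ) / 4) * gk l (1 / 2) y t := by
  unfold bk gk cc; rw [mul_assoc]; congr 4; ring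

lemma measurable_gk (l b : ℝ) : Measurable fun p : HSp n × HSp n => gk l b p.1 p.2 := by
  unfold gk; fun_prop

/-- Here `y` is fixed and `t` varies: the Gaussian in `u'` integrates to a constant, and `ξ^{l-1}
e^{-2hξ}` is left, which is integrable as `h > 0`. A general width `b` is allowed so that the kernel
can later be dominated locally uniformly in `y`. -/
lemma memLp_dens_mul_gk {l b : ℝ} (hl : (n : ℝ) + 1 < l) (hb : 0 < b) {y : HSp n}
    (hy : 0 < y.2) : MemLp (fun t => dens t * gk l b y t) 2 (halfMeasure n) := by
  have hc := cc_pos hl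
  have hm : Measurable (fun t => dens t * gk l b y t) := measurable_dens.mul
    ((measurable_gk l b).comp (by fun_prop : Measurable fun t : HSp n => (y, t)))
  refine ⟨hm.aestronglyMeasurable, ?_⟩
  rw [eLpNorm_lt_top_iff_lintegral_rpow_enorm_lt_top two_ne_zero ENNReal.ofNat_ne_top]
  simp only [ENNReal.toReal_ofNat, ENNReal.rpow_ofNat]
  have hm2 : Measurable fun t : HSp n => ‖dens t * gk l b y t‖ₑ ^ 2 := (hm.enorm).pow_const 2
  rw [halfMeasure_eq_prod, lintegral_prod_symm _ hm2.aemeasurable]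
  set G : ENNReal := ∫⁻ u : Fin n → ℝ, ENNReal.ofReal (Real.exp (-(2 * b) * ∑ k, u k ^ 2)) with hG
  have hGt : G < ⊤ := lintegral_gaussian_pi_lt_top (by positivity)
  have e (x : ℝ) (hx : x ∈ Set.Ioi (0 : ℝ)) : ∫⁻ u : Fin n → ℝ,
      ‖dens (u, x) * gk l b y (u, x)‖ₑ ^ 2 = ENNReal.ofReal (4 * 2 ^ (l - (n + 1)) * 4 ^ n / cc n l) *
        ENNReal.ofReal (x ^ ((l - (n + 1) + n + 1) - 1) * Real.exp (-(2 * y.2 * x))) * G := by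
    have hx' : (0 : ℝ) < x := hx
    have e1 (u : Fin n → ℝ) : ‖dens (u, x) * gk l b y (u, x)‖ₑ ^ 2 =
        ENNReal.ofReal ((4 * 2 ^ (l - (n + 1)) * 4 ^ n / cc n l) *
          (x ^ ((l - (n + 1) + n + 1) - 1) * Real.exp (-(2 * y.2 * x)))) *
        ENNReal.ofReal (Real.exp (-(2 * b) * ∑ k, (u k + ((2 * Real.sqrt x) • y.1) k) ^ 2)) := by
      have h3 : 0 ≤ 4 * (2 * x) ^ (l - (n + 1)) / cc n l := by positivity
      rw [← ofReal_norm, ← ENNReal.ofReal_pow (norm_nonneg _), Real.norm_eq_abs, sq_abs,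
        ← ENNReal.ofReal_mul (by positivity), gk, mul_pow, mul_pow, Real.sq_sqrt h3,
        sq (Real.exp _), ← Real.exp_add, dens, ← pow_mul, mul_comm n 2,
        pow_mul, mul_pow 2, Real.sq_sqrt hx'.le, mul_pow, Real.mul_rpow (by norm_num) hx'.le,
        add_sub_cancel_right, Real.rpow_add hx', Real.rpow_natCast]
      congr 1
      simp only [Pi.smul_apply, smul_eq_mul, show (2 : ℝ) ^ 2 = 4 by norm_num]
      rw [show -x * y.2 - b * ∑ k, (u k + 2 * Real.sqrt x * y.1 k) ^ 2 +
        (-x * y.2 - b * ∑ k, (u k + 2 * Real.sqrt x * y.1 k) ^ 2) =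
        -(2 * y.2 * x) + -(2 * b) * ∑ k, (u k + 2 * Real.sqrt x * y.1 k) ^ 2 by ring, Real.exp_add]
      ring
    simp only [e1]
    have h4 := lintegral_add_right_eq_self (μ := (volume : Measure (Fin n → ℝ)))
      (fun u => ENNReal.ofReal (Real.exp (-(2 * b) * ∑ k, u k ^ 2))) ((2 * Real.sqrt x) • y.1)
    simp only [Pi.add_apply] at h4
    rw [lintegral_const_mul _ (by fun_prop), h4, ← hG, ENNReal.ofReal_mul (by positivity)]
  rw [setLIntegral_congr_fun measurableSet_Ioi e, lintegral_mul_const _ (by fun_prop),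
    lintegral_const_mul _ (by fun_prop),
    lintegral_rpow_mul_exp (by linarith [(Nat.cast_nonneg n : (0 : ℝ) ≤ n)]) (by positivity)]
  exact ENNReal.mul_lt_top (ENNReal.mul_lt_top ENNReal.ofReal_lt_top ENNReal.ofReal_lt_top) hGt

lemma memLp_dens_mul_bk {l : ℝ} (hl : (n : ℝ) + 1 < l) {y : HSp n} (hy : 0 < y.2) :
    MemLp (fun t => dens t * bk l y t) 2 (halfMeasure n) := by
  have h := (memLp_dens_mul_gk hl (b := 1 / 2) (by norm_num) hy).const_mul
    (Real.pi ^ (-(n : ℝ) / 4))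
  refine h.ae_eq (.of_forall fun t => ?_)
  simp only [bk_eq_gk]; ring

end KernelIntegrals

/-! ### Weighted measures. -/

section Weights
variable {n : ℕ}

/-- The weighted measure `v^{ν-p-1} dy' dv`. -/
def wHalf (n : ℕ) (l : ℝ) : Measure (HSp n) :=
  (halfMeasure n).withDensity fun y => ENNReal.ofReal (y.2 ^ (l - (n + 1) - 1))

/-- The weighted measure `ρ^{ν-p-1} dz` on the Siegel domain. -/
def wSiegel (n : ℕ) (l : ℝ) : Measure (siegel n) :=
  (siegelMeasure n).withDensity fun z => ENNReal.ofReal (height z.1 ^ (l - (n + 1) - 1))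

lemma measurable_wdens (l : ℝ) :
    Measurable fun y : HSp n => ENNReal.ofReal (y.2 ^ (l - (n + 1) - 1)) := by fun_prop

lemma measurable_wdens_siegel (l : ℝ) : Measurable fun z : siegel n =>
    ENNReal.ofReal (height z.1 ^ (l - (n + 1) - 1)) := by
  have : Measurable fun z : siegel n => height z.1 :=
    (continuous_height.comp continuous_subtype_val).measurable
  fun_prop

lemma ae_wHalf (l : ℝ) : ∀ᵐ y ∂(wHalf n l), 0 < y.2 :=
  (withDensity_absolutelyContinuous _ _).ae_le ae_half

instance (l : ℝ) : SigmaFinite (wHalf n l) :=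
  SigmaFinite.withDensity_of_ne_top (.of_forall fun _ => ENNReal.ofReal_ne_top)

lemma measurePreserving_spt_weighted (l : ℝ) :
    MeasurePreserving (fun p : HSp n × HSp n => spt p.1 p.2) ((wHalf n l).prod volume)
      (wSiegel n l) := by
  refine ⟨measurable_spt, ?_⟩
  rw [wHalf, prod_withDensity_left (measurable_wdens l)]
  ext A hA
  rw [Measure.map_apply measurable_spt hA, withDensity_apply _ (measurable_spt hA), wSiegel,
    withDensity_apply _ hA,
    ← measurePreserving_spt.setLIntegral_comp_preimage hA (measurable_wdens_siegel l)]
  refine setLIntegral_congr_fun_ae (measurable_spt hA) ?_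
  have : ∀ᵐ p ∂((halfMeasure n).prod (volume : Measure (HSp n))), 0 < p.1.2 :=
    Measure.quasiMeasurePreserving_fst.ae ae_half
  filter_upwards [this] with p hp _
  rw [height_spt hp]

end Weights
end SuperSiegel

end

noncomputable section
namespace SuperSiegel
open Filter Topology

/-! ### The transform as a Fourier integral on horizontal slices. -/

section Transform
variable {n : ℕ}

/-- The translation `(η, ξ) ↦ (η + 2ξ a, ξ)`. -/
def shiftEquiv (a : Fin n → ℝ) : HSp n ≃ᵐ HSp n where
  toFun ζ := (ζ.1 + (2 * ζ.2) • a, ζ.2)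
  invFun ζ := (ζ.1 - (2 * ζ.2) • a, ζ.2)
  left_inv ζ := by simp
  right_inv ζ := by simp
  measurable_toFun := by simp only [Equiv.coe_fn_mk]; fun_prop
  measurable_invFun := by simp only [Equiv.coe_fn_symm_mk]; fun_prop

lemma measurePreserving_shiftEquiv (a : Fin n → ℝ) : MeasurePreserving (shiftEquiv a) := by
  have h : MeasurePreserving (fun p : ℝ × (Fin n → ℝ) => (p.1, p.2 + (2 * p.1) • a)) := by
    refine (MeasurePreserving.id (volume : Measure ℝ)).skew_product
      (g := fun x c => c + (2 * x) • a) (by fun_prop) (.of_forall fun x => ?_)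
    exact (measurePreserving_add_right volume _).map_eq
  exact Measure.measurePreserving_swap.comp (h.comp Measure.measurePreserving_swap)

/-- The frequency slice of the transform at height `y = (y', h)`. -/
def slice (l : ℝ) (f : HSp n → ℂ) (y ζ : HSp n) : ℂ :=
  (bk l y (scaleDown ζ) : ℂ) * f (scaleDown ζ)

lemma slice_scaleUp (l : ℝ) (f : HSp n → ℂ) (y : HSp n) {t : HSp n} (ht : 0 < t.2) :
    slice l f y (scaleUp t) = (bk l y t : ℂ) * f t := by
  rw [slice, scaleDown_scaleUp ht]

/-- The normalization `(2π)^{-p/2}` of the unitary Fourier transform. -/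
def fc (n : ℕ) : ℝ := (2 * Real.pi) ^ (-((n : ℝ) + 1) / 2)

lemma fc_pos (n : ℕ) : 0 < fc n := by have := Real.pi_pos; unfold fc; positivity

lemma fc_sq_mul (n : ℕ) : fc n ^ 2 * (2 * Real.pi) ^ (n + 1) = 1 := by
  have := Real.pi_pos
  rw [fc, ← Real.rpow_natCast _ 2, ← Real.rpow_mul (by positivity), ← Real.rpow_natCast _ (n + 1),
    ← Real.rpow_add (by positivity)]
  convert Real.rpow_zero _ using 2
  push_cast; ring

/-- The substitution `ξ' = η + 2ξy'` does two things at once: it turns `u'` into `η/(2√ξ)`, free of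
`y'`, and it cancels the term `-2 x'·y'` of `Re z_p` in the phase. A pure inverse Fourier integral
in `x` remains. -/
lemma bargmannAdj_spt (l : ℝ) (f : HSp n → ℂ) {y : HSp n} (hy : 0 < y.2) (x : HSp n) :
    bargmannAdj l f (spt y x) =
      fc n * ∫ ζ, Complex.exp (Complex.I * (dot x ζ : ℂ)) * slice l f y ζ ∂(halfMeasure n) := by
  rw [bargmannAdj, fc, ← (measurePreserving_shiftEquiv y.1).setIntegral_preimage_emb
    (shiftEquiv y.1).measurableEmbedding]
  congr 1
  have hpre : shiftEquiv y.1 ⁻¹' {t : HSp n | 0 < t.2} = {t | 0 < t.2} := rfl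
  rw [hpre]
  refine setIntegral_congr_fun measurableSet_pos fun ζ hζ => ?_
  have hζ' : 0 < ζ.2 := hζ
  have hs := Real.sqrt_pos.2 hζ'
  have hsq := Real.mul_self_sqrt hζ'.le
  have hz1 (k : Fin n) : ((spt y x).1.1 k).re = x.1 k := by simp [coe_spt hy, tubeMap, cpt]
  have hz2 (k : Fin n) : ((spt y x).1.1 k).im = y.1 k := by simp [coe_spt hy, tubeMap, cpt, par]
  have hz3 : (spt y x).1.2.re = x.2 - 2 * ∑ k, x.1 k * y.1 k := by
    have e (k : Fin n) : (((x.1 k : ℂ) + Complex.I * (y.1 k : ℂ)) ^ 2).im = 2 * (x.1 k * y.1 k) := by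
      rw [sq]; simp; ring
    simp only [coe_spt hy, tubeMap, cpt, par, Complex.add_re, Complex.mul_re, Complex.im_sum, e,
      Complex.I_re, Complex.I_im, Complex.ofReal_re, Complex.ofReal_im, ← Finset.mul_sum]
    ring
  have hE (ζ' : HSp n) (h : ζ' = (ζ.1 + (2 * ζ.2) • y.1, ζ.2)) :
      (∑ k, x.1 k * ζ'.1 k) + (x.2 - 2 * ∑ k, x.1 k * y.1 k) * ζ'.2 = dot x ζ := by
    subst h
    simp only [dot, Pi.add_apply, Pi.smul_apply, smul_eq_mul, mul_add, Finset.sum_add_distrib]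
    have : ∑ k, x.1 k * (2 * ζ.2 * y.1 k) = 2 * ζ.2 * ∑ k, x.1 k * y.1 k := by
      rw [Finset.mul_sum]; exact Finset.sum_congr rfl fun k _ => by ring
    rw [this]; ring
  simp only [hz1, hz2, hz3, hE (shiftEquiv y.1 ζ) rfl, height_spt hy]
  congr 1
  have hu (k : Fin n) : (shiftEquiv y.1 ζ).1 k / (2 * Real.sqrt ζ.2) - Real.sqrt ζ.2 * y.1 k =
      ζ.1 k / (2 * Real.sqrt ζ.2) := by
    have : (shiftEquiv y.1 ζ).1 k = ζ.1 k + 2 * ζ.2 * y.1 k := rfl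
    rw [this, add_div]
    have : 2 * ζ.2 * y.1 k / (2 * Real.sqrt ζ.2) = Real.sqrt ζ.2 * y.1 k := by
      nth_rewrite 1 [← hsq]; field_simp
    rw [this]; ring
  have hv (k : Fin n) : (shiftEquiv y.1 ζ).1 k / (2 * Real.sqrt ζ.2) + Real.sqrt ζ.2 * y.1 k =
      ζ.1 k / (2 * Real.sqrt ζ.2) + 2 * Real.sqrt ζ.2 * y.1 k := by
    linear_combination hu k
  have h2 : (shiftEquiv y.1 ζ).2 = ζ.2 := rfl
  rw [h2]
  simp only [hu, hv, bargmannEmbed]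
  rfl

lemma aestronglyMeasurable_slice (l : ℝ) {f : HSp n → ℂ}
    (hf : AEStronglyMeasurable f (halfMeasure n)) (y : HSp n) :
    AEStronglyMeasurable (slice l f y) (halfMeasure n) := by
  refine AEStronglyMeasurable.mul ?_ (hf.comp_quasiMeasurePreserving
    quasiMeasurePreserving_scaleDown)
  refine (Complex.measurable_ofReal.comp ((measurable_bk l).comp (?_ : Measurable fun ζ : HSp n =>
    (y, scaleDown ζ)))).aestronglyMeasurable
  exact measurable_const.prodMk measurable_scaleDown

/-- Cauchy–Schwarz, valid at every height and not merely almost every one; this makes the transform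
a genuine function on the domain. -/
lemma integrable_dens_bk_mul {l : ℝ} (hl : (n : ℝ) + 1 < l) {f : HSp n → ℂ}
    (hf : MemLp f 2 (halfMeasure n)) {y : HSp n} (hy : 0 < y.2) :
    Integrable (fun t => ((dens t * bk l y t : ℝ) : ℂ) * f t) (halfMeasure n) :=
  MemLp.integrable_mul (memLp_dens_mul_bk hl hy).ofReal hf

lemma integrable_slice {l : ℝ} (hl : (n : ℝ) + 1 < l) {f : HSp n → ℂ}
    (hf : MemLp f 2 (halfMeasure n)) {y : HSp n} (hy : 0 < y.2) :
    Integrable (slice l f y) (halfMeasure n) := by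
  rw [integrable_half_iff (aestronglyMeasurable_slice l hf.1 y)]
  refine (integrable_dens_bk_mul hl hf hy).congr ?_
  filter_upwards [ae_half] with t ht
  rw [slice_scaleUp l f y ht]; push_cast; ring

/-- The transform as an integral in the variables `(u', ξ)`. -/
lemma bargmannAdj_spt_eq (l : ℝ) {f : HSp n → ℂ} (hf : AEStronglyMeasurable f (halfMeasure n))
    {y : HSp n} (hy : 0 < y.2) (x : HSp n) :
    bargmannAdj l f (spt y x) = fc n * ∫ t, Complex.exp (Complex.I * (dot x (scaleUp t) : ℂ)) *
      (((dens t * bk l y t : ℝ) : ℂ) * f t) ∂(halfMeasure n) := by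
  rw [bargmannAdj_spt l f hy, integral_half_eq]
  · congr 1
    refine integral_congr_ae ?_
    filter_upwards [ae_half] with t ht
    rw [slice_scaleUp l f y ht]; push_cast; ring
  · refine AEStronglyMeasurable.mul ?_ (aestronglyMeasurable_slice l hf y)
    have : Continuous fun ζ : HSp n => dot x ζ :=
      continuous_dot.comp (continuous_const.prodMk continuous_id)
    exact Continuous.aestronglyMeasurable (by fun_prop)

lemma integrable_exp_mul {l : ℝ} (hl : (n : ℝ) + 1 < l) {f : HSp n → ℂ}
    (hf : MemLp f 2 (halfMeasure n)) {y : HSp n} (hy : 0 < y.2) (x : HSp n) :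
    Integrable (fun t => Complex.exp (Complex.I * (dot x (scaleUp t) : ℂ)) *
      (((dens t * bk l y t : ℝ) : ℂ) * f t)) (halfMeasure n) := by
  have hm : Measurable fun t : HSp n => dot x (scaleUp t) :=
    (continuous_dot.measurable.comp (measurable_const.prodMk measurable_scaleUp))
  refine (integrable_dens_bk_mul hl hf hy).bdd_mul (c := 1) ?_ (.of_forall fun t => ?_)
  · exact Measurable.aestronglyMeasurable (by fun_prop)
  · rw [mul_comm, Complex.norm_exp_ofReal_mul_I]

/-- The full frequency slice on `ℝ^{p-1} × ℝ`. -/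
def fullSlice (l : ℝ) (f : HSp n → ℂ) (y : HSp n) : HSp n → ℂ :=
  {t : HSp n | 0 < t.2}.indicator (slice l f y)

lemma bargmannAdj_spt_eq_ft (l : ℝ) (f : HSp n → ℂ) {y : HSp n} (hy : 0 < y.2) (x : HSp n) :
    bargmannAdj l f (spt y x) = fc n * ft (fullSlice l f y) x := by
  rw [bargmannAdj_spt l f hy, ft, ← integral_indicator measurableSet_pos]
  congr 2
  ext ζ
  by_cases h : 0 < ζ.2 <;> simp [fullSlice, h]

lemma integrable_fullSlice {l : ℝ} (hl : (n : ℝ) + 1 < l) {f : HSp n → ℂ}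
    (hf : MemLp f 2 (halfMeasure n)) {y : HSp n} (hy : 0 < y.2) :
    Integrable (fullSlice l f y) :=
  (integrable_indicator_iff measurableSet_pos).2 (integrable_slice hl hf hy)

lemma lintegral_enorm_fullSlice_sq (l : ℝ) {f : HSp n → ℂ}
    (hf : AEStronglyMeasurable f (halfMeasure n)) (y : HSp n) :
    ∫⁻ ζ, ‖fullSlice l f y ζ‖ₑ ^ 2 =
      ∫⁻ t, ENNReal.ofReal (kk l y t) * ‖f t‖ₑ ^ 2 ∂(halfMeasure n) := by
  have e (ζ : HSp n) : ‖fullSlice l f y ζ‖ₑ ^ 2 =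
      {t : HSp n | 0 < t.2}.indicator (fun ζ => ‖slice l f y ζ‖ₑ ^ 2) ζ := by
    by_cases h : 0 < ζ.2 <;> simp [fullSlice, h]
  simp only [e]
  rw [lintegral_indicator measurableSet_pos,
    lintegral_half_eq ((aestronglyMeasurable_slice l hf y).enorm.pow_const 2)]
  refine lintegral_congr_ae ?_
  filter_upwards [ae_half] with t ht
  rw [slice_scaleUp l f y ht, kk, enorm_mul, mul_pow, ← mul_assoc,
    ENNReal.ofReal_mul (dens_nonneg t), ← ofReal_norm (bk l y t : ℂ),
    ← ENNReal.ofReal_pow (norm_nonneg _), Complex.norm_real, Real.norm_eq_abs, sq_abs]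

lemma integral_conj_fullSlice_mul (l : ℝ) {f g : HSp n → ℂ}
    (hf : AEStronglyMeasurable f (halfMeasure n)) (hg : AEStronglyMeasurable g (halfMeasure n))
    (y : HSp n) : ∫ ζ, conj (fullSlice l f y ζ) * fullSlice l g y ζ =
      ∫ t, (kk l y t : ℂ) * (conj (f t) * g t) ∂(halfMeasure n) := by
  have e (ζ : HSp n) : conj (fullSlice l f y ζ) * fullSlice l g y ζ =
      {t : HSp n | 0 < t.2}.indicator (fun ζ => conj (slice l f y ζ) * slice l g y ζ) ζ := by
    by_cases h : 0 < ζ.2 <;> simp [fullSlice, h]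
  simp only [e]
  rw [integral_indicator measurableSet_pos, integral_half_eq]
  · refine integral_congr_ae ?_
    filter_upwards [ae_half] with t ht
    rw [slice_scaleUp l f y ht, slice_scaleUp l g y ht, kk, map_mul, Complex.conj_ofReal]
    push_cast; ring
  · exact (continuous_star.comp_aestronglyMeasurable (aestronglyMeasurable_slice l hf y)).mul
      (aestronglyMeasurable_slice l hg y)

end Transform
end SuperSiegel

end

noncomputable section
namespace SuperSiegel
open Filter Topology

/-! ### Holomorphy of the transform. -/

section Holomorphy
variable {n : ℕ}

/-- The coordinates `(Im z', Im z_p - |z'|²)`. -/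
def yc (z : (Fin n → ℂ) × ℂ) : HSp n := (fun k => (z.1 k).im, height z)

lemma continuous_yc : Continuous (yc (n := n)) := by
  have := continuous_height (n := n); unfold yc; fun_prop

lemma yc_spt {y : HSp n} (hy : 0 < y.2) (x : HSp n) : yc (spt y x).1 = y := by
  refine Prod.ext ?_ (height_spt hy x)
  ext k; simp [yc, coe_spt hy, tubeMap, cpt, par]

lemma exists_spt_yc (z : siegel n) : ∃ x : HSp n, z = spt (yc z.1) x := by
  obtain ⟨y, x, -, h, rfl⟩ := exists_eq_spt z
  exact ⟨x, h⟩

lemma yc_pos (z : siegel n) : 0 < (yc z.1).2 := z.2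

/-- The holomorphic phase of the transform. -/
def phase (t : HSp n) (z : (Fin n → ℂ) × ℂ) : ℂ :=
  Complex.I * t.2 * z.2 + 2 * Complex.I * Real.sqrt t.2 * (∑ k, (t.1 k : ℂ) * z.1 k) +
    t.2 * (∑ k, z.1 k ^ 2) - (∑ k, (t.1 k : ℂ) ^ 2) / 2

/-- The amplitude of the transform. -/
def amp (l : ℝ) (t : HSp n) : ℝ :=
  Real.pi ^ (-(n : ℝ) / 4) * Real.sqrt (4 * (2 * t.2) ^ (l - (n + 1)) / cc n l)

/-- Expanding the square in the Gaussian, the terms in `x` and `y` combine into a polynomial in `z`: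
this is why the image consists of holomorphic functions. -/
lemma exp_mul_bk_eq (l : ℝ) {y : HSp n} (hy : 0 < y.2) (x : HSp n) {t : HSp n} (ht : 0 < t.2) :
    Complex.exp (Complex.I * (dot x (scaleUp t) : ℂ)) * (bk l y t : ℂ) =
      amp l t * Complex.exp (phase t (spt y x).1) := by
  have hI := Complex.I_sq
  have hs : (Real.sqrt t.2 : ℂ) ^ 2 = t.2 := by
    rw [← Complex.ofReal_pow, Real.sq_sqrt ht.le]
  have e1 : (bk l y t : ℂ) = amp l t * Complex.exp ((-t.2 * y.2 -
      (∑ k, (t.1 k + 2 * Real.sqrt t.2 * y.1 k) ^ 2) / 2 : ℝ) : ℂ) := by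
    rw [← Complex.ofReal_exp, ← Complex.ofReal_mul]; congr 1; unfold bk amp cc; ring
  have e2 : Complex.I * (dot x (scaleUp t) : ℂ) + ((-t.2 * y.2 -
      (∑ k, (t.1 k + 2 * Real.sqrt t.2 * y.1 k) ^ 2) / 2 : ℝ) : ℂ) = phase t (spt y x).1 := by
    have h1 : (dot x (scaleUp t) : ℂ) =
        2 * Real.sqrt t.2 * (∑ k, (t.1 k : ℂ) * x.1 k) + x.2 * t.2 := by
      simp only [dot, scaleUp, Pi.smul_apply, smul_eq_mul]
      push_cast
      rw [Finset.mul_sum]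
      congr 1
      exact Finset.sum_congr rfl fun k _ => by ring
    have h2 : ((∑ k, (t.1 k + 2 * Real.sqrt t.2 * y.1 k) ^ 2 : ℝ) : ℂ) =
        (∑ k, (t.1 k : ℂ) ^ 2) + 4 * Real.sqrt t.2 * (∑ k, (t.1 k : ℂ) * y.1 k) +
          4 * t.2 * ∑ k, (y.1 k : ℂ) ^ 2 := by
      push_cast
      rw [Finset.mul_sum, Finset.mul_sum, ← Finset.sum_add_distrib, ← Finset.sum_add_distrib]
      refine Finset.sum_congr rfl fun k _ => ?_
      linear_combination 4 * (y.1 k : ℂ) ^ 2 * hs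
    have h3 : (∑ k, (t.1 k : ℂ) * ((x.1 k : ℂ) + Complex.I * (y.1 k : ℂ))) =
        (∑ k, (t.1 k : ℂ) * x.1 k) + Complex.I * ∑ k, (t.1 k : ℂ) * y.1 k := by
      rw [Finset.mul_sum, ← Finset.sum_add_distrib]
      exact Finset.sum_congr rfl fun k _ => by ring
    push_cast [h1, h2] at *
    rw [h2]
    simp only [coe_spt hy, tubeMap, cpt, par, phase, h3]
    push_cast
    linear_combination ((t.2 : ℂ) * (y.2 + 2 * ∑ k, (y.1 k : ℂ) ^ 2) * (-1) -
      t.2 * (∑ k, ((x.1 k : ℂ) + Complex.I * y.1 k) ^ 2) -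
      2 * Real.sqrt t.2 * (∑ k, (t.1 k : ℂ) * y.1 k)) * hI
  rw [e1, ← e2, Complex.exp_add]; ring

/-- The transform as an integral of holomorphic functions. -/
lemma bargmannAdj_eq_phase (l : ℝ) {f : HSp n → ℂ} (hf : AEStronglyMeasurable f (halfMeasure n))
    (z : siegel n) : bargmannAdj l f z = fc n * ∫ t, Complex.exp (phase t z.1) *
      (((dens t * amp l t : ℝ) : ℂ) * f t) ∂(halfMeasure n) := by
  obtain ⟨x, hx⟩ := exists_spt_yc z
  have hy := yc_pos z
  rw [hx, bargmannAdj_spt_eq l hf hy x]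
  congr 1
  refine integral_congr_ae ?_
  filter_upwards [ae_half] with t ht
  have := exp_mul_bk_eq l hy x ht
  push_cast
  linear_combination (dens t : ℂ) * f t * this

lemma norm_exp_phase_mul_amp (l : ℝ) (z : siegel n) {t : HSp n} (ht : 0 < t.2) :
    ‖Complex.exp (phase t z.1)‖ * amp l t = bk l (yc z.1) t := by
  obtain ⟨x, hx⟩ := exists_spt_yc z
  have hy := yc_pos z
  have h := congrArg norm (exp_mul_bk_eq l hy x ht)
  rw [← hx, norm_mul, norm_mul, mul_comm Complex.I, Complex.norm_exp_ofReal_mul_I, Complex.norm_real,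
    Complex.norm_real, Real.norm_of_nonneg (bk_nonneg _ _ _), one_mul, Real.norm_of_nonneg] at h
  · rw [h, mul_comm]
  · have := Real.pi_pos; unfold amp; positivity

lemma amp_nonneg (l : ℝ) (t : HSp n) : 0 ≤ amp l t := by
  have := Real.pi_pos; unfold amp; positivity

/-- Recentring the Gaussian from `y'` to `y₀'` halves its width parameter and costs `2ξ|y' - y₀'|² ≤
ξh₀/4` in the exponent. The decay `e^{-ξh} ≤ e^{-ξh₀/2}` pays for it and keeps `e^{-ξh₀/4}`. The
result is a bound uniform near `y₀`. -/
lemma bk_le_gk (l : ℝ) {y y₀ t : HSp n} (ht : 0 < t.2) (h1 : y₀.2 / 2 ≤ y.2)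
    (h2 : ∑ k, (y.1 k - y₀.1 k) ^ 2 ≤ y₀.2 / 8) :
    bk l y t ≤ Real.pi ^ (-(n : ℝ) / 4) * gk l (1 / 4) (y₀.1, y₀.2 / 4) t := by
  rw [bk_eq_gk]
  have := Real.pi_pos
  refine mul_le_mul_of_nonneg_left ?_ (by positivity)
  unfold gk
  refine mul_le_mul_of_nonneg_right (Real.exp_le_exp.2 ?_) (Real.sqrt_nonneg _)
  have h3 : (1 / 4 : ℝ) * ∑ k, (t.1 k + 2 * Real.sqrt t.2 * y₀.1 k) ^ 2 ≤
      1 / 2 * ∑ k, (t.1 k + 2 * Real.sqrt t.2 * y.1 k) ^ 2 +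
        2 * t.2 * ∑ k, (y.1 k - y₀.1 k) ^ 2 := by
    rw [Finset.mul_sum, Finset.mul_sum, Finset.mul_sum, ← Finset.sum_add_distrib]
    refine Finset.sum_le_sum fun k _ => ?_
    have hs := Real.sq_sqrt ht.le
    have : 2 * t.2 * (y.1 k - y₀.1 k) ^ 2 =
        1 / 2 * (2 * Real.sqrt t.2 * y.1 k - 2 * Real.sqrt t.2 * y₀.1 k) ^ 2 := by
      linear_combination (-2 * (y.1 k - y₀.1 k) ^ 2) * hs
    rw [this]
    nlinarith [sq_nonneg ((t.1 k + 2 * Real.sqrt t.2 * y.1 k) +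
      (2 * Real.sqrt t.2 * y.1 k - 2 * Real.sqrt t.2 * y₀.1 k))]
  simp only
  nlinarith

lemma isHolomorphic_bargmannAdj {l : ℝ} (hl : (n : ℝ) + 1 < l) {f : HSp n → ℂ}
    (hf : MemLp f 2 (halfMeasure n)) : IsHolomorphic (bargmannAdj l f) := by
  have hext (z) (hz : z ∈ siegel n) : Function.extend Subtype.val (bargmannAdj l f) 0 z =
      fc n * ∫ t, Complex.exp (phase t z) *
      (((dens t * amp l t : ℝ) : ℂ) * f t) ∂(halfMeasure n) := by
    rw [show z = (⟨z, hz⟩ : siegel n).1 from rfl, Subtype.val_injective.extend_apply,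
      bargmannAdj_eq_phase l hf.1]
  refine DifferentiableOn.congr ?_ hext
  intro z₀ hz₀
  refine DifferentiableAt.differentiableWithinAt (DifferentiableAt.const_mul ?_ _)
  have hy₀ : 0 < (yc z₀).2 := hz₀
  have hev : ∀ᶠ z in 𝓝 z₀, z ∈ siegel n ∧ (yc z₀).2 / 2 ≤ (yc z).2 ∧
      ∑ k, ((yc z).1 k - (yc z₀).1 k) ^ 2 ≤ (yc z₀).2 / 8 := by
    have hcy := continuous_yc (n := n)
    refine (isOpen_siegel.eventually_mem hz₀).and (Filter.Eventually.and ?_ ?_)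
    · have hc : Continuous fun z : (Fin n → ℂ) × ℂ => (yc z).2 := continuous_height
      exact (hc.tendsto z₀).eventually (le_mem_nhds (by linarith))
    · have hc : Continuous fun z : (Fin n → ℂ) × ℂ => ∑ k, ((yc z).1 k - (yc z₀).1 k) ^ 2 := by
        simp only [yc]; fun_prop
      refine (hc.tendsto z₀).eventually (ge_mem_nhds ?_)
      simp; linarith
  obtain ⟨r, hr, hball⟩ := Metric.eventually_nhds_iff_ball.1 hev
  have hdm : Measurable fun t : HSp n => ((dens t * amp l t : ℝ) : ℂ) := by
    have := measurable_dens (n := n)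
    unfold amp; fun_prop
  have hb := (MemLp.integrable_mul (memLp_dens_mul_gk hl (b := 1 / 4) (by norm_num)
    (y := ((yc z₀).1, (yc z₀).2 / 4)) (by simp only; linarith)) hf.norm).const_mul
      (Real.pi ^ (-(n : ℝ) / 4))
  refine differentiableAt_integral_of_dominated hr hb ?_ ?_ ?_
  · intro z _
    refine AEStronglyMeasurable.mul ?_ (hdm.aestronglyMeasurable.mul hf.1)
    refine Measurable.aestronglyMeasurable ?_
    unfold phase; fun_prop
  · filter_upwards [ae_half] with t ht z hz
    obtain ⟨hz1, hz2, hz3⟩ := hball z hz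
    have h1 := norm_exp_phase_mul_amp l ⟨z, hz1⟩ ht
    have h2 := bk_le_gk l ht hz2 hz3
    rw [norm_mul, norm_mul, Complex.norm_real, Real.norm_of_nonneg
      (mul_nonneg (dens_nonneg t) (amp_nonneg l t))]
    calc _ = dens t * (‖Complex.exp (phase t z)‖ * amp l t) * ‖f t‖ := by ring
      _ ≤ dens t * (Real.pi ^ (-(n : ℝ) / 4) * gk l (1 / 4) ((yc z₀).1, (yc z₀).2 / 4) t) * ‖f t‖ := by
        rw [h1]
        exact mul_le_mul_of_nonneg_right (mul_le_mul_of_nonneg_left h2 (dens_nonneg t))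
          (norm_nonneg _)
      _ = _ := by simp only [Pi.mul_apply]; ring
  · refine .of_forall fun t => Differentiable.differentiableOn ?_
    unfold phase; fun_prop

lemma IsHolomorphic.continuous {f : siegel n → ℂ} (hf : IsHolomorphic f) : Continuous f := by
  have h := hf.continuousOn.domRestrict
  have e : (siegel n).domRestrict (Function.extend Subtype.val f 0) = f := by
    ext z; exact Subtype.val_injective.extend_apply _ _ _
  rwa [e] at h

end Holomorphy
end SuperSiegel

end

noncomputable section
namespace SuperSiegel
open Filter Topology

/-! ### Plancherel: norms, and symbols as multipliers. -/

section Isometry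
variable {n : ℕ}

/-- With the matching weight the powers of `ξ` cancel up to `(2ξ)^{-m}`. For `m = 0` the result is
constant, which gives the isometry; for `m > 0` it blows up as `ξ → 0`, which is why unbounded
symbols are controlled only away from `ξ = 0`. -/
lemma lintegral_pow_mul_kk_wHalf {l m : ℝ} (hl : (n : ℝ) + 1 < l) (hm : 0 ≤ m) {t : HSp n}
    (ht : 0 < t.2) :
    ∫⁻ y, ENNReal.ofReal (y.2 ^ m) * ENNReal.ofReal (kk l y t) ∂(wHalf n l) =
      ENNReal.ofReal (4 / cc n l * Real.Gamma (l - (n + 1) + m) * (2 * t.2) ^ (-m)) := by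
  have hk : Measurable fun y : HSp n => kk l y t :=
    (measurable_kk l).comp (by fun_prop : Measurable fun y : HSp n => (y, t))
  rw [wHalf, lintegral_withDensity_eq_lintegral_mul _ (measurable_wdens l) (by fun_prop)]
  have h := lintegral_rpow_mul_kk (s := l - (n + 1) + m) hl (by linarith) ht
  have e : (4 * (2 * t.2) ^ (l - (n + 1)) / cc n l *
        ((1 / (2 * t.2)) ^ (l - (n + 1) + m) * Real.Gamma (l - (n + 1) + m))) =
      4 / cc n l * Real.Gamma (l - (n + 1) + m) * (2 * t.2) ^ (-m) := by
    have h2 : 0 < 2 * t.2 := by positivity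
    rw [one_div, Real.inv_rpow h2.le, ← Real.rpow_neg h2.le, neg_add, Real.rpow_add h2]
    have h3 : (2 * t.2) ^ (l - (n + 1)) * (2 * t.2) ^ (-(l - ((n : ℝ) + 1))) = 1 := by
      rw [← Real.rpow_add h2, add_neg_cancel, Real.rpow_zero]
    linear_combination (4 / cc n l * Real.Gamma (l - (n + 1) + m) * (2 * t.2) ^ (-m)) * h3
  rw [← e, ← h]
  refine lintegral_congr_ae ?_
  filter_upwards [ae_half] with y hy
  simp only [Pi.mul_apply]
  rw [← mul_assoc, ← ENNReal.ofReal_mul (by positivity), ← Real.rpow_add hy]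
  congr 3; ring

lemma lintegral_kk_wHalf {l : ℝ} (hl : (n : ℝ) + 1 < l) {t : HSp n} (ht : 0 < t.2) :
    ∫⁻ y, ENNReal.ofReal (kk l y t) ∂(wHalf n l) = ENNReal.ofReal (4 / bergmanConst n l) := by
  have h := lintegral_pow_mul_kk_wHalf hl le_rfl ht
  simp only [Real.rpow_zero, ENNReal.ofReal_one, one_mul, neg_zero, add_zero, mul_one] at h
  rw [h]
  have := (Real.Gamma_pos_of_pos (show 0 < l - (n + 1) by linarith)).ne'
  congr 1
  unfold cc; field_simp

lemma aemeasurable_kk_mul (l : ℝ) {w : HSp n → ENNReal} (hw : Measurable w) {f : HSp n → ℂ}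
    (hf : AEStronglyMeasurable f (halfMeasure n)) :
    AEMeasurable (fun p : HSp n × HSp n => w p.1 * (ENNReal.ofReal (kk l p.1 p.2) * ‖f p.2‖ₑ ^ 2))
      ((wHalf n l).prod (halfMeasure n)) := by
  refine (hw.comp measurable_fst).aemeasurable.mul
    ((measurable_kk l).ennreal_ofReal.aemeasurable.mul ?_)
  exact (hf.enorm.pow_const 2).comp_quasiMeasurePreserving Measure.quasiMeasurePreserving_snd

lemma lintegral_lintegral_kk (l : ℝ) {w : HSp n → ENNReal} (hw : Measurable w) {f : HSp n → ℂ}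
    (hf : AEStronglyMeasurable f (halfMeasure n)) :
    ∫⁻ y, w y * ∫⁻ t, ENNReal.ofReal (kk l y t) * ‖f t‖ₑ ^ 2 ∂(halfMeasure n) ∂(wHalf n l) =
      ∫⁻ t, ‖f t‖ₑ ^ 2 * ∫⁻ y, w y * ENNReal.ofReal (kk l y t) ∂(wHalf n l) ∂(halfMeasure n) := by
  have hk (y : HSp n) : Measurable fun t : HSp n => kk l y t :=
    (measurable_kk l).comp (by fun_prop : Measurable fun t : HSp n => (y, t))
  have h1 (y : HSp n) : w y * ∫⁻ t, ENNReal.ofReal (kk l y t) * ‖f t‖ₑ ^ 2 ∂(halfMeasure n) =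
      ∫⁻ t, w y * (ENNReal.ofReal (kk l y t) * ‖f t‖ₑ ^ 2) ∂(halfMeasure n) := by
    rw [lintegral_const_mul'']
    exact (hk y).ennreal_ofReal.aemeasurable.mul (hf.enorm.pow_const 2)
  simp only [h1]
  rw [lintegral_lintegral_swap (aemeasurable_kk_mul l hw hf)]
  refine lintegral_congr fun t => ?_
  rw [← lintegral_const_mul' _ _ (by simp)]
  exact lintegral_congr fun y => by ring

lemma lintegral_enorm_sq_lt_top {α : Type*} [MeasurableSpace α] {μ : Measure α} {f : α → ℂ}
    (hf : MemLp f 2 μ) : ∫⁻ t, ‖f t‖ₑ ^ 2 ∂μ < ⊤ := by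
  have := (eLpNorm_lt_top_iff_lintegral_rpow_enorm_lt_top two_ne_zero ENNReal.ofNat_ne_top).1 hf.2
  simpa using this

lemma memLp_two_of_lintegral {α : Type*} [MeasurableSpace α] {μ : Measure α} {f : α → ℂ}
    (hm : AEStronglyMeasurable f μ) (hf : ∫⁻ t, ‖f t‖ₑ ^ 2 ∂μ < ⊤) : MemLp f 2 μ := by
  refine ⟨hm, (eLpNorm_lt_top_iff_lintegral_rpow_enorm_lt_top two_ne_zero ENNReal.ofNat_ne_top).2 ?_⟩
  simpa using hf

lemma lintegral_mul_kk_eq {l : ℝ} (hl : (n : ℝ) + 1 < l) (f : HSp n → ℂ) :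
    ∫⁻ t, ‖f t‖ₑ ^ 2 * ∫⁻ y, ENNReal.ofReal (kk l y t) ∂(wHalf n l) ∂(halfMeasure n) =
      ENNReal.ofReal (4 / bergmanConst n l) * ∫⁻ t, ‖f t‖ₑ ^ 2 ∂(halfMeasure n) := by
  rw [← lintegral_const_mul' _ _ ENNReal.ofReal_ne_top]
  refine lintegral_congr_ae ?_
  filter_upwards [ae_half] with t ht
  rw [lintegral_kk_wHalf hl ht, mul_comm]

lemma ae_lintegral_kk_lt_top {l : ℝ} (hl : (n : ℝ) + 1 < l) {f : HSp n → ℂ}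
    (hf : MemLp f 2 (halfMeasure n)) : ∀ᵐ y ∂(wHalf n l),
      ∫⁻ t, ENNReal.ofReal (kk l y t) * ‖f t‖ₑ ^ 2 ∂(halfMeasure n) < ⊤ := by
  have h := lintegral_lintegral_kk l measurable_one hf.1
  simp only [Pi.one_apply, one_mul] at h
  rw [lintegral_mul_kk_eq hl] at h
  refine ae_lt_top' ?_ (h.trans_lt
    (ENNReal.mul_lt_top ENNReal.ofReal_lt_top (lintegral_enorm_sq_lt_top hf))).ne
  simpa using (aemeasurable_kk_mul l measurable_one hf.1).lintegral_prod_right'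

/-- Integrability holds at every height. Square integrability is extracted from the finite total
norm by Tonelli, hence only for almost every `y`; this suffices for Plancherel under an integral
over `y`. -/
lemma ae_memLp_fullSlice {l : ℝ} (hl : (n : ℝ) + 1 < l) {f : HSp n → ℂ}
    (hf : MemLp f 2 (halfMeasure n)) : ∀ᵐ y ∂(wHalf n l), 0 < y.2 ∧ Integrable (fullSlice l f y) ∧
      MemLp (fullSlice l f y) 2 := by
  filter_upwards [ae_lintegral_kk_lt_top hl hf, ae_wHalf l] with y h hy
  have hi := integrable_fullSlice hl hf hy
  exact ⟨hy, hi, memLp_two_of_lintegral hi.1 (by rwa [lintegral_enorm_fullSlice_sq l hf.1 y])⟩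

lemma measurable_bargmannAdj {l : ℝ} (hl : (n : ℝ) + 1 < l) {f : HSp n → ℂ}
    (hf : MemLp f 2 (halfMeasure n)) : Measurable (bargmannAdj l f) :=
  (isHolomorphic_bargmannAdj hl hf).continuous.measurable

lemma measurable_yc_coe : Measurable fun z : siegel n => yc z.1 :=
  (continuous_yc.comp continuous_subtype_val).measurable

/-- The norm of the transform, weighted by a function of `(Im z', ρ)`. -/
lemma lintegral_bargmannAdj {l : ℝ} (hl : (n : ℝ) + 1 < l) {f : HSp n → ℂ}
    (hf : MemLp f 2 (halfMeasure n)) {w : HSp n → ENNReal} (hw : Measurable w) :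
    ∫⁻ z, w (yc z.1) * ‖bargmannAdj l f z‖ₑ ^ 2 ∂(wSiegel n l) =
      ∫⁻ t, ‖f t‖ₑ ^ 2 * ∫⁻ y, w y * ENNReal.ofReal (kk l y t) ∂(wHalf n l) ∂(halfMeasure n) := by
  have hm : Measurable fun z : siegel n => w (yc z.1) * ‖bargmannAdj l f z‖ₑ ^ 2 :=
    (hw.comp measurable_yc_coe).mul ((measurable_bargmannAdj hl hf).enorm.pow_const 2)
  have hm' : AEMeasurable (fun p : HSp n × HSp n => w (yc (spt p.1 p.2).1) *
      ‖bargmannAdj l f (spt p.1 p.2)‖ₑ ^ 2) ((wHalf n l).prod volume) :=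
    (hm.comp measurable_spt).aemeasurable
  rw [← (measurePreserving_spt_weighted l).lintegral_comp hm, lintegral_prod _ hm', ← lintegral_lintegral_kk l hw hf.1]
  refine lintegral_congr_ae ?_
  -- On a slice the weight is constant, so Plancherel in `x` applies; the square of `fc n` cancels
  -- its constant.
  filter_upwards [ae_memLp_fullSlice hl hf] with y ⟨hy, h1, h2⟩
  simp only [yc_spt hy, bargmannAdj_spt_eq_ft l f hy, enorm_mul, mul_pow]
  have hft : AEMeasurable (fun x => ‖ft (fullSlice l f y) x‖ₑ ^ 2) :=
    (memLp_ft h1 h2).1.enorm.pow_const 2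
  rw [lintegral_const_mul'' _ (hft.const_mul _), lintegral_const_mul'' _ hft,
    lintegral_enorm_ft_sq h1 h2, ← lintegral_enorm_fullSlice_sq l hf.1 y]
  rw [← ofReal_norm (fc n : ℂ), ← ENNReal.ofReal_pow (norm_nonneg _), Complex.norm_real,
    Real.norm_eq_abs, sq_abs, ← mul_assoc (ENNReal.ofReal _) (ENNReal.ofReal _),
    ← ENNReal.ofReal_mul (sq_nonneg _), fc_sq_mul, ENNReal.ofReal_one, one_mul]

lemma lintegral_enorm_bargmannAdj_sq {l : ℝ} (hl : (n : ℝ) + 1 < l) {f : HSp n → ℂ}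
    (hf : MemLp f 2 (halfMeasure n)) :
    ∫⁻ z, ‖bargmannAdj l f z‖ₑ ^ 2 ∂(wSiegel n l) =
      ENNReal.ofReal (4 / bergmanConst n l) * ∫⁻ t, ‖f t‖ₑ ^ 2 ∂(halfMeasure n) := by
  have h := lintegral_bargmannAdj hl hf measurable_one
  simp only [Pi.one_apply, one_mul] at h
  rw [h, lintegral_mul_kk_eq hl]

lemma memLp_bargmannAdj {l : ℝ} (hl : (n : ℝ) + 1 < l) {f : HSp n → ℂ}
    (hf : MemLp f 2 (halfMeasure n)) : MemLp (bargmannAdj l f) 2 (wSiegel n l) := by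
  refine memLp_two_of_lintegral (measurable_bargmannAdj hl hf).aestronglyMeasurable ?_
  rw [lintegral_enorm_bargmannAdj_sq hl hf]
  exact ENNReal.mul_lt_top ENNReal.ofReal_lt_top (lintegral_enorm_sq_lt_top hf)

/-- A symbol `a` multiplies the transform of `f` into the weighted `L²` space. -/
def SymbolL2 (l : ℝ) (a : HSp n → ℂ) (f : HSp n → ℂ) : Prop :=
  ∫⁻ t, ‖f t‖ₑ ^ 2 * ∫⁻ y, ‖a y‖ₑ ^ 2 * ENNReal.ofReal (kk l y t) ∂(wHalf n l) ∂(halfMeasure n) < ⊤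

lemma memLp_symbol_mul_bargmannAdj {l : ℝ} (hl : (n : ℝ) + 1 < l) {f : HSp n → ℂ}
    (hf : MemLp f 2 (halfMeasure n)) {a : HSp n → ℂ} (ha : Measurable a) (h : SymbolL2 l a f) :
    MemLp (fun z : siegel n => a (yc z.1) * bargmannAdj l f z) 2 (wSiegel n l) := by
  refine memLp_two_of_lintegral
    ((ha.comp measurable_yc_coe).mul (measurable_bargmannAdj hl hf)).aestronglyMeasurable ?_
  simp only [enorm_mul, mul_pow]
  rw [lintegral_bargmannAdj hl hf (ha.enorm.pow_const 2)]
  exact h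

/-- Writing `kk` as a product of two square roots lets Cauchy–Schwarz on the product space yield the
joint integrability that Fubini requires. -/
lemma memLp_sqrt_kk_mul {l : ℝ} {f : HSp n → ℂ} (hf : AEStronglyMeasurable f (halfMeasure n))
    {a : HSp n → ℂ} (ha : Measurable a) (h : SymbolL2 l a f) :
    MemLp (fun p : HSp n × HSp n => a p.1 * ((Real.sqrt (kk l p.1 p.2) : ℂ) * f p.2)) 2
      ((wHalf n l).prod (halfMeasure n)) := by
  have hm : AEStronglyMeasurable
      (fun p : HSp n × HSp n => a p.1 * ((Real.sqrt (kk l p.1 p.2) : ℂ) * f p.2))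
      ((wHalf n l).prod (halfMeasure n)) := by
    refine (ha.comp measurable_fst).aestronglyMeasurable.mul (AEStronglyMeasurable.mul ?_ ?_)
    · exact (Complex.measurable_ofReal.comp (measurable_kk l).sqrt).aestronglyMeasurable
    · exact hf.comp_quasiMeasurePreserving Measure.quasiMeasurePreserving_snd
  refine memLp_two_of_lintegral hm ?_
  have hw : Measurable fun y => ‖a y‖ₑ ^ 2 := ha.enorm.pow_const 2
  have e (p : HSp n × HSp n) : ‖a p.1 * ((Real.sqrt (kk l p.1 p.2) : ℂ) * f p.2)‖ₑ ^ 2 =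
      ‖a p.1‖ₑ ^ 2 * (ENNReal.ofReal (kk l p.1 p.2) * ‖f p.2‖ₑ ^ 2) := by
    rw [enorm_mul, enorm_mul, mul_pow, mul_pow, ← ofReal_norm (Real.sqrt _ : ℂ),
      ← ENNReal.ofReal_pow (norm_nonneg _), Complex.norm_real, Real.norm_eq_abs, sq_abs,
      Real.sq_sqrt (kk_nonneg _ _ _)]
  simp only [e]
  rw [lintegral_prod _ (aemeasurable_kk_mul l hw hf)]
  have h1 (y : HSp n) : ∫⁻ t, ‖a y‖ₑ ^ 2 * (ENNReal.ofReal (kk l y t) * ‖f t‖ₑ ^ 2) ∂(halfMeasure n)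
      = ‖a y‖ₑ ^ 2 * ∫⁻ t, (ENNReal.ofReal (kk l y t) * ‖f t‖ₑ ^ 2) ∂(halfMeasure n) :=
    lintegral_const_mul' _ _ (by simp)
  simp only [h1]
  rw [lintegral_lintegral_kk l hw hf]
  exact h

lemma symbolL2_one {l : ℝ} (hl : (n : ℝ) + 1 < l) {f : HSp n → ℂ}
    (hf : MemLp f 2 (halfMeasure n)) : SymbolL2 l (fun _ => 1) f := by
  unfold SymbolL2
  simp only [enorm_one, one_pow, one_mul]
  rw [lintegral_mul_kk_eq hl]
  exact ENNReal.mul_lt_top ENNReal.ofReal_lt_top (lintegral_enorm_sq_lt_top hf)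

lemma integrable_kk_mul_symbol {l : ℝ} (hl : (n : ℝ) + 1 < l) {f g : HSp n → ℂ}
    (hf : MemLp f 2 (halfMeasure n)) (hg : MemLp g 2 (halfMeasure n)) {a : HSp n → ℂ}
    (ha : Measurable a) (h : SymbolL2 l a g) :
    Integrable (fun p : HSp n × HSp n => a p.1 * ((kk l p.1 p.2 : ℂ) * (conj (f p.2) * g p.2)))
      ((wHalf n l).prod (halfMeasure n)) := by
  have h1 := (memLp_sqrt_kk_mul hf.1 measurable_const (symbolL2_one hl hf)).star
  have h2 := memLp_sqrt_kk_mul hg.1 ha h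
  refine (MemLp.integrable_mul h1 h2).congr (.of_forall fun p => ?_)
  have : (Real.sqrt (kk l p.1 p.2) : ℂ) * Real.sqrt (kk l p.1 p.2) = kk l p.1 p.2 := by
    rw [← Complex.ofReal_mul, Real.mul_self_sqrt (kk_nonneg _ _ _)]
  simp only [Pi.mul_apply, Pi.star_apply, one_mul, RCLike.star_def, map_mul, Complex.conj_ofReal]
  rw [← this]; ring

lemma integrable_conj_mul_symbol {l : ℝ} (hl : (n : ℝ) + 1 < l) {f g : HSp n → ℂ}
    (hf : MemLp f 2 (halfMeasure n)) (hg : MemLp g 2 (halfMeasure n)) {a : HSp n → ℂ}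
    (ha : Measurable a) (h : SymbolL2 l a g) :
    Integrable (fun z : siegel n => conj (bargmannAdj l f z) * (a (yc z.1) * bargmannAdj l g z))
      (wSiegel n l) :=
  MemLp.integrable_mul (memLp_bargmannAdj hl hf).star (memLp_symbol_mul_bargmannAdj hl hg ha h)

/-- Sesquilinear forms of functions of `(Im z', ρ)` become multiplication operators. -/
lemma integral_conj_bargmannAdj_mul {l : ℝ} (hl : (n : ℝ) + 1 < l) {f g : HSp n → ℂ}
    (hf : MemLp f 2 (halfMeasure n)) (hg : MemLp g 2 (halfMeasure n)) {a : HSp n → ℂ}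
    (ha : Measurable a) (h : SymbolL2 l a g) :
    Integrable (fun t => conj (f t) * g t * ∫ y, a y * (kk l y t : ℂ) ∂(wHalf n l)) (halfMeasure n) ∧
    ∫ z, conj (bargmannAdj l f z) * (a (yc z.1) * bargmannAdj l g z) ∂(wSiegel n l) =
      ∫ t, conj (f t) * g t * ∫ y, a y * (kk l y t : ℂ) ∂(wHalf n l) ∂(halfMeasure n) := by
  have hI := integrable_kk_mul_symbol hl hf hg ha h
  have e (t : HSp n) : conj (f t) * g t * ∫ y, a y * (kk l y t : ℂ) ∂(wHalf n l) =
      ∫ y, a y * ((kk l y t : ℂ) * (conj (f t) * g t)) ∂(wHalf n l) := by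
    rw [← integral_const_mul]; congr 1; ext y; ring
  simp only [e]
  refine ⟨hI.swap.integral_prod_left, ?_⟩
  have hJ := integrable_conj_mul_symbol hl hf hg ha h
  have hMP := measurePreserving_spt_weighted (n := n) l
  have hJ' : Integrable (fun p : HSp n × HSp n => conj (bargmannAdj l f (spt p.1 p.2)) *
      (a (yc (spt p.1 p.2).1) * bargmannAdj l g (spt p.1 p.2))) ((wHalf n l).prod volume) :=
    hMP.integrable_comp_of_integrable hJ
  -- With `y` outermost on both sides, it remains to compare slices, where this is Parseval.
  rw [← integral_integral_swap (f := fun y t => a y * ((kk l y t : ℂ) * (conj (f t) * g t))) hI,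
    ← hMP.map_eq, integral_map hMP.measurable.aemeasurable (by rw [hMP.map_eq]; exact hJ.1),
    integral_prod _ hJ']
  refine integral_congr_ae ?_
  filter_upwards [ae_memLp_fullSlice hl hf, ae_memLp_fullSlice hl hg] with y ⟨hy, h1, h2⟩ ⟨_, h3, h4⟩
  have hc := fc_sq_mul n
  have hc' : ((fc n : ℂ)) ^ 2 * (((2 * Real.pi) ^ (n + 1) : ℝ) : ℂ) = 1 := by
    rw [← Complex.ofReal_pow, ← Complex.ofReal_mul, hc, Complex.ofReal_one]
  have h5 := integral_conj_ft_mul_ft h1 h2 h3 h4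
  rw [integral_conj_fullSlice_mul l hf.1 hg.1 y] at h5
  simp only [yc_spt hy, bargmannAdj_spt_eq_ft l _ hy, map_mul, Complex.conj_ofReal]
  calc _ = ∫ x, (a y * (fc n : ℂ) ^ 2) * (conj (ft (fullSlice l f y) x) * ft (fullSlice l g y) x) := by
        congr 1; ext x; ring
    _ = _ := by
        rw [integral_const_mul, integral_const_mul, h5]
        linear_combination a y * (∫ t, (kk l y t : ℂ) * (conj (f t) * g t) ∂(halfMeasure n)) * hc'

end Isometry
end SuperSiegel

end

noncomputable section
namespace SuperSiegel
open Filter Topology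

/-! ### Bounds and regularization for Bergman functions on the tube. -/

section TubeFunctions
variable {n : ℕ}

/-- The base of the tube domain. -/
def tubeBase (n : ℕ) : Set (HSp n) := {Y | 0 < Y.2 - 2 * ∑ k, Y.1 k ^ 2}

lemma isOpen_tubeBase : IsOpen (tubeBase n) := isOpen_lt (by fun_prop) (by fun_prop)

lemma par_mem_tubeBase {y : HSp n} (hy : 0 < y.2) : par y ∈ tubeBase n := by
  simpa [tubeBase, par] using hy

/-- The base is the image of a half space under the shear `par`. Connectedness is what globalizes
the local shift of the contour. -/
lemma isPreconnected_tubeBase : IsPreconnected (tubeBase n) := by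
  have h1 : IsPreconnected {y : HSp n | 0 < y.2} :=
    ((convex_Ioi (0 : ℝ)).linear_preimage (LinearMap.snd ℝ (Fin n → ℝ) ℝ)).isPreconnected
  have h2 : par '' {y : HSp n | 0 < y.2} = tubeBase n := by
    ext Y
    refine ⟨?_, fun h => ⟨(Y.1, Y.2 - 2 * ∑ k, Y.1 k ^ 2), h, by simp [par]⟩⟩
    rintro ⟨y, hy, rfl⟩
    exact par_mem_tubeBase hy
  rw [← h2]
  exact h1.image _ continuous_par.continuousOn

lemma tubeMap_cpt_mem_siegel {Y x : HSp n} : tubeMap (cpt Y x) ∈ siegel n ↔ Y ∈ tubeBase n := by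
  simp [siegel, tubeBase, height_tubeMap_cpt]

/-- The vector of imaginary parts. -/
def imc (w : (Fin n → ℂ) × ℂ) : HSp n := (fun k => (w.1 k).im, w.2.im)

lemma exists_eq_cpt (w : (Fin n → ℂ) × ℂ) : ∃ x, w = cpt (imc w) x := by
  refine ⟨(fun k => (w.1 k).re, w.2.re), Prod.ext ?_ ?_⟩
  · ext k; simp [cpt, imc, mul_comm Complex.I, Complex.re_add_im]
  · simp [cpt, imc, mul_comm Complex.I, Complex.re_add_im]

lemma imc_cpt (Y x : HSp n) : imc (cpt Y x) = Y := by
  refine Prod.ext ?_ ?_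
  · ext k; simp [cpt, imc]
  · simp [cpt, imc]

lemma dist_imc_le (w w' : (Fin n → ℂ) × ℂ) : dist (imc w) (imc w') ≤ dist w w' := by
  rw [dist_eq_norm, dist_eq_norm]
  refine max_le ?_ ?_
  · refine (pi_norm_le_iff_of_nonneg (norm_nonneg _)).2 fun k => ?_
    calc ‖(imc w - imc w').1 k‖ = |((w - w').1 k).im| := by simp [imc]
      _ ≤ ‖(w - w').1 k‖ := Complex.abs_im_le_norm _
      _ ≤ ‖(w - w').1‖ := norm_le_pi_norm _ _
      _ ≤ _ := norm_fst_le _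
  · calc ‖(imc w - imc w').2‖ = |((w - w').2).im| := by simp [imc]
      _ ≤ ‖(w - w').2‖ := Complex.abs_im_le_norm _
      _ ≤ _ := norm_snd_le _

/-- The pullback of a function on the Siegel domain to the tube domain. -/
def tubeFun (ψ : siegel n → ℂ) (w : (Fin n → ℂ) × ℂ) : ℂ :=
  Function.extend Subtype.val ψ 0 (tubeMap w)

lemma tubeFun_of_mem (ψ : siegel n → ℂ) {w : (Fin n → ℂ) × ℂ} (hw : tubeMap w ∈ siegel n) :
    tubeFun ψ w = ψ ⟨tubeMap w, hw⟩ :=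
  Subtype.val_injective.extend_apply ψ 0 ⟨tubeMap w, hw⟩

lemma tubeFun_cpt_par (ψ : siegel n → ℂ) {y : HSp n} (hy : 0 < y.2) (x : HSp n) :
    tubeFun ψ (cpt (par y) x) = ψ (spt y x) := by
  rw [tubeFun_of_mem ψ (tubeMap_cpt_mem_siegel.2 (par_mem_tubeBase hy))]
  congr 1
  exact Subtype.ext (coe_spt hy x).symm

lemma differentiable_tubeMap : Differentiable ℂ (tubeMap (n := n)) := by
  unfold tubeMap; fun_prop

lemma IsHolomorphic.tubeFun {ψ : siegel n → ℂ} (hψ : IsHolomorphic ψ) :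
    DifferentiableOn ℂ (tubeFun ψ) (tubeMap ⁻¹' siegel n) :=
  DifferentiableOn.comp hψ differentiable_tubeMap.differentiableOn fun _ h => h

lemma setLIntegral_tubeFun_le (l : ℝ) (ψ : siegel n → ℂ) (hψ : IsHolomorphic ψ)
    {B : Set ((Fin n → ℂ) × ℂ)} (hB : B ⊆ tubeMap ⁻¹' siegel n) :
    ∫⁻ w in B, ENNReal.ofReal (height (tubeMap w) ^ (l - (n + 1) - 1)) * ‖tubeFun ψ w‖ₑ ^ 2 ≤
      ∫⁻ z, ‖ψ z‖ₑ ^ 2 ∂(wSiegel n l) := by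
  have hS := (isOpen_siegel (n := n)).measurableSet
  set g : (Fin n → ℂ) × ℂ → ENNReal := fun z => ENNReal.ofReal (height z ^ (l - (n + 1) - 1)) *
    ‖Function.extend Subtype.val ψ 0 z‖ₑ ^ 2 with hg
  have he := MeasurableEmbedding.subtype_coe hS
  have hgm : AEMeasurable g (volume.restrict (siegel n)) := by
    have : Measurable fun z : (Fin n → ℂ) × ℂ => height z := continuous_height.measurable
    refine AEMeasurable.mul (this.pow_const _).ennreal_ofReal.aemeasurable ?_
    exact (hψ.continuousOn.aestronglyMeasurable hS).enorm.pow_const 2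
  calc _ ≤ ∫⁻ w in tubeMap ⁻¹' siegel n, g (tubeMap w) := lintegral_mono_set hB
    _ = ∫⁻ z in siegel n, g z := by
        have h := (measurePreserving_tubeMap (n := n)).restrict_preimage hS
        rw [← h.map_eq, lintegral_map' (by rw [h.map_eq]; exact hgm) h.measurable.aemeasurable]
    _ = ∫⁻ z, g z.1 ∂(siegelMeasure n) := by
        rw [siegelMeasure, lintegral_subtype_comap hS]
    _ = _ := by
        rw [wSiegel, lintegral_withDensity_eq_lintegral_mul _ (measurable_wdens_siegel l)
          (hψ.continuous.measurable.enorm.pow_const 2)]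
        refine lintegral_congr fun z => ?_
        simp only [hg, Pi.mul_apply, Subtype.val_injective.extend_apply]

/-- Square integrable holomorphic functions are bounded on tubes over small balls. -/
lemma exists_bound_tubeFun {l : ℝ} {ψ : siegel n → ℂ} (hψ : IsHolomorphic ψ)
    (h2 : MemLp ψ 2 (wSiegel n l)) {Y₀ : HSp n} (hY₀ : Y₀ ∈ tubeBase n) :
    ∃ δ > 0, ∃ C : ℝ, ∀ Y ∈ Metric.ball Y₀ δ, Y ∈ tubeBase n ∧
      ∀ x, ‖tubeFun ψ (cpt Y x)‖ ≤ C := by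
  set e := l - (n + 1) - 1
  set ht : HSp n → ℝ := fun Y => Y.2 - 2 * ∑ k, Y.1 k ^ 2 with hht
  have hhtc : Continuous ht := by rw [hht]; fun_prop
  have hv₀ : 0 < ht Y₀ ^ e := Real.rpow_pos_of_pos hY₀ _
  -- The radius is chosen so that the weight stays above half its value at `Y₀`.
  have hev : ∀ᶠ Y in 𝓝 Y₀, Y ∈ tubeBase n ∧ ht Y₀ ^ e / 2 < ht Y ^ e := by
    refine (isOpen_tubeBase.eventually_mem hY₀).and ?_
    have hc : ContinuousAt (fun Y => ht Y ^ e) Y₀ :=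
      hhtc.continuousAt.rpow_const (Or.inl (ne_of_gt hY₀))
    exact hc.eventually (lt_mem_nhds (half_lt_self hv₀))
  obtain ⟨r, hr, hball⟩ := Metric.eventually_nhds_iff_ball.1 hev
  set A := ∫⁻ z, ‖ψ z‖ₑ ^ 2 ∂(wSiegel n l) with hA
  have hAt : A < ⊤ := lintegral_enorm_sq_lt_top h2
  set V := volume (Metric.ball (0 : (Fin n → ℂ) × ℂ) (r / 3)) with hV
  have hV0 : V ≠ 0 := (Metric.measure_ball_pos _ _ (by positivity)).ne'
  have hVt : V ≠ ⊤ := measure_ball_lt_top.ne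
  refine ⟨r / 3, by positivity, Real.sqrt (ENNReal.toReal
    (ENNReal.ofReal (2 / ht Y₀ ^ e) * A / V)), fun Y hY => ⟨(hball Y (Metric.ball_subset_ball
      (by linarith) hY)).1, fun x => ?_⟩⟩
  set w := cpt Y x with hw
  -- Only imaginary parts enter, so the same radius works for all `x`, and the resulting bound is
  -- uniform in `x`.
  have hsub : ∀ v ∈ Metric.ball w (2 * r / 3), imc v ∈ Metric.ball Y₀ r := by
    intro v hv
    have h1 := dist_imc_le v w
    rw [hw, imc_cpt] at h1
    rw [Metric.mem_ball] at *
    linarith [dist_triangle (imc v) Y Y₀]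
  have hT : Metric.ball w (2 * r / 3) ⊆ tubeMap ⁻¹' siegel n := by
    intro v hv
    obtain ⟨x', hx'⟩ := exists_eq_cpt v
    rw [Set.mem_preimage, hx', tubeMap_cpt_mem_siegel]
    exact (hball _ (hsub v hv)).1
  -- Applied to the square of the function, the mean value property bounds `|ψ|²` at the centre by
  -- the `L²` mass of a ball of fixed volume.
  have hmean := setIntegral_ball_eq_of_differentiableOn (show r / 3 < 2 * r / 3 by linarith)
    (f := fun v => tubeFun ψ v ^ 2) ((hψ.tubeFun.mono hT).pow 2)
  have hVw : volume (Metric.ball w (r / 3)) = V := by rw [hV, Measure.addHaar_ball_center]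
  have hle : ‖tubeFun ψ w‖ₑ ^ 2 ≤ ENNReal.ofReal (2 / ht Y₀ ^ e) * A / V := by
    rw [ENNReal.le_div_iff_mul_le (Or.inl hV0) (Or.inl hVt)]
    calc ‖tubeFun ψ w‖ₑ ^ 2 * V = ‖∫ v in Metric.ball w (r / 3), tubeFun ψ v ^ 2‖ₑ := by
          rw [hmean, enorm_mul, enorm_pow, mul_comm, Measure.real, hVw]
          congr 1
          rw [← ofReal_norm, Complex.norm_real, Real.norm_of_nonneg ENNReal.toReal_nonneg,
            ENNReal.ofReal_toReal hVt]
      _ ≤ ∫⁻ v in Metric.ball w (r / 3), ‖tubeFun ψ v‖ₑ ^ 2 := by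
          refine (enorm_integral_le_lintegral_enorm _).trans_eq ?_
          simp only [enorm_pow]
      _ ≤ ∫⁻ v in Metric.ball w (r / 3), ENNReal.ofReal (2 / ht Y₀ ^ e) *
            (ENNReal.ofReal (height (tubeMap v) ^ e) * ‖tubeFun ψ v‖ₑ ^ 2) := by
          refine setLIntegral_mono' measurableSet_ball fun v hv => ?_
          have hv' := hball _ (hsub v (Metric.ball_subset_ball (by linarith) hv))
          obtain ⟨x', hx'⟩ := exists_eq_cpt v
          have hh : height (tubeMap v) = ht (imc v) := by rw [hx', height_tubeMap_cpt, imc_cpt]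
          rw [hh, ← mul_assoc, ← ENNReal.ofReal_mul (by positivity)]
          refine le_mul_of_one_le_left zero_le ?_
          rw [ENNReal.one_le_ofReal, div_mul_eq_mul_div, le_div_iff₀ hv₀]
          linarith [hv'.2]
      _ = ENNReal.ofReal (2 / ht Y₀ ^ e) * ∫⁻ v in Metric.ball w (r / 3),
            (ENNReal.ofReal (height (tubeMap v) ^ e) * ‖tubeFun ψ v‖ₑ ^ 2) :=
          lintegral_const_mul' _ _ ENNReal.ofReal_ne_top
      _ ≤ _ := by
          gcongr
          exact setLIntegral_tubeFun_le l ψ hψ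
            ((Metric.ball_subset_ball (by linarith)).trans hT)
  have hfin : ENNReal.ofReal (2 / ht Y₀ ^ e) * A / V ≠ ⊤ :=
    ENNReal.div_ne_top (ENNReal.mul_lt_top ENNReal.ofReal_lt_top hAt).ne hV0
  refine Real.le_sqrt_of_sq_le ?_
  have := ENNReal.toReal_mono hfin hle
  simpa using this

/-- The regularizing factor `(1 - iεz_p)^{-m}`. -/
def reg (ε : ℝ) (m : ℕ) (z : (Fin n → ℂ) × ℂ) : ℂ := ((1 - Complex.I * ε * z.2) ^ m)⁻¹

/-- The real part of `1 - iεz_p` is `1 + ε Im z_p`, and `Im z_p > |z'|²` on the domain. So the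
regularizer has no pole and controls `z'`. -/
lemma one_add_le_norm {ε : ℝ} (hε : 0 < ε) {z : (Fin n → ℂ) × ℂ} (hz : z ∈ siegel n) :
    1 + ε * ∑ k, ‖z.1 k‖ ^ 2 ≤ ‖1 - Complex.I * ε * z.2‖ := by
  have h1 : ∑ k, ‖z.1 k‖ ^ 2 < z.2.im := by
    have : 0 < height z := hz
    unfold height at this; linarith
  have h2 : (1 - Complex.I * ε * z.2).re = 1 + ε * z.2.im := by simp
  calc _ ≤ 1 + ε * z.2.im := by nlinarith
    _ ≤ _ := by rw [← h2]; exact Complex.re_le_norm _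

lemma one_le_norm_one_sub {ε : ℝ} (hε : 0 < ε) {z : (Fin n → ℂ) × ℂ} (hz : z ∈ siegel n) :
    1 ≤ ‖1 - Complex.I * ε * z.2‖ :=
  le_trans (by have : 0 ≤ ∑ k, ‖z.1 k‖ ^ 2 := by positivity
               nlinarith) (one_add_le_norm hε hz)

lemma norm_reg_le_one {ε : ℝ} (hε : 0 < ε) (m : ℕ) {z : (Fin n → ℂ) × ℂ} (hz : z ∈ siegel n) :
    ‖reg ε m z‖ ≤ 1 := by
  rw [reg, norm_inv, norm_pow]
  exact inv_le_one_of_one_le₀ (one_le_pow₀ (one_le_norm_one_sub hε hz))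

lemma differentiableOn_reg {ε : ℝ} (hε : 0 < ε) (m : ℕ) :
    DifferentiableOn ℂ (reg (n := n) ε m) (siegel n) := by
  unfold reg
  refine DifferentiableOn.inv (by fun_prop) fun z hz => pow_ne_zero _ fun h => ?_
  have := one_le_norm_one_sub hε hz
  rw [h, norm_zero] at this; linarith

/-- The real part of `1 - iεz_p` controls `|z'|²`, and its imaginary part controls `Re z_p`, which
differs from `x_p` by `2 x'·Y'`. For bounded `Y` the factor thus dominates the whole of `x`. -/
lemma one_add_norm_le {ε M : ℝ} (hε : 0 < ε) {Y x : HSp n} (hY : Y ∈ tubeBase n)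
    (hM : ‖Y‖ ≤ M) : 1 + ‖x‖ ≤ (1 + (1 + 1 / ε) * (1 + 2 * n * M)) *
      ‖1 - Complex.I * ε * (tubeMap (cpt Y x)).2‖ := by
  set z := tubeMap (cpt Y x) with hz
  have hzS : z ∈ siegel n := tubeMap_cpt_mem_siegel.2 hY
  set D := ‖1 - Complex.I * ε * z.2‖ with hD
  have hD1 : 1 ≤ D := one_le_norm_one_sub hε hzS
  have hD2 := one_add_le_norm hε hzS
  rw [← hD] at hD2
  have hM0 : 0 ≤ M := (norm_nonneg _).trans hM
  have hxk (k : Fin n) : |x.1 k| ≤ (1 + 1 / ε) * D := by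
    have h1 : x.1 k ^ 2 ≤ ∑ k, ‖z.1 k‖ ^ 2 := by
      refine le_trans ?_ (Finset.single_le_sum (f := fun k => ‖z.1 k‖ ^ 2)
        (fun _ _ => by positivity) (Finset.mem_univ k))
      have h3 : z.1 k = (x.1 k : ℂ) + Complex.I * (Y.1 k : ℂ) := rfl
      simp only [h3]
      rw [Complex.sq_norm, Complex.normSq_apply]
      simp; nlinarith [sq_nonneg (Y.1 k)]
    have h2 : ε * ∑ k, ‖z.1 k‖ ^ 2 ≤ D := by linarith
    have h3 : ∑ k, ‖z.1 k‖ ^ 2 ≤ 1 / ε * D := by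
      rw [one_div, ← div_eq_inv_mul, le_div_iff₀ hε]; linarith
    have h4 : |x.1 k| ≤ 1 + x.1 k ^ 2 := by
      rw [← sq_abs]; nlinarith [sq_nonneg (|x.1 k| - 1)]
    linarith
  have hre : |z.2.re| ≤ 1 / ε * D := by
    have h1 : (1 - Complex.I * ε * z.2).im = -(ε * z.2.re) := by simp
    have h2 := Complex.abs_im_le_norm (1 - Complex.I * ε * z.2)
    rw [h1, abs_neg, abs_mul, abs_of_pos hε] at h2
    rw [one_div, ← div_eq_inv_mul, le_div_iff₀ hε]; linarith
  have hzre : z.2.re = x.2 - 2 * ∑ k, x.1 k * Y.1 k := by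
    have e (k : Fin n) : (((x.1 k : ℂ) + Complex.I * (Y.1 k : ℂ)) ^ 2).im = 2 * (x.1 k * Y.1 k) := by
      rw [sq]; simp; ring
    simp only [hz, tubeMap, cpt, Complex.add_re, Complex.mul_re, Complex.im_sum, e,
      Complex.I_re, Complex.I_im, Complex.ofReal_re, Complex.ofReal_im, ← Finset.mul_sum]
    ring
  have hsum : |∑ k, x.1 k * Y.1 k| ≤ n * ((1 + 1 / ε) * D * M) := by
    refine (Finset.abs_sum_le_sum_abs _ _).trans ?_
    have : ∀ k ∈ Finset.univ, |x.1 k * Y.1 k| ≤ (1 + 1 / ε) * D * M := fun k _ => by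
      rw [abs_mul]
      exact mul_le_mul (hxk k) (((norm_le_pi_norm Y.1 k).trans (norm_fst_le Y)).trans hM)
        (abs_nonneg _) (by positivity)
    simpa using Finset.sum_le_sum this
  have hx2 : |x.2| ≤ (1 + 1 / ε) * (1 + 2 * n * M) * D := by
    have : x.2 = z.2.re + 2 * ∑ k, x.1 k * Y.1 k := by rw [hzre]; ring
    rw [this]
    refine (abs_add_le _ _).trans ?_
    rw [abs_mul, abs_two]
    nlinarith
  have hx1 : ‖x.1‖ ≤ (1 + 1 / ε) * (1 + 2 * n * M) * D := by
    refine (pi_norm_le_iff_of_nonneg (by positivity)).2 fun k => (hxk k).trans ?_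
    have : 0 ≤ (1 + 1 / ε) * D * (2 * n * M) := by positivity
    nlinarith
  have hx : ‖x‖ ≤ (1 + 1 / ε) * (1 + 2 * n * M) * D := max_le hx1 hx2
  nlinarith

/-- Holomorphic functions on the tube domain with slices of uniform polynomial decay. -/
def IsDecaying (Θ : (Fin n → ℂ) × ℂ → ℂ) : Prop :=
  DifferentiableOn ℂ Θ (tubeMap ⁻¹' siegel n) ∧
  ∀ Y₀ ∈ tubeBase n, ∃ δ > 0, ∃ C : ℝ, ∀ Y ∈ Metric.ball Y₀ δ, Y ∈ tubeBase n ∧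
    ∀ x, ‖Θ (cpt Y x)‖ ≤ C * (1 + ‖x‖) ^ (-((n : ℝ) + 2))

/-- The function is bounded on the tube over a small ball, so the damping factor supplies all the
decay. The power `n + 2` exceeds the dimension `n + 1` of a slice, which makes the slices
integrable. -/
lemma isDecaying_tubeFun_reg {l ε : ℝ} (hε : 0 < ε) {ψ : siegel n → ℂ} (hψ : IsHolomorphic ψ)
    (h2 : MemLp ψ 2 (wSiegel n l)) :
    IsDecaying (tubeFun fun z => reg ε (n + 2) z.1 * ψ z) := by
  have heq (w) (hw : tubeMap w ∈ siegel n) : tubeFun (fun z => reg ε (n + 2) z.1 * ψ z) w =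
      reg ε (n + 2) (tubeMap w) * tubeFun ψ w := by
    rw [tubeFun_of_mem _ hw, tubeFun_of_mem _ hw]
  refine ⟨?_, fun Y₀ hY₀ => ?_⟩
  · refine DifferentiableOn.congr (f := fun w => reg ε (n + 2) (tubeMap w) * tubeFun ψ w) ?_
      fun w hw => heq w hw
    exact ((differentiableOn_reg hε _).comp differentiable_tubeMap.differentiableOn
      fun _ h => h).mul hψ.tubeFun
  obtain ⟨δ, hδ, C, hC⟩ := exists_bound_tubeFun hψ h2 hY₀
  set M := ‖Y₀‖ + δ
  set B := 1 + (1 + 1 / ε) * (1 + 2 * n * M)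
  have hB : 0 < B := by positivity
  refine ⟨δ, hδ, C * B ^ (n + 2), fun Y hY => ⟨(hC Y hY).1, fun x => ?_⟩⟩
  have hYM : ‖Y‖ ≤ M := by
    have h1 : ‖Y - Y₀‖ < δ := by rwa [← dist_eq_norm]
    have := norm_le_norm_add_norm_sub' Y Y₀
    simp only [M]; linarith
  have hD := one_add_norm_le hε (x := x) (hC Y hY).1 hYM
  have hbd := (hC Y hY).2 x
  have hz : tubeMap (cpt Y x) ∈ siegel n := tubeMap_cpt_mem_siegel.2 (hC Y hY).1
  have hD1 := one_le_norm_one_sub hε hz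
  set D := ‖1 - Complex.I * ε * (tubeMap (cpt Y x)).2‖ with hDdef
  have hC0 : 0 ≤ C := (norm_nonneg _).trans hbd
  rw [heq _ hz, norm_mul, reg, norm_inv, norm_pow, ← hDdef]
  have hx0 : 0 < 1 + ‖x‖ := by positivity
  have hpow : (1 + ‖x‖) ^ (-((n : ℝ) + 2)) = ((1 + ‖x‖) ^ (n + 2))⁻¹ := by
    rw [Real.rpow_neg hx0.le, ← Real.rpow_natCast]; push_cast; rfl
  rw [hpow]
  have h3 : (1 + ‖x‖) ^ (n + 2) ≤ B ^ (n + 2) * D ^ (n + 2) := by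
    rw [← mul_pow]; exact pow_le_pow_left₀ hx0.le hD _
  have h4 : (D ^ (n + 2))⁻¹ ≤ B ^ (n + 2) * ((1 + ‖x‖) ^ (n + 2))⁻¹ := by
    rw [inv_le_iff_one_le_mul₀ (by positivity), ← div_eq_mul_inv, div_mul_eq_mul_div,
      le_div_iff₀ (by positivity), one_mul]
    exact h3
  calc _ ≤ (B ^ (n + 2) * ((1 + ‖x‖) ^ (n + 2))⁻¹) * C :=
        mul_le_mul h4 hbd (norm_nonneg _) (by positivity)
    _ = _ := by ring

end TubeFunctions
end SuperSiegel

end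

noncomputable section
namespace SuperSiegel
open Filter Topology

/-! ### Paley–Wiener: shifting the contour of integration. -/

section PaleyWiener
variable {n : ℕ}

lemma integrable_one_add_norm_rpow :
    Integrable fun x : HSp n => (1 + ‖x‖) ^ (-((n : ℝ) + 2)) := by
  refine integrable_one_add_norm ?_
  simp

/-- Peetre's inequality: translating `x` by a bounded vector costs only a constant in the decay
bound. -/
lemma one_add_norm_rpow_le (x e : HSp n) : (1 + ‖x + e‖) ^ (-((n : ℝ) + 2)) ≤
    (1 + ‖e‖) ^ ((n : ℝ) + 2) * (1 + ‖x‖) ^ (-((n : ℝ) + 2)) := by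
  have h0 : 0 < 1 + ‖x‖ := by positivity
  have h1 : 0 < 1 + ‖e‖ := by positivity
  have h2 : 0 < 1 + ‖x + e‖ := by positivity
  have h3 : 1 + ‖x‖ ≤ (1 + ‖x + e‖) * (1 + ‖e‖) := by
    have : ‖x‖ ≤ ‖x + e‖ + ‖e‖ := by
      simpa using norm_sub_le (x + e) e
    nlinarith [norm_nonneg (x + e), norm_nonneg e]
  have hn : 0 ≤ (n : ℝ) + 2 := by positivity
  have h4 := Real.rpow_le_rpow h0.le h3 hn
  rw [Real.mul_rpow h2.le h1.le] at h4
  rw [Real.rpow_neg h0.le, Real.rpow_neg h2.le, ← div_eq_mul_inv,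
    inv_le_iff_one_le_mul₀ (by positivity), div_mul_eq_mul_div, le_div_iff₀ (by positivity)]
  linarith

/-- The complex bilinear extension of `dot` in the first variable. -/
def cdot (w : (Fin n → ℂ) × ℂ) (ζ : HSp n) : ℂ := (∑ k, w.1 k * (ζ.1 k : ℂ)) + w.2 * (ζ.2 : ℂ)

lemma cdot_cpt (Y x ζ : HSp n) : cdot (cpt Y x) ζ = (dot x ζ : ℂ) + Complex.I * (dot Y ζ : ℂ) := by
  simp only [cdot, cpt, dot]
  push_cast
  have : ∑ k, ((x.1 k : ℂ) + Complex.I * Y.1 k) * (ζ.1 k : ℂ) =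
      (∑ k, (x.1 k : ℂ) * ζ.1 k) + Complex.I * ∑ k, (Y.1 k : ℂ) * ζ.1 k := by
    rw [Finset.mul_sum, ← Finset.sum_add_distrib]
    exact Finset.sum_congr rfl fun k _ => by ring
  rw [this]; ring

lemma exp_neg_I_cdot_cpt (Y x ζ : HSp n) : Complex.exp (-(Complex.I * cdot (cpt Y x) ζ)) =
    Complex.exp (dot Y ζ : ℂ) * Complex.exp (Complex.I * (dot x (-ζ) : ℂ)) := by
  rw [cdot_cpt, ← Complex.exp_add, dot_neg]
  congr 1
  push_cast
  linear_combination (-(dot Y ζ : ℂ)) * Complex.I_sq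

lemma norm_exp_neg_I_cdot_cpt (Y x ζ : HSp n) :
    ‖Complex.exp (-(Complex.I * cdot (cpt Y x) ζ))‖ = Real.exp (dot Y ζ) := by
  rw [exp_neg_I_cdot_cpt, norm_mul, mul_comm Complex.I, Complex.norm_exp_ofReal_mul_I,
    ← Complex.ofReal_exp, Complex.norm_real, Real.norm_of_nonneg (Real.exp_pos _).le, mul_one]

/-- A complex parameter `s` moves both parts of the point: real `s` translates along the slice,
while `s = i` passes to another slice. -/
lemma cpt_add_smul (Y x d : HSp n) (s : ℂ) :
    cpt Y x + s • cpt 0 d = cpt (Y + s.im • d) (x + s.re • d) := by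
  refine Prod.ext ?_ ?_
  · ext k
    simp only [cpt, Prod.fst_add, Prod.smul_fst, Pi.add_apply, Pi.smul_apply, smul_eq_mul,
      Complex.ofReal_add, Complex.ofReal_mul]
    simp
    linear_combination -(d.1 k : ℂ) * Complex.re_add_im s
  · simp only [cpt, Prod.snd_add, Prod.smul_snd, smul_eq_mul,
      Complex.ofReal_add, Complex.ofReal_mul]
    simp
    linear_combination -(d.2 : ℂ) * Complex.re_add_im s

lemma continuous_cpt_right (Y : HSp n) : Continuous (cpt Y) :=
  continuous_cpt.comp (continuous_const.prodMk continuous_id)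

variable {Θ : (Fin n → ℂ) × ℂ → ℂ}

lemma IsDecaying.continuous_slice (hΘ : IsDecaying Θ) {Y : HSp n} (hY : Y ∈ tubeBase n) :
    Continuous fun x => Θ (cpt Y x) :=
  hΘ.1.continuousOn.comp_continuous (continuous_cpt_right Y)
    fun _ => tubeMap_cpt_mem_siegel.2 hY

lemma IsDecaying.integrable_slice (hΘ : IsDecaying Θ) {Y : HSp n} (hY : Y ∈ tubeBase n) :
    Integrable fun x => Θ (cpt Y x) := by
  obtain ⟨δ, hδ, C, hC⟩ := hΘ.2 Y hY
  refine (integrable_one_add_norm_rpow.const_mul C).mono'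
    (hΘ.continuous_slice hY).aestronglyMeasurable (.of_forall fun x => ?_)
  exact (hC Y (Metric.mem_ball_self hδ)).2 x

lemma IsDecaying.memLp_slice (hΘ : IsDecaying Θ) {Y : HSp n} (hY : Y ∈ tubeBase n) :
    MemLp (fun x => Θ (cpt Y x)) 2 := by
  obtain ⟨δ, hδ, C, hC⟩ := hΘ.2 Y hY
  have hm := (hΘ.continuous_slice hY).aestronglyMeasurable (μ := volume)
  refine (memLp_two_iff_integrable_sq_norm hm).2
    (((hΘ.integrable_slice hY).norm.const_mul C).mono' (hm.norm.pow 2) (.of_forall fun x => ?_))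
  have h1 := (hC Y (Metric.mem_ball_self hδ)).2 x
  have h0 : 0 < (1 + ‖x‖) ^ (-((n : ℝ) + 2)) := by positivity
  have hC0 : 0 ≤ C := nonneg_of_mul_nonneg_left ((norm_nonneg _).trans h1) h0
  have h2 : (1 + ‖x‖) ^ (-((n : ℝ) + 2)) ≤ 1 :=
    Real.rpow_le_one_of_one_le_of_nonpos (by linarith [norm_nonneg x]) (by linarith [n.cast_nonneg (α := ℝ)])
  rw [Real.norm_of_nonneg (by positivity), sq]
  exact mul_le_mul_of_nonneg_right (h1.trans (by nlinarith)) (norm_nonneg _)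

/-- Let `A(s)` be the integral over the slice displaced by `s • (Y - Y₀)`. It is holomorphic near
`0`, and constant for real `s` by translation invariance of Lebesgue measure. The identity theorem
makes it constant up to `s = i`, which is the slice over `Y`; no boundary terms need to be
estimated. -/
lemma IsDecaying.eventually_integral_eq (hΘ : IsDecaying Θ) (ζ : HSp n) {Y₀ : HSp n}
    (hY₀ : Y₀ ∈ tubeBase n) : ∀ᶠ Y in 𝓝 Y₀,
      ∫ x, Θ (cpt Y x) * Complex.exp (-(Complex.I * cdot (cpt Y x) ζ)) =
      ∫ x, Θ (cpt Y₀ x) * Complex.exp (-(Complex.I * cdot (cpt Y₀ x) ζ)) := by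
  obtain ⟨δ, hδ, C, hC⟩ := hΘ.2 Y₀ hY₀
  have hC0 : 0 ≤ C := by
    have := (norm_nonneg _).trans ((hC Y₀ (Metric.mem_ball_self hδ)).2 0)
    simpa using this
  set K : (Fin n → ℂ) × ℂ → ℂ := fun w => Θ w * Complex.exp (-(Complex.I * cdot w ζ)) with hK
  have hKd : DifferentiableOn ℂ K (tubeMap ⁻¹' siegel n) := by
    refine hΘ.1.mul (Differentiable.differentiableOn ?_)
    unfold cdot; fun_prop
  have hdc : Continuous fun Y : HSp n => dot Y ζ :=
    continuous_dot.comp (continuous_id.prodMk continuous_const)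
  obtain ⟨M, hM⟩ := (isCompact_closedBall Y₀ δ).bddAbove_image
    (f := fun Y => Real.exp (dot Y ζ)) (by fun_prop)
  -- Half the radius, so that the disc `‖s‖ < 2`, which contains `i` in its interior, stays within
  -- the controlled slices.
  filter_upwards [Metric.ball_mem_nhds Y₀ (half_pos hδ)] with Y hY
  set d := Y - Y₀ with hd
  have hdn : ‖d‖ < δ / 2 := by rwa [hd, ← dist_eq_norm]
  set A : ℂ → ℂ := fun s => ∫ x, K (cpt Y₀ x + s • cpt 0 d) with hA
  have hmem {s : ℂ} (hs : ‖s‖ < 2) : Y₀ + s.im • d ∈ Metric.ball Y₀ δ := by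
    rw [Metric.mem_ball, dist_self_add_left, norm_smul, Real.norm_eq_abs]
    have := Complex.abs_im_le_norm s
    nlinarith [norm_nonneg d, abs_nonneg s.im]
  have hT {s : ℂ} (hs : ‖s‖ < 2) (x : HSp n) : cpt Y₀ x + s • cpt 0 d ∈ tubeMap ⁻¹' siegel n := by
    rw [cpt_add_smul]; exact tubeMap_cpt_mem_siegel.2 (hC _ (hmem hs)).1
  have hbound {s : ℂ} (hs : ‖s‖ < 2) (x : HSp n) : ‖K (cpt Y₀ x + s • cpt 0 d)‖ ≤
      C * M * (1 + δ) ^ ((n : ℝ) + 2) * (1 + ‖x‖) ^ (-((n : ℝ) + 2)) := by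
    rw [cpt_add_smul, hK]
    simp only
    rw [norm_mul, norm_exp_neg_I_cdot_cpt]
    have h1 := (hC _ (hmem hs)).2 (x + s.re • d)
    have h2 := hM ⟨_, Metric.ball_subset_closedBall (hmem hs), rfl⟩
    have h3 := one_add_norm_rpow_le x (s.re • d)
    have h4 : ‖s.re • d‖ ≤ δ := by
      rw [norm_smul, Real.norm_eq_abs]
      have := Complex.abs_re_le_norm s
      nlinarith [norm_nonneg d, abs_nonneg s.re]
    have h5 : (1 + ‖s.re • d‖) ^ ((n : ℝ) + 2) ≤ (1 + δ) ^ ((n : ℝ) + 2) :=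
      Real.rpow_le_rpow (by positivity) (by linarith) (by positivity)
    have hx0 : 0 ≤ (1 + ‖x‖) ^ (-((n : ℝ) + 2)) := by positivity
    have hM0 : 0 ≤ M := (Real.exp_pos _).le.trans h2
    calc _ ≤ (C * ((1 + δ) ^ ((n : ℝ) + 2) * (1 + ‖x‖) ^ (-((n : ℝ) + 2)))) * M := by
          refine mul_le_mul (h1.trans (mul_le_mul_of_nonneg_left (h3.trans ?_) hC0)) h2
            (Real.exp_pos _).le (by positivity)
          exact mul_le_mul_of_nonneg_right h5 hx0
      _ = _ := by ring
  have hAd : DifferentiableOn ℂ A (Metric.ball 0 2) := by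
    intro s hs
    have hs' : ‖s‖ < 2 := by simpa using hs
    have hsub {s' : ℂ} (h : s' ∈ Metric.ball s (2 - ‖s‖)) : ‖s'‖ < 2 := by
      rw [Metric.mem_ball, dist_eq_norm] at h
      have := norm_le_norm_add_norm_sub' s' s
      linarith
    refine (differentiableAt_integral_of_dominated (r := 2 - ‖s‖) (by linarith)
      (integrable_one_add_norm_rpow.const_mul (C * M * (1 + δ) ^ ((n : ℝ) + 2))) ?_ ?_
      ?_).differentiableWithinAt
    · intro s' h
      refine Continuous.aestronglyMeasurable ?_
      exact hKd.continuousOn.comp_continuous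
        ((continuous_cpt_right Y₀).add continuous_const) fun x => hT (hsub h) x
    · exact .of_forall fun x s' h => hbound (hsub h) x
    · refine .of_forall fun x => ?_
      exact hKd.comp (by fun_prop) fun s' h => hT (hsub h) x
  have hAreal (σ : ℝ) : A (σ : ℂ) = A 0 := by
    have h1 (x : HSp n) : cpt Y₀ x + (σ : ℂ) • cpt 0 d = cpt Y₀ (x + σ • d) := by
      rw [cpt_add_smul]; simp
    simp only [hA, h1, zero_smul, add_zero]
    exact integral_add_right_eq_self (fun x => K (cpt Y₀ x)) (σ • d)
  have hAn : AnalyticOnNhd ℂ A (Metric.ball 0 2) := hAd.analyticOnNhd Metric.isOpen_ball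
  have heq := hAn.eqOn_of_preconnected_of_frequently_eq (g := fun _ => A 0)
    analyticOnNhd_const (convex_ball _ _).isPreconnected (z₀ := 0)
    (Metric.mem_ball_self two_pos) ?_ (x := Complex.I) (by simp)
  · have h1 (x : HSp n) : cpt Y₀ x + Complex.I • cpt 0 d = cpt Y x := by
      rw [cpt_add_smul]; simp [hd]
    simpa only [hA, h1, zero_smul, add_zero] using heq
  · have ht : Tendsto (fun k : ℕ => (((1 / ((k : ℝ) + 1) : ℝ)) : ℂ)) atTop (𝓝[≠] 0) := by
      refine tendsto_nhdsWithin_iff.2 ⟨?_, .of_forall fun k => ?_⟩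
      · exact (Complex.continuous_ofReal.tendsto 0).comp tendsto_one_div_add_atTop_nhds_zero_nat
      · have : (0 : ℝ) < 1 / ((k : ℝ) + 1) := by positivity
        simpa using Complex.ofReal_ne_zero.2 this.ne'
    exact ht.frequently (.of_forall fun k => hAreal _)

/-- Shift of the contour of integration. -/
lemma IsDecaying.integral_eq (hΘ : IsDecaying Θ) (ζ : HSp n) {Y₀ Y : HSp n}
    (hY₀ : Y₀ ∈ tubeBase n) (hY : Y ∈ tubeBase n) :
    ∫ x, Θ (cpt Y x) * Complex.exp (-(Complex.I * cdot (cpt Y x) ζ)) =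
      ∫ x, Θ (cpt Y₀ x) * Complex.exp (-(Complex.I * cdot (cpt Y₀ x) ζ)) := by
  refine isPreconnected_tubeBase.induction₂ (fun Y₀ Y =>
    ∫ x, Θ (cpt Y x) * Complex.exp (-(Complex.I * cdot (cpt Y x) ζ)) =
      ∫ x, Θ (cpt Y₀ x) * Complex.exp (-(Complex.I * cdot (cpt Y₀ x) ζ))) ?_ ?_ ?_ hY₀ hY
  · intro Y₀ hY₀
    exact (hΘ.eventually_integral_eq ζ hY₀).filter_mono nhdsWithin_le_nhds
  · intro _ _ _ _ _ _ h1 h2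
    exact h2.trans h1
  · intro _ _ _ _ h
    exact h.symm

/-- The contour shift in spectral form: `e^{Y·ζ}` times the Fourier transform of the slice at `Y` is
one density for all `Y`. -/
lemma IsDecaying.ft_eq (hΘ : IsDecaying Θ) (ζ : HSp n) {Y₀ Y : HSp n}
    (hY₀ : Y₀ ∈ tubeBase n) (hY : Y ∈ tubeBase n) :
    ft (fun x => Θ (cpt Y x)) (-ζ) = Complex.exp (-(dot Y ζ : ℂ)) *
      (Complex.exp (dot Y₀ ζ : ℂ) * ft (fun x => Θ (cpt Y₀ x)) (-ζ)) := by
  have key (Y : HSp n) : ∫ x, Θ (cpt Y x) * Complex.exp (-(Complex.I * cdot (cpt Y x) ζ)) =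
      Complex.exp (dot Y ζ : ℂ) * ft (fun x => Θ (cpt Y x)) (-ζ) := by
    rw [ft, ← integral_const_mul]
    refine integral_congr_ae (.of_forall fun x => ?_)
    simp only [exp_neg_I_cdot_cpt, dot_comm (-ζ) x]
    ring
  rw [← key, ← hΘ.integral_eq ζ hY₀ hY, key, ← mul_assoc, ← Complex.exp_add, neg_add_cancel,
    Complex.exp_zero, one_mul]

end PaleyWiener
end SuperSiegel

end

noncomputable section
namespace SuperSiegel
open Filter Topology

/-! ### Decaying Bergman functions are transforms. -/

section PaleyWienerDecaying
variable {n : ℕ}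

lemma continuous_ft {G : HSp n → ℂ} (hG : Integrable G) : Continuous (ft G) := by
  refine continuous_of_dominated (bound := fun ζ => ‖G ζ‖) ?_ ?_ hG.norm ?_
  · intro x
    refine AEStronglyMeasurable.mul ?_ hG.aestronglyMeasurable
    have : Continuous fun ζ : HSp n => dot x ζ :=
      continuous_dot.comp (continuous_const.prodMk continuous_id)
    exact Continuous.aestronglyMeasurable (by fun_prop)
  · intro x
    refine .of_forall fun ζ => ?_
    rw [norm_mul, mul_comm Complex.I, Complex.norm_exp_ofReal_mul_I, one_mul]
  · refine .of_forall fun ζ => ?_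
    have : Continuous fun x : HSp n => dot x ζ :=
      continuous_dot.comp (continuous_id.prodMk continuous_const)
    fun_prop

/-- The kernel depends on `y` only through `e^{-par(y)·ζ}`, the same factor as in
`IsDecaying.ft_eq`; this matches the transform with the Paley–Wiener density. -/
lemma bk_eq_exp_mul (l : ℝ) (y : HSp n) {t : HSp n} (ht : 0 < t.2) :
    bk l y t = Real.exp (-dot (par y) (scaleUp t)) * bk l 0 t := by
  have hs : Real.sqrt t.2 * Real.sqrt t.2 = t.2 := Real.mul_self_sqrt ht.le
  have : -t.2 * y.2 - (∑ k, (t.1 k + 2 * Real.sqrt t.2 * y.1 k) ^ 2) / 2 =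
      -dot (par y) (scaleUp t) + (-t.2 * 0 - (∑ k, (t.1 k + 2 * Real.sqrt t.2 * 0) ^ 2) / 2) := by
    simp only [dot, par, scaleUp, Pi.smul_apply, smul_eq_mul]
    have e : ∑ k, (t.1 k + 2 * Real.sqrt t.2 * y.1 k) ^ 2 = ∑ k, t.1 k ^ 2 +
        2 * ∑ k, y.1 k * (2 * Real.sqrt t.2 * t.1 k) + 4 * t.2 * ∑ k, y.1 k ^ 2 := by
      rw [Finset.mul_sum, Finset.mul_sum, ← Finset.sum_add_distrib, ← Finset.sum_add_distrib]
      refine Finset.sum_congr rfl fun k _ => ?_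
      linear_combination 4 * y.1 k ^ 2 * hs
    rw [e]
    simp only [mul_zero, add_zero]
    ring
  simp only [bk, this, Real.exp_add, Prod.fst_zero, Prod.snd_zero, Pi.zero_apply]
  ring

lemma lintegral_Ioi_rpow_eq_top {s : ℝ} (hs : -1 ≤ s) :
    ∫⁻ h in Set.Ioi (1 : ℝ), ENNReal.ofReal (h ^ s) = ⊤ := by
  by_contra hne
  have : IntegrableOn (fun h : ℝ => h ^ s) (Set.Ioi 1) := by
    refine ⟨by fun_prop, ?_⟩
    rw [hasFiniteIntegral_iff_ofReal]
    · exact lt_top_iff_ne_top.2 hne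
    · filter_upwards [ae_restrict_mem measurableSet_Ioi] with h hh
      have : (0 : ℝ) < h := one_pos.trans hh
      positivity
  have := (integrableOn_Ioi_rpow_iff one_pos).1 this
  linarith

/-- On the box `|y_k| ≤ 1`, `h > 1` the exponential is bounded below when `ζ_p ≤ 0`, and `h^{l-p-1}`
has exponent greater than `-1`, so it is not integrable at infinity. -/
lemma lintegral_exp_wHalf_eq_top {l : ℝ} (hl : (n : ℝ) + 1 < l) {ζ : HSp n} (hζ : ζ.2 ≤ 0) :
    ∫⁻ y, ENNReal.ofReal (Real.exp (-dot (par y) ζ) ^ 2) ∂(wHalf n l) = ⊤ := by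
  rw [wHalf, lintegral_withDensity_eq_lintegral_mul_non_measurable _ (measurable_wdens l)
    (.of_forall fun _ => ENNReal.ofReal_lt_top), halfMeasure_eq_prod]
  set c := Real.exp (-∑ k, |ζ.1 k|) ^ 2 with hc
  have hc0 : 0 < c := by positivity
  set B : Set (HSp n) := Set.univ.pi (fun _ => Set.Icc (-1) 1) ×ˢ Set.Ioi 1 with hB
  have hBm : MeasurableSet B :=
    (MeasurableSet.univ_pi fun _ => measurableSet_Icc).prod measurableSet_Ioi
  rw [eq_top_iff]
  refine le_trans ?_ (setLIntegral_le_lintegral B _)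
  have hle : ∀ y ∈ B, ENNReal.ofReal (y.2 ^ (l - (n + 1) - 1)) * ENNReal.ofReal c ≤
      ENNReal.ofReal (y.2 ^ (l - (n + 1) - 1)) *
        ENNReal.ofReal (Real.exp (-dot (par y) ζ) ^ 2) := by
    rintro y ⟨hy1, hy2⟩
    gcongr
    have hy2' : 0 ≤ y.2 := zero_le_one.trans (le_of_lt hy2)
    have h1 : ∑ k, y.1 k * ζ.1 k ≤ ∑ k, |ζ.1 k| := by
      refine Finset.sum_le_sum fun k _ => ?_
      have : |y.1 k| ≤ 1 := abs_le.2 (hy1 k trivial)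
      calc _ ≤ |y.1 k * ζ.1 k| := le_abs_self _
        _ = |y.1 k| * |ζ.1 k| := abs_mul _ _
        _ ≤ 1 * |ζ.1 k| := by gcongr
        _ = _ := one_mul _
    have h2 : (y.2 + 2 * ∑ k, y.1 k ^ 2) * ζ.2 ≤ 0 :=
      mul_nonpos_of_nonneg_of_nonpos (by positivity) hζ
    refine pow_le_pow_left₀ (Real.exp_pos _).le (Real.exp_le_exp.2 ?_) 2
    simp only [dot, par]
    linarith
  refine le_trans ?_ (setLIntegral_mono' hBm hle)
  rw [hB, ← Measure.prod_restrict]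
  rw [lintegral_prod _ (by fun_prop)]
  · simp only [lintegral_mul_const' _ _ ENNReal.ofReal_ne_top, lintegral_const]
    rw [Measure.restrict_restrict measurableSet_Ioi,
      Set.inter_eq_left.2 (Set.Ioi_subset_Ioi zero_le_one),
      lintegral_Ioi_rpow_eq_top (by linarith), Measure.restrict_apply_univ, volume_pi_pi,
      ENNReal.top_mul (by simp), ENNReal.top_mul]
    simp
    exact hc0

/-- A holomorphic function on the Siegel domain which is square integrable and decays fast on
horizontal slices is a Bargmann transform. -/
lemma exists_bargmannAdj_eq_of_isDecaying {l : ℝ} (hl : (n : ℝ) + 1 < l) {ψ : siegel n → ℂ}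
    (hD : IsDecaying (tubeFun ψ)) (h2 : MemLp ψ 2 (wSiegel n l)) :
    ∃ f, MemLp f 2 (halfMeasure n) ∧ ∀ z, bargmannAdj l f z = ψ z := by
  have hY₀ : par ((0, 1) : HSp n) ∈ tubeBase n := par_mem_tubeBase one_pos
  set Y₀ : HSp n := par (0, 1)
  -- The common density of all slices, read off at an arbitrary base point.
  set g : HSp n → ℂ := fun ζ => fc n *
    (Complex.exp (dot Y₀ ζ : ℂ) * ft (fun x => tubeFun ψ (cpt Y₀ x)) (-ζ)) with hg
  have hgc : Continuous g := by
    have h1 := continuous_ft (hD.integrable_slice hY₀)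
    have : Continuous fun ζ : HSp n => dot Y₀ ζ :=
      continuous_dot.comp (continuous_const.prodMk continuous_id)
    fun_prop
  have hdc : Continuous fun p : HSp n × HSp n => dot (par p.1) p.2 :=
    continuous_dot.comp ((continuous_par.comp continuous_fst).prodMk continuous_snd)
  set E : HSp n → HSp n → ℂ := fun y ζ => (Real.exp (-dot (par y) ζ) : ℂ) * g ζ with hE
  have hEft {y : HSp n} (hy : 0 < y.2) (ζ : HSp n) :
      E y ζ = fc n * ft (fun x => ψ (spt y x)) (-ζ) := by
    have := hD.ft_eq ζ hY₀ (par_mem_tubeBase hy)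
    simp only [tubeFun_cpt_par ψ hy] at this
    rw [hE, this, hg]
    push_cast
    ring
  have hEn (y ζ : HSp n) : ‖E y ζ‖ₑ ^ 2 =
      ENNReal.ofReal (Real.exp (-dot (par y) ζ) ^ 2) * ‖g ζ‖ₑ ^ 2 := by
    rw [hE, enorm_mul, mul_pow, ← ofReal_norm (Real.exp _ : ℂ), Complex.norm_real,
      Real.norm_of_nonneg (Real.exp_pos _).le, ENNReal.ofReal_pow (Real.exp_pos _).le]
  have hEP {y : HSp n} (hy : 0 < y.2) : ∫⁻ ζ, ‖E y ζ‖ₑ ^ 2 = ∫⁻ x, ‖ψ (spt y x)‖ₑ ^ 2 := by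
    have hi := hD.integrable_slice (par_mem_tubeBase hy)
    have hm := hD.memLp_slice (par_mem_tubeBase hy)
    simp only [tubeFun_cpt_par ψ hy] at hi hm
    have hfc : ‖(fc n : ℂ)‖ₑ ^ 2 = ENNReal.ofReal (fc n ^ 2) := by
      rw [← ofReal_norm, Complex.norm_real, Real.norm_of_nonneg (fc_pos n).le,
        ENNReal.ofReal_pow (fc_pos n).le]
    simp only [hEft hy, enorm_mul, mul_pow, hfc]
    rw [lintegral_const_mul' _ _ ENNReal.ofReal_ne_top,
      lintegral_neg_eq_self (fun ζ => ‖ft (fun x => ψ (spt y x)) ζ‖ₑ ^ 2),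
      lintegral_enorm_ft_sq hi hm, ← mul_assoc, ← ENNReal.ofReal_mul (sq_nonneg _), fc_sq_mul,
      ENNReal.ofReal_one, one_mul]
  have htot : ∫⁻ y, (∫⁻ ζ, ‖E y ζ‖ₑ ^ 2) ∂(wHalf n l) < ⊤ := by
    have hmp := measurePreserving_spt_weighted (n := n) l
    have h3 := lintegral_enorm_sq_lt_top h2
    have hψm : AEMeasurable (fun z => ‖ψ z‖ₑ ^ 2) (wSiegel n l) := h2.1.enorm.pow_const 2
    rw [← hmp.map_eq] at h3 hψm
    rw [lintegral_map' hψm hmp.measurable.aemeasurable,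
      lintegral_prod (fun p : HSp n × HSp n => ‖ψ (spt p.1 p.2)‖ₑ ^ 2)
        (hψm.comp_measurable hmp.measurable)] at h3
    refine lt_of_le_of_lt (lintegral_mono_ae ?_) h3
    filter_upwards [ae_wHalf l] with y hy
    exact (hEP hy).le
  -- By Tonelli `|g(ζ)|² ∫ e^{-2 par(y)·ζ}` is finite for almost every `ζ`; where `ζ_p ≤ 0` the
  -- integral diverges, so `g` must vanish.
  have hg0 : ∀ᵐ ζ : HSp n, ζ.2 ≤ 0 → g ζ = 0 := by
    have hEm : Measurable fun p : HSp n × HSp n => ‖E p.1 p.2‖ₑ ^ 2 := by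
      have : Continuous fun p : HSp n × HSp n => E p.1 p.2 := by fun_prop
      exact (this.measurable.enorm).pow_const 2
    rw [lintegral_lintegral_swap hEm.aemeasurable] at htot
    have h4 := ae_lt_top' (AEMeasurable.lintegral_prod_left' (f := fun p : HSp n × HSp n =>
      ‖E p.1 p.2‖ₑ ^ 2) hEm.aemeasurable) htot.ne
    filter_upwards [h4] with ζ hζ hζ2
    by_contra hne
    simp only [hEn] at hζ
    rw [lintegral_mul_const' _ _ (by simp), lintegral_exp_wHalf_eq_top hl hζ2,
      ENNReal.top_mul (by simpa using hne)] at hζ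
    exact lt_irrefl _ hζ
  -- Division by the kernel at `y = 0`; by `bk_eq_exp_mul` this recovers the density at every
  -- height.
  set f : HSp n → ℂ := fun t => g (scaleUp t) / (bk l 0 t : ℂ) with hf
  have hfm : AEStronglyMeasurable f (halfMeasure n) := by
    have h1 : Measurable fun t : HSp n => bk l 0 t :=
      (measurable_bk l).comp (measurable_const.prodMk measurable_id)
    exact ((hgc.measurable.comp measurable_scaleUp).div
      (Complex.measurable_ofReal.comp h1)).aestronglyMeasurable
  have hfs (y : HSp n) : ∀ᵐ ζ, fullSlice l f y ζ = E y ζ := by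
    filter_upwards [hg0] with ζ hζ
    by_cases h : 0 < ζ.2
    · have hd : 0 < (scaleDown ζ).2 := h
      have hb : (bk l 0 (scaleDown ζ) : ℂ) ≠ 0 := Complex.ofReal_ne_zero.2 (bk_pos hl 0 hd).ne'
      rw [fullSlice, Set.indicator_of_mem (by exact h), slice, bk_eq_exp_mul l y hd, hf, hE]
      simp only
      rw [scaleUp_scaleDown h]
      push_cast
      field_simp
    · rw [fullSlice, Set.indicator_of_notMem (by exact h), hE]
      simp [hζ (not_lt.1 h)]
  have hfL : MemLp f 2 (halfMeasure n) := by
    refine memLp_two_of_lintegral hfm ?_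
    have h5 := lintegral_lintegral_kk l (w := fun _ => 1) measurable_const hfm
    simp only [one_mul] at h5
    rw [lintegral_mul_kk_eq hl] at h5
    simp only [← lintegral_enorm_fullSlice_sq l hfm] at h5
    have h6 : ∫⁻ y, (∫⁻ ζ, ‖fullSlice l f y ζ‖ₑ ^ 2) ∂(wHalf n l) < ⊤ := by
      refine lt_of_le_of_lt (lintegral_mono fun y => lintegral_mono_ae ?_) htot
      filter_upwards [hfs y] with ζ hζ
      rw [hζ]
    rw [h5] at h6
    by_contra hne
    rw [not_lt_top_iff.1 hne, ENNReal.mul_top] at h6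
    · exact lt_irrefl _ h6
    · have := bergmanConst_pos hl
      simpa using this
  refine ⟨f, hfL, fun z => ?_⟩
  obtain ⟨x, hx⟩ := exists_spt_yc z
  have hy := yc_pos z
  set y := yc z.1
  have hc := hD.continuous_slice (par_mem_tubeBase hy)
  have hi := hD.integrable_slice (par_mem_tubeBase hy)
  simp only [tubeFun_cpt_par ψ hy] at hi hc
  have hcongr : fullSlice l f y =ᵐ[volume] fun ζ =>
      (fc n : ℂ) * ft (fun x => ψ (spt y x)) (-ζ) := by
    filter_upwards [hfs y] with ζ hζ
    rw [hζ, hEft hy]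
  have hfc0 : (fc n : ℂ) ≠ 0 := Complex.ofReal_ne_zero.2 (fc_pos n).ne'
  -- The transform of the slice agrees almost everywhere with a multiple of the integrable
  -- `fullSlice`. As the slice is continuous, inversion holds at every point.
  have hint : Integrable (ft fun x => ψ (spt y x)) := by
    have h7 := ((integrable_fullSlice hl hfL hy).congr hcongr).comp_neg.const_mul (fc n : ℂ)⁻¹
    refine h7.congr (.of_forall fun ζ => ?_)
    simp [hfc0]
  have h8 : ft (fullSlice l f y) x = fc n * ft (fun ζ => ft (fun x => ψ (spt y x)) (-ζ)) x := by
    rw [ft, ft, ← integral_const_mul]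
    refine integral_congr_ae ?_
    filter_upwards [hcongr] with ζ hζ
    rw [hζ]; ring
  rw [hx, bargmannAdj_spt_eq_ft l f hy, h8, ft_inversion hc hi hint, ← mul_assoc, ← mul_assoc,
    ← sq]
  have := congrArg (fun r : ℝ => (r : ℂ)) (fc_sq_mul n)
  simp only [Complex.ofReal_mul, Complex.ofReal_pow (fc n), Complex.ofReal_one] at this
  rw [this, one_mul]

end PaleyWienerDecaying
end SuperSiegel

end

noncomputable section
namespace SuperSiegel
open Filter Topology

/-! ### Closed range, and removal of the regularization. -/

section Surjectivity
variable {n : ℕ}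

lemma eLpNorm_two_sq {α : Type*} [MeasurableSpace α] (μ : Measure α) (f : α → ℂ) :
    eLpNorm f 2 μ ^ 2 = ∫⁻ x, ‖f x‖ₑ ^ 2 ∂μ := by
  have := eLpNorm_nnreal_pow_eq_lintegral (μ := μ) (f := f) (p := 2) two_ne_zero
  simpa using this

lemma tendsto_toLp_of_norm_le {α : Type*} [MeasurableSpace α] {μ : Measure α} {f : ℕ → α → ℂ}
    {g : α → ℂ} (hf : ∀ k, MemLp (f k) 2 μ) (hg : MemLp g 2 μ)
    (hle : ∀ k, ∀ᵐ x ∂μ, ‖f k x‖ ≤ ‖g x‖)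
    (hlim : ∀ᵐ x ∂μ, Tendsto (fun k => f k x) atTop (𝓝 (g x))) :
    Tendsto (fun k => (hf k).toLp (f k)) atTop (𝓝 (hg.toLp g)) := by
  rw [Lp.tendsto_Lp_iff_tendsto_eLpNorm'']
  have h1 : Tendsto (fun k => ∫⁻ x, ‖f k x - g x‖ₑ ^ 2 ∂μ) atTop (𝓝 (∫⁻ _, 0 ∂μ)) := by
    refine tendsto_lintegral_of_dominated_convergence' (fun x => 4 * ‖g x‖ₑ ^ 2)
      (fun k => ((hf k).1.sub hg.1).enorm.pow_const 2) (fun k => ?_) ?_ ?_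
    · filter_upwards [hle k] with x hx
      have h2 : ‖f k x - g x‖ₑ ≤ 2 * ‖g x‖ₑ := by
        refine (enorm_sub_le).trans ?_
        rw [two_mul]
        gcongr
        exact enorm_le_iff_norm_le.2 hx
      calc _ ≤ (2 * ‖g x‖ₑ) ^ 2 := by gcongr
        _ = _ := by rw [mul_pow]; norm_num
    · rw [lintegral_const_mul' _ _ (by simp)]
      exact ENNReal.mul_ne_top (by simp) (lintegral_enorm_sq_lt_top hg).ne
    · filter_upwards [hlim] with x hx
      have h3 : Tendsto (fun k => ‖f k x - g x‖ₑ ^ 2) atTop (𝓝 (‖g x - g x‖ₑ ^ 2)) :=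
        ((ENNReal.continuous_pow 2).comp continuous_enorm).continuousAt.tendsto.comp
          (hx.sub_const (g x))
      simpa using h3
  simp only [lintegral_zero] at h1
  have h4 := (ENNReal.continuous_rpow_const (y := 1 / 2)).continuousAt.tendsto.comp h1
  have e (k : ℕ) : (∫⁻ x, ‖f k x - g x‖ₑ ^ 2 ∂μ) ^ ((1 : ℝ) / 2) = eLpNorm (f k - g) 2 μ := by
    have := eLpNorm_two_sq μ (f k - g)
    simp only [Pi.sub_apply] at this
    rw [← this, ← ENNReal.rpow_natCast, ← ENNReal.rpow_mul]
    norm_num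
  simp only [Function.comp_def, e] at h4
  simpa using h4

lemma bargmannAdj_congr (l : ℝ) {f g : HSp n → ℂ} (h : f =ᵐ[halfMeasure n] g)
    (hf : AEStronglyMeasurable f (halfMeasure n)) (z : siegel n) :
    bargmannAdj l f z = bargmannAdj l g z := by
  obtain ⟨x, hx⟩ := exists_spt_yc z
  rw [hx, bargmannAdj_spt_eq l hf (yc_pos z), bargmannAdj_spt_eq l (hf.congr h) (yc_pos z)]
  congr 1
  refine integral_congr_ae ?_
  filter_upwards [h] with t ht
  rw [ht]

lemma bargmannAdj_add {l : ℝ} (hl : (n : ℝ) + 1 < l) {f g : HSp n → ℂ}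
    (hf : MemLp f 2 (halfMeasure n)) (hg : MemLp g 2 (halfMeasure n)) (z : siegel n) :
    bargmannAdj l (f + g) z = bargmannAdj l f z + bargmannAdj l g z := by
  obtain ⟨x, hx⟩ := exists_spt_yc z
  have hy := yc_pos z
  rw [hx, bargmannAdj_spt_eq l hf.1 hy, bargmannAdj_spt_eq l hg.1 hy,
    bargmannAdj_spt_eq l (hf.add hg).1 hy, ← mul_add,
    ← integral_add (integrable_exp_mul hl hf hy x) (integrable_exp_mul hl hg hy x)]
  simp only [Pi.add_apply, mul_add]

lemma bargmannAdj_smul (l : ℝ) (c : ℂ) {f : HSp n → ℂ}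
    (hf : AEStronglyMeasurable f (halfMeasure n)) (z : siegel n) :
    bargmannAdj l (c • f) z = c * bargmannAdj l f z := by
  obtain ⟨x, hx⟩ := exists_spt_yc z
  rw [hx, bargmannAdj_spt_eq l hf (yc_pos z), bargmannAdj_spt_eq l (hf.const_smul c) (yc_pos z),
    mul_left_comm c, ← integral_const_mul c]
  refine congrArg _ ?_
  refine integral_congr_ae (.of_forall fun t => ?_)
  simp only [Pi.smul_apply, smul_eq_mul]
  ring

instance : (siegelMeasure n).IsOpenPosMeasure :=
  Measure.IsOpenPosMeasure.comap volume isOpen_siegel.isOpenEmbedding_subtypeVal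

lemma ae_wSiegel (l : ℝ) : siegelMeasure n ≪ wSiegel n l := by
  refine withDensity_absolutelyContinuous' (measurable_wdens_siegel l).aemeasurable
    (.of_forall fun z => ?_)
  have : 0 < height z.1 := z.2
  have h2 : 0 < height z.1 ^ (l - (n + 1) - 1) := Real.rpow_pos_of_pos this _
  simpa using h2

/-- The weight is positive and the volume charges open sets, so continuous representatives are
unique. -/
lemma eq_of_ae_eq_wSiegel {l : ℝ} {φ ψ : siegel n → ℂ} (hφ : Continuous φ) (hψ : Continuous ψ)
    (h : φ =ᵐ[wSiegel n l] ψ) : φ = ψ :=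
  (hφ.ae_eq_iff_eq (siegelMeasure n) hψ).1 ((ae_wSiegel l).ae_le h)

lemma norm_toLp_two {α : Type*} [MeasurableSpace α] {μ : Measure α} {f : α → ℂ}
    (hf : MemLp f 2 μ) : ‖hf.toLp f‖ ^ 2 = (∫⁻ x, ‖f x‖ₑ ^ 2 ∂μ).toReal := by
  rw [Lp.norm_toLp, ← eLpNorm_two_sq, ENNReal.toReal_pow]

/-- The Bargmann transform as an operator between Hilbert spaces. -/
def bargmannLp {l : ℝ} (hl : (n : ℝ) + 1 < l) :
    Lp ℂ 2 (halfMeasure n) →ₗ[ℂ] Lp ℂ 2 (wSiegel n l) where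
  toFun f := (memLp_bargmannAdj hl (Lp.memLp f)).toLp _
  map_add' f g := by
    rw [← MemLp.toLp_add]
    refine MemLp.toLp_congr _ _ (.of_forall fun z => ?_)
    rw [bargmannAdj_congr l (Lp.coeFn_add f g) (Lp.aestronglyMeasurable _),
      bargmannAdj_add hl (Lp.memLp f) (Lp.memLp g), Pi.add_apply]
  map_smul' c f := by
    rw [← MemLp.toLp_const_smul]
    refine MemLp.toLp_congr _ _ (.of_forall fun z => ?_)
    rw [bargmannAdj_congr l (Lp.coeFn_smul c f) (Lp.aestronglyMeasurable _),
      bargmannAdj_smul l c (Lp.aestronglyMeasurable f), RingHom.id_apply, Pi.smul_apply,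
      smul_eq_mul]

lemma norm_bargmannLp {l : ℝ} (hl : (n : ℝ) + 1 < l) (f : Lp ℂ 2 (halfMeasure n)) :
    ‖bargmannLp hl f‖ = Real.sqrt (4 / bergmanConst n l) * ‖f‖ := by
  have h0 := bergmanConst_pos hl
  have h1 := norm_toLp_two (memLp_bargmannAdj hl (Lp.memLp f))
  have h2 := norm_toLp_two (Lp.memLp f)
  rw [lintegral_enorm_bargmannAdj_sq hl (Lp.memLp f), ENNReal.toReal_mul, ← h2,
    ENNReal.toReal_ofReal (by positivity), Lp.toLp_coeFn] at h1
  rw [← Real.sqrt_sq (norm_nonneg f), ← Real.sqrt_mul (by positivity), ← h1,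
    Real.sqrt_sq (norm_nonneg _)]
  rfl

lemma bargmannLp_coeFn {l : ℝ} (hl : (n : ℝ) + 1 < l) (f : Lp ℂ 2 (halfMeasure n)) :
    bargmannLp hl f =ᵐ[wSiegel n l] bargmannAdj l f :=
  (memLp_bargmannAdj hl (Lp.memLp f)).coeFn_toLp

lemma injective_bargmannLp {l : ℝ} (hl : (n : ℝ) + 1 < l) :
    Function.Injective (bargmannLp (n := n) hl) := by
  rw [injective_iff_map_eq_zero]
  intro f hf
  have h1 := norm_bargmannLp hl f
  have h0 := bergmanConst_pos hl
  have h2 : Real.sqrt (4 / bergmanConst n l) ≠ 0 := by positivity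
  rw [hf, norm_zero, eq_comm, mul_eq_zero, norm_eq_zero] at h1
  exact h1.resolve_left h2

/-- A positive multiple of an isometry defined on a complete space has closed range. -/
lemma isClosed_range_bargmannLp {l : ℝ} (hl : (n : ℝ) + 1 < l) :
    IsClosed (Set.range (bargmannLp (n := n) hl)) := by
  have h0 := bergmanConst_pos hl
  set c := Real.sqrt (4 / bergmanConst n l) with hc
  have hcp : 0 < c := by positivity
  have hle (f : Lp ℂ 2 (halfMeasure n)) : ‖bargmannLp hl f‖ ≤ c * ‖f‖ := (norm_bargmannLp hl f).le
  have ha : AntilipschitzWith (Real.toNNReal c⁻¹) (bargmannLp (n := n) hl) := by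
    refine AddMonoidHomClass.antilipschitz_of_bound _ fun f => ?_
    rw [norm_bargmannLp hl, Real.coe_toNNReal _ (by positivity), ← hc, inv_mul_cancel_left₀ hcp.ne']
  exact ha.isClosed_range (AddMonoidHomClass.uniformContinuous_of_bound _ c hle)

lemma tendsto_reg (m : ℕ) {z : (Fin n → ℂ) × ℂ} :
    Tendsto (fun k : ℕ => reg (1 / ((k : ℝ) + 1)) m z) atTop (𝓝 1) := by
  have h1 : Tendsto (fun k : ℕ => (((1 / ((k : ℝ) + 1) : ℝ)) : ℂ)) atTop (𝓝 0) :=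
    (Complex.continuous_ofReal.tendsto 0).comp tendsto_one_div_add_atTop_nhds_zero_nat
  have h2 : ContinuousAt (fun e : ℂ => ((1 - Complex.I * e * z.2) ^ m)⁻¹) 0 := by
    refine ContinuousAt.inv₀ (by fun_prop) (by simp)
  have h3 := h2.tendsto.comp h1
  simpa [reg, Function.comp_def] using h3

lemma IsHolomorphic.reg_mul {ε : ℝ} (hε : 0 < ε) (m : ℕ) {ψ : siegel n → ℂ}
    (hψ : IsHolomorphic ψ) : IsHolomorphic fun z => reg ε m z.1 * ψ z := by
  refine ((differentiableOn_reg hε m).mul hψ).congr fun z hz => ?_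
  have e (φ : siegel n → ℂ) : Function.extend Subtype.val φ 0 z = φ ⟨z, hz⟩ :=
    Subtype.val_injective.extend_apply φ 0 ⟨z, hz⟩
  rw [Pi.mul_apply, e, e]

/-- The Bargmann transform is onto the weighted Bergman space. -/
theorem exists_bargmannAdj_eq {l : ℝ} (hl : (n : ℝ) + 1 < l) {ψ : siegel n → ℂ}
    (hψ : IsHolomorphic ψ) (h2 : MemLp ψ 2 (wSiegel n l)) :
    ∃ f : Lp ℂ 2 (halfMeasure n), bargmannAdj l f = ψ := by
  have hε (k : ℕ) : 0 < 1 / ((k : ℝ) + 1) := by positivity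
  set φ : ℕ → siegel n → ℂ := fun k z => reg (1 / ((k : ℝ) + 1)) (n + 2) z.1 * ψ z with hφ
  have hle (k : ℕ) (z : siegel n) : ‖φ k z‖ ≤ ‖ψ z‖ := by
    rw [hφ, norm_mul]
    exact mul_le_of_le_one_left (norm_nonneg _) (norm_reg_le_one (hε k) _ z.2)
  have hφL (k : ℕ) : MemLp (φ k) 2 (wSiegel n l) :=
    h2.mono ((hψ.reg_mul (hε k) _).continuous.aestronglyMeasurable) (.of_forall (hle k))
  have hran (k : ℕ) : (hφL k).toLp (φ k) ∈ Set.range (bargmannLp (n := n) hl) := by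
    obtain ⟨f, hf, hfe⟩ := exists_bargmannAdj_eq_of_isDecaying hl
      (isDecaying_tubeFun_reg (hε k) hψ h2) (hφL k)
    refine ⟨hf.toLp f, MemLp.toLp_congr (memLp_bargmannAdj hl (Lp.memLp _)) (hφL k) (.of_forall fun z => ?_)⟩
    rw [bargmannAdj_congr l hf.coeFn_toLp (Lp.aestronglyMeasurable _), hfe]
  have hlim := tendsto_toLp_of_norm_le hφL h2 (fun k => .of_forall (hle k)) (.of_forall fun z => by
    have := (tendsto_reg (n + 2) (z := z.1)).mul_const (ψ z)
    rwa [one_mul] at this)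
  -- Each regularized function is a transform, and they converge to `ψ` in `L²` by domination;
  -- closedness of the range catches the limit.
  obtain ⟨f, hf⟩ := (isClosed_range_bargmannLp hl).mem_of_tendsto hlim (.of_forall hran)
  refine ⟨f, eq_of_ae_eq_wSiegel (l := l)
    (isHolomorphic_bargmannAdj hl (Lp.memLp f)).continuous hψ.continuous ?_⟩
  filter_upwards [bargmannLp_coeFn hl f, h2.coeFn_toLp] with z h3 h4
  rw [← h3, hf, h4]

lemma bargmannAdj_injective {l : ℝ} (hl : (n : ℝ) + 1 < l) {f g : Lp ℂ 2 (halfMeasure n)}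
    (h : bargmannAdj l f = bargmannAdj l g) : f = g := by
  refine injective_bargmannLp hl (MemLp.toLp_congr (memLp_bargmannAdj hl (Lp.memLp f))
    (memLp_bargmannAdj hl (Lp.memLp g)) (.of_forall fun z => ?_))
  rw [h]

end Surjectivity
end SuperSiegel

end

noncomputable section
namespace SuperSiegel
open Filter Topology

/-! ### Berezin integrals in the Grassmann algebra. -/

section BerezinIntegral
variable {q : ℕ}

/-- The linear map rescaling one of the generators. -/
def genScale (a : Fin (q + q)) (t : ℂ) : (Fin (q + q) → ℂ) →ₗ[ℂ] (Fin (q + q) → ℂ) where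
  toFun v i := Function.update (fun _ => (1 : ℂ)) a t i * v i
  map_add' v w := by ext i; simp [mul_add]
  map_smul' c v := by ext i; simp [mul_left_comm]

lemma genScale_single (a b : Fin (q + q)) (t : ℂ) :
    genScale a t (Pi.single b 1) = (if b = a then t else 1) • Pi.single b 1 := by
  ext i
  by_cases h : i = b
  · subst h
    by_cases h2 : i = a
    · subst h2; simp [genScale]
    · simp [genScale, h2]
  · simp [genScale, h]

/-- In top degree the functional is a determinant, and scaling one generator scales one column; in
all other degrees both sides vanish. -/
lemma berezin_map_genScale (a : Fin (q + q)) (t : ℂ) (x : Grassmann q) :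
    berezin q (ExteriorAlgebra.map (genScale a t) x) = t * berezin q x := by
  have : berezin q ∘ₗ (ExteriorAlgebra.map (genScale a t)).toLinearMap = t • berezin q := by
    refine ExteriorAlgebra.lhom_ext fun i => ?_
    ext v
    simp only [LinearMap.compAlternatingMap_apply, LinearMap.comp_apply, AlgHom.toLinearMap_apply,
      ExteriorAlgebra.map_apply_ιMulti, LinearMap.smul_apply, berezin,
      ExteriorAlgebra.liftAlternating_apply_ιMulti]
    by_cases h : i = q + q
    · subst h
      rw [Pi.single_eq_same]
      have := Matrix.det_mul_row (Function.update (fun _ => (1 : ℂ)) a t) (Matrix.of v)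
      rw [Finset.prod_update_of_mem (Finset.mem_univ a)] at this
      simp only [Finset.prod_const_one, mul_one] at this
      exact this
    · rw [Pi.single_eq_of_ne h]
      simp
  exact LinearMap.congr_fun this x

/-- The even element `ξ̄_j ξ_j`. -/
def evenGen (j : Fin q) : Grassmann q := xiBar j * xi j

lemma ι_mul_ι_mul_ι (x y z : Fin (q + q) → ℂ) :
    ExteriorAlgebra.ι ℂ x * ExteriorAlgebra.ι ℂ y * ExteriorAlgebra.ι ℂ z =
      ExteriorAlgebra.ι ℂ z * (ExteriorAlgebra.ι ℂ x * ExteriorAlgebra.ι ℂ y) := by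
  have h1 := ExteriorAlgebra.ι_add_mul_swap (R := ℂ) y z
  have h2 := ExteriorAlgebra.ι_add_mul_swap (R := ℂ) x z
  rw [add_eq_zero_iff_eq_neg] at h1 h2
  rw [mul_assoc, h1, mul_neg, ← mul_assoc, h2, neg_mul, neg_neg, mul_assoc]

lemma evenGen_commute (j : Fin q) (x : Grassmann q) : Commute (evenGen j) x := by
  induction x using ExteriorAlgebra.induction with
  | algebraMap r => exact (Algebra.commutes r _).symm
  | ι m => exact ι_mul_ι_mul_ι _ _ _
  | mul a b ha hb => exact ha.mul_right hb
  | add a b ha hb => exact ha.add_right hb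

lemma xi_mul_self (j : Fin q) : xi j * xi j = 0 := ExteriorAlgebra.ι_sq_zero _

lemma xi_mul_xiBar (j : Fin q) : xi j * xiBar j = -evenGen j := by
  have := ExteriorAlgebra.ι_add_mul_swap (R := ℂ)
    (Pi.single (Fin.natAdd q j) 1 : Fin (q + q) → ℂ) (Pi.single (Fin.castAdd q (Fin.rev j)) 1)
  rwa [add_eq_zero_iff_eq_neg] at this

lemma evenGen_mul_self (j : Fin q) : evenGen j * evenGen j = 0 := by
  have h : xi j * evenGen j = 0 := by
    rw [← (evenGen_commute j (xi j)).eq, evenGen, mul_assoc, xi_mul_self, mul_zero]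
  rw [show evenGen j * evenGen j = xiBar j * (xi j * evenGen j) by simp only [evenGen, mul_assoc],
    h, mul_zero]

/-- The even elements in the center. -/
def centralGen (j : Fin q) : Subalgebra.center ℂ (Grassmann q) :=
  ⟨evenGen j, Subalgebra.mem_center_iff.2 fun x => (evenGen_commute j x).eq.symm⟩

/-- The product of the `ξ̄_j ξ_j` over a set of indices. -/
def evenProd (A : Finset (Fin q)) : Grassmann q :=
  ((∏ j ∈ A, centralGen j : Subalgebra.center ℂ (Grassmann q)) : Grassmann q)

lemma evenProd_commute (A : Finset (Fin q)) (x : Grassmann q) : Commute (evenProd A) x :=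
  (Subalgebra.mem_center_iff.1 (∏ j ∈ A, centralGen j : Subalgebra.center ℂ (Grassmann q)).2 x).symm

lemma evenProd_union {A B : Finset (Fin q)} (h : Disjoint A B) :
    evenProd (A ∪ B) = evenProd A * evenProd B := by
  rw [evenProd, Finset.prod_union h]; rfl

lemma evenProd_eq_list (A : Finset (Fin q)) : evenProd A = (A.sort.map evenGen).prod := by
  have h : ∏ j ∈ A, centralGen j = (A.sort.map centralGen).prod := by
    conv_lhs => rw [← Finset.sort_toFinset A (· ≤ ·)]
    rw [List.prod_toFinset _ (Finset.sort_nodup A _)]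
  rw [evenProd, h, ← Subalgebra.coe_val, map_list_prod, List.map_map]
  rfl

/-- The reversed order places `ξ̄_a ξ_a` innermost. This pair is central and can be pulled out, so
no sign appears. -/
lemma xiStarProd_mul_xiProd (M : Finset (Fin q)) : xiStarProd M * xiProd M = evenProd M := by
  rw [evenProd_eq_list, xiStarProd, xiProd]
  induction M.sort with
  | nil => simp
  | cons a L ih =>
    rw [List.reverse_cons, List.map_append, List.prod_append, List.map_singleton,
      List.prod_singleton, List.map_cons, List.prod_cons, List.map_cons, List.prod_cons, ← ih]
    have h := (evenGen_commute a (L.reverse.map xiBar).prod).eq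
    rw [← mul_assoc (evenGen a), h, evenGen]
    simp only [mul_assoc]

/-- Here `ξ_a` and `ξ̄_a` are outermost, with a central element between them; bringing them together
leaves `ξ_a ξ̄_a = -ξ̄_a ξ_a`, one sign for each index. -/
lemma xiProd_mul_xiStarProd (M : Finset (Fin q)) :
    xiProd M * xiStarProd M = (-1 : ℂ) ^ M.card • evenProd M := by
  rw [evenProd_eq_list, xiStarProd, xiProd, ← Finset.length_sort (· ≤ ·) (s := M)]
  induction M.sort with
  | nil => simp
  | cons a L ih =>
    rw [List.reverse_cons, List.map_append, List.prod_append, List.map_singleton,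
      List.prod_singleton, List.map_cons, List.prod_cons, List.map_cons, List.prod_cons]
    have h1 : (L.map xi).prod * ((L.reverse.map xiBar).prod * xiBar a) =
        xiBar a * ((L.map xi).prod * (L.reverse.map xiBar).prod) := by
      rw [← mul_assoc, ih, smul_mul_assoc, mul_smul_comm]
      congr 1
      have : ∀ x ∈ L.map evenGen, Commute x (xiBar a) := by
        intro x hx
        obtain ⟨j, _, rfl⟩ := List.mem_map.1 hx
        exact evenGen_commute j _
      exact (Commute.list_prod_left _ _ this).eq
    rw [mul_assoc, h1, ih, ← mul_assoc, xi_mul_xiBar, List.length_cons, pow_succ, mul_smul_comm,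
      mul_neg_one, neg_smul, neg_mul, smul_neg]

/-! ### Powers of the nilpotent element -/

/-- Only squarefree monomials survive, each from `k!` orderings. It is stated for commutative rings
because it is applied in the center of the Grassmann algebra. -/
lemma sum_pow_of_sq_eq_zero {R ι : Type*} [CommRing R] [DecidableEq ι] (e : ι → R)
    (he : ∀ j, e j ^ 2 = 0) (S : Finset ι) (k : ℕ) :
    (∑ j ∈ S, e j) ^ k = (k.factorial : R) * ∑ A ∈ S.powersetCard k, ∏ j ∈ A, e j := by
  induction S using Finset.induction_on generalizing k with
  | empty =>
    cases k with
    | zero => simp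
    | succ k => rw [Finset.powersetCard_eq_empty.2 (by simp)]; simp
  | insert a S ha ih =>
    rw [Finset.sum_insert ha]
    cases k with
    | zero => simp
    | succ k =>
      have h1 (X : R) (k : ℕ) : (e a + X) ^ (k + 1) = X ^ (k + 1) + (k + 1) * (e a * X ^ k) := by
        induction k with
        | zero => ring
        | succ k ihk =>
          rw [pow_succ, ihk]
          push_cast
          linear_combination (k + 1) * X ^ k * he a
      rw [h1, ih, ih, Finset.powersetCard_succ_insert ha, Finset.sum_union, Finset.sum_image]
      · have h2 : ∑ A ∈ S.powersetCard k, ∏ j ∈ insert a A, e j =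
            e a * ∑ A ∈ S.powersetCard k, ∏ j ∈ A, e j := by
          rw [Finset.mul_sum]
          refine Finset.sum_congr rfl fun A hA => ?_
          rw [Finset.prod_insert fun h => ha ((Finset.mem_powersetCard.1 hA).1 h)]
        rw [h2, Nat.factorial_succ]
        push_cast
        ring
      · intro A hA B hB h
        have hA' : a ∉ A := fun h => ha ((Finset.mem_powersetCard.1 hA).1 h)
        have hB' : a ∉ B := fun h => ha ((Finset.mem_powersetCard.1 hB).1 h)
        rw [← Finset.erase_insert hA', ← Finset.erase_insert hB']
        exact congrArg (fun s => s.erase a) h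
      · refine Finset.disjoint_left.2 fun A hA hA' => ?_
        obtain ⟨B, _, rfl⟩ := Finset.mem_image.1 hA'
        exact ha ((Finset.mem_powersetCard.1 hA).1 (Finset.mem_insert_self a B))

lemma neg_sum_pow (k : ℕ) : (-∑ j : Fin q, xi j * xiBar j) ^ k =
    (k.factorial : ℂ) • ∑ A ∈ (Finset.univ : Finset (Fin q)).powersetCard k, evenProd A := by
  have h := sum_pow_of_sq_eq_zero (centralGen (q := q))
    (fun j => Subtype.ext (by rw [sq]; exact evenGen_mul_self j)) Finset.univ k
  have h2 := congrArg (Subalgebra.center ℂ (Grassmann q)).val h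
  simp only [map_pow, map_sum, map_mul, map_natCast] at h2
  have h3 : -∑ j : Fin q, xi j * xiBar j = ∑ j, evenGen j := by
    simp [xi_mul_xiBar]
  rw [h3, Nat.cast_smul_eq_nsmul, nsmul_eq_mul]
  exact h2

/-! ### Berezin integrals of monomials -/

lemma map_genScale_xi (a : Fin (q + q)) (t : ℂ) (j : Fin q) :
    ExteriorAlgebra.map (genScale a t) (xi j) = (if Fin.natAdd q j = a then t else 1) • xi j := by
  rw [xi, ExteriorAlgebra.map_apply_ι, genScale_single, map_smul]

lemma map_genScale_xiBar (a : Fin (q + q)) (t : ℂ) (j : Fin q) :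
    ExteriorAlgebra.map (genScale a t) (xiBar j) =
      (if Fin.castAdd q (Fin.rev j) = a then t else 1) • xiBar j := by
  rw [xiBar, ExteriorAlgebra.map_apply_ι, genScale_single, map_smul]

lemma map_list_smul_prod {R A ι : Type*} [CommSemiring R] [Semiring A] [Algebra R A] (c : ι → R)
    (x : ι → A) (L : List ι) :
    (L.map fun j => c j • x j).prod = (L.map c).prod • (L.map x).prod := by
  induction L with
  | nil => simp
  | cons a L ih => simp [ih, smul_smul, mul_comm]

lemma map_genScale_evenProd (a : Fin (q + q)) (t : ℂ) (A : Finset (Fin q)) :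
    ExteriorAlgebra.map (genScale a t) (evenProd A) =
      (∏ j ∈ A, ((if Fin.castAdd q (Fin.rev j) = a then t else 1) *
        (if Fin.natAdd q j = a then t else 1))) • evenProd A := by
  rw [evenProd_eq_list, map_list_prod, List.map_map]
  have : (ExteriorAlgebra.map (genScale a t) ∘ evenGen : Fin q → Grassmann q) = fun j =>
      ((if Fin.castAdd q (Fin.rev j) = a then t else 1) *
        (if Fin.natAdd q j = a then t else 1)) • evenGen j := by
    ext j
    simp only [Function.comp, evenGen, map_mul, map_genScale_xi, map_genScale_xiBar,
      smul_mul_assoc, mul_smul_comm, smul_smul]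
    rw [mul_comm]
  rw [this, map_list_smul_prod]
  conv_rhs => rw [← Finset.sort_toFinset A (· ≤ ·)]
  rw [List.prod_toFinset _ (Finset.sort_nodup A _), Finset.sort_toFinset]

lemma map_genScale_xiProd (a : Fin (q + q)) (t : ℂ) (A : Finset (Fin q)) :
    ExteriorAlgebra.map (genScale a t) (xiProd A) =
      (∏ j ∈ A, (if Fin.natAdd q j = a then t else 1)) • xiProd A := by
  rw [xiProd, map_list_prod, List.map_map]
  have : (ExteriorAlgebra.map (genScale a t) ∘ xi : Fin q → Grassmann q) = fun j =>
      (if Fin.natAdd q j = a then t else 1) • xi j := by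
    ext j
    simp only [Function.comp, map_genScale_xi]
  rw [this, map_list_smul_prod]
  conv_rhs => rw [← Finset.sort_toFinset A (· ≤ ·)]
  rw [List.prod_toFinset _ (Finset.sort_nodup A _), Finset.sort_toFinset]

lemma map_genScale_xiStarProd (a : Fin (q + q)) (t : ℂ) (A : Finset (Fin q)) :
    ExteriorAlgebra.map (genScale a t) (xiStarProd A) =
      (∏ j ∈ A, (if Fin.castAdd q (Fin.rev j) = a then t else 1)) • xiStarProd A := by
  rw [xiStarProd, map_list_prod, List.map_map]
  have : (ExteriorAlgebra.map (genScale a t) ∘ xiBar : Fin q → Grassmann q) = fun j =>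
      (if Fin.castAdd q (Fin.rev j) = a then t else 1) • xiBar j := by
    ext j
    simp only [Function.comp, map_genScale_xiBar]
  rw [this, map_list_smul_prod, List.map_reverse, List.prod_reverse]
  conv_rhs => rw [← Finset.sort_toFinset A (· ≤ ·)]
  rw [List.prod_toFinset _ (Finset.sort_nodup A _), Finset.sort_toFinset]

/-- The product `ξ_Q^* ξ_Q` lists the basis vectors in their standard order, so the functional is
the determinant of the identity matrix. -/
lemma berezin_evenProd_univ : berezin q (evenProd Finset.univ) = 1 := by
  have h : evenProd (Finset.univ : Finset (Fin q)) =
      ExteriorAlgebra.ιMulti ℂ (q + q) (fun i => Pi.single i 1) := by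
    rw [← xiStarProd_mul_xiProd, xiStarProd, xiProd, Fin.sort_univ, List.finRange_reverse,
      ExteriorAlgebra.ιMulti_apply, List.map_map, ← List.prod_append,
      ← List.ofFn_eq_map, ← List.ofFn_eq_map, ← List.ofFn_fin_append]
    congr 2
    ext i
    refine Fin.addCases (fun j => ?_) (fun j => ?_) i
    · rw [Fin.append_left]; simp [xiBar]
    · rw [Fin.append_right]; rfl
  rw [h, berezin, ExteriorAlgebra.liftAlternating_apply_ιMulti, Pi.single_eq_same]
  have : (fun i : Fin (q + q) => (Pi.single i 1 : Fin (q + q) → ℂ)) = (1 : Matrix _ _ ℂ) := by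
    ext i j
    simp [Matrix.one_apply, Pi.single_apply, eq_comm]
  rw [this]
  exact Matrix.det_one

lemma prod_ite_eq_pow {ι : Type*} [DecidableEq ι] (A : Finset ι) (a : ι) (t : ℂ) :
    ∏ j ∈ A, (if j = a then t else 1) = t ^ (if a ∈ A then 1 else 0) := by
  rw [Finset.prod_ite_eq' A a fun _ => t]
  split_ifs <;> simp

lemma partition_of_count {A I M N : Finset (Fin q)}
    (h1 : ∀ j, (if j ∈ A then 1 else 0) + (if j ∈ I then 1 else 0) + (if j ∈ M then 1 else 0) = 1)
    (h2 : ∀ j, (if j ∈ A then 1 else 0) + (if j ∈ I then 1 else 0) + (if j ∈ N then 1 else 0) = 1) :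
    M = N ∧ Disjoint I M ∧ A = (I ∪ M)ᶜ := by
  refine ⟨?_, ?_, ?_⟩
  · ext j
    have h1 := h1 j
    have h2 := h2 j
    by_cases hM : j ∈ M <;> by_cases hN : j ∈ N <;> simp only [hM, hN, if_true, if_false] at h1 h2 ⊢
      <;> omega
  · refine Finset.disjoint_left.2 fun j hI hM => ?_
    have h1 := h1 j
    simp only [hI, hM, if_true] at h1
    omega
  · ext j
    have h1 := h1 j
    rw [Finset.mem_compl, Finset.mem_union]
    by_cases hA : j ∈ A <;> by_cases hI : j ∈ I <;> by_cases hM : j ∈ M <;>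
      simp [hA, hI, hM] at h1 ⊢

/-- A weight argument: doubling one generator multiplies the monomial by `2^m`, with `m` its
multiplicity, and the functional by `2`. A nonzero value thus forces `m = 1`. Counting `ξ̄_j` and
`ξ_j` separately says that `A`, `I`, `M` partition the indices, and so do `A`, `I`, `N`; hence `M =
N`. -/
lemma berezin_monomial (A I M N : Finset (Fin q)) :
    berezin q (evenProd A * evenProd I * (xiStarProd M * xiProd N)) =
      if M = N ∧ Disjoint I M ∧ A = (I ∪ M)ᶜ then 1 else 0 := by
  set X := evenProd A * evenProd I * (xiStarProd M * xiProd N) with hX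
  have hpow {m : ℕ} (h : (2 : ℂ) ^ m * berezin q X = 2 * berezin q X) (h0 : berezin q X ≠ 0) :
      m = 1 := by
    have h2 := mul_right_cancel₀ h0 h
    have h3 : (2 : ℕ) ^ m = 2 ^ 1 := by exact_mod_cast h2.trans (pow_one 2).symm
    exact Nat.pow_right_injective le_rfl h3
  have hbar (j : Fin q) (h0 : berezin q X ≠ 0) :
      (if j ∈ A then 1 else 0) + (if j ∈ I then 1 else 0) + (if j ∈ M then 1 else 0) = 1 := by
    refine hpow ?_ h0
    rw [← berezin_map_genScale (Fin.castAdd q (Fin.rev j)) 2 X, hX]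
    have e1 (i : Fin q) : Fin.natAdd q i ≠ Fin.castAdd q (Fin.rev j) := by
      intro h; have := congrArg Fin.val h; simp at this; omega
    simp only [map_mul, map_genScale_evenProd, map_genScale_xiProd, map_genScale_xiStarProd, e1,
      if_false, mul_one, (Fin.castAdd_injective q q).eq_iff, Fin.rev_inj, prod_ite_eq_pow,
      Finset.prod_const_one, one_smul, smul_mul_assoc, mul_smul_comm, map_smul, smul_eq_mul]
    ring
  have hxi (j : Fin q) (h0 : berezin q X ≠ 0) :
      (if j ∈ A then 1 else 0) + (if j ∈ I then 1 else 0) + (if j ∈ N then 1 else 0) = 1 := by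
    refine hpow ?_ h0
    rw [← berezin_map_genScale (Fin.natAdd q j) 2 X, hX]
    have e1 (i : Fin q) : Fin.castAdd q (Fin.rev i) ≠ Fin.natAdd q j := by
      intro h; have := congrArg Fin.val h; simp at this; omega
    simp only [map_mul, map_genScale_evenProd, map_genScale_xiProd, map_genScale_xiStarProd, e1,
      if_false, one_mul, (Fin.natAdd_injective q q).eq_iff, prod_ite_eq_pow,
      Finset.prod_const_one, one_smul, smul_mul_assoc, mul_smul_comm, map_smul,
      smul_eq_mul]
    ring
  by_cases h0 : berezin q X = 0
  · rw [h0, if_neg]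
    rintro ⟨rfl, hd, rfl⟩
    rw [hX, xiStarProd_mul_xiProd, mul_assoc, ← evenProd_union hd,
      ← evenProd_union disjoint_compl_left, Finset.union_comm (I ∪ M)ᶜ, Finset.union_compl, berezin_evenProd_univ] at h0
    exact one_ne_zero h0
  · have hc := partition_of_count (fun j => hbar j h0) (fun j => hxi j h0)
    rw [if_pos hc]
    obtain ⟨rfl, hd, rfl⟩ := hc
    rw [hX, xiStarProd_mul_xiProd, mul_assoc, ← evenProd_union hd,
      ← evenProd_union disjoint_compl_left, Finset.union_comm (I ∪ M)ᶜ, Finset.union_compl, berezin_evenProd_univ]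

end BerezinIntegral
end SuperSiegel

end

noncomputable section
namespace SuperSiegel
open Filter Topology

/-! ### The super pairing after integrating out the odd variables. -/

section Pairing
variable {n q : ℕ}

lemma descPochhammer_eval_eq_Gamma {s : ℝ} (k : ℕ) (h : 0 < s + 1 - k) :
    (descPochhammer ℝ k).eval s = Real.Gamma (s + 1) / Real.Gamma (s + 1 - k) := by
  induction k with
  | zero =>
    have := (Real.Gamma_pos_of_pos h).ne'
    simp at this
    simp [this]
  | succ k ih =>
    have hk : 0 < s - k := by push_cast at h; linarith
    have h1 : Real.Gamma (s - k + 1) = (s - k) * Real.Gamma (s - k) := Real.Gamma_add_one hk.ne'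
    have h2 : s + 1 - (k : ℝ) = s - k + 1 := by ring
    have h3 : s + 1 - ((k + 1 : ℕ) : ℝ) = s - k := by push_cast; ring
    rw [descPochhammer_succ_right, Polynomial.eval_mul, ih (by linarith), h2, h1, h3]
    have := (Real.Gamma_pos_of_pos hk).ne'
    simp
    field_simp

/-- Of the whole binomial series only the term of degree `|(I ∪ M)ᶜ|` contributes, and in it only
the monomial of this complement; the factorials cancel. -/
lemma berezin_superPow_mul (r s : ℝ) (I M N : Finset (Fin q)) :
    berezin q (superPow q r s * (xiStarProd M * (xiProd I * xiStarProd I * xiProd N))) =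
      if M = N ∧ Disjoint I M then (-1 : ℂ) ^ I.card *
        (((descPochhammer ℝ ((I ∪ M)ᶜ).card).eval s * r ^ (s - ((I ∪ M)ᶜ).card) : ℝ) : ℂ)
      else 0 := by
  have h1 : xiStarProd M * (xiProd I * xiStarProd I * xiProd N) =
      (-1 : ℂ) ^ I.card • (evenProd I * (xiStarProd M * xiProd N)) := by
    rw [xiProd_mul_xiStarProd, smul_mul_assoc, mul_smul_comm, ← mul_assoc,
      ← (evenProd_commute I (xiStarProd M)).eq, mul_assoc]
  have h2 (k : ℕ) : ((((descPochhammer ℝ k).eval s / (k.factorial : ℝ) * r ^ (s - k) : ℝ) : ℂ) •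
      (-∑ j : Fin q, xi j * xiBar j) ^ k : Grassmann q) =
      (((descPochhammer ℝ k).eval s * r ^ (s - k) : ℝ) : ℂ) •
        ∑ A ∈ (Finset.univ : Finset (Fin q)).powersetCard k, evenProd A := by
    rw [neg_sum_pow, smul_smul]
    congr 1
    have : (k.factorial : ℂ) ≠ 0 := by exact_mod_cast k.factorial_ne_zero
    push_cast
    field_simp
  simp only [superPow, h2, h1, Finset.sum_mul, map_sum, smul_mul_assoc, mul_smul_comm, map_smul,
    ← mul_assoc (evenProd _) (evenProd _), smul_eq_mul, berezin_monomial]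
  by_cases hc : M = N ∧ Disjoint I M
  · rw [if_pos hc]
    have hcard : ((I ∪ M)ᶜ).card ∈ Finset.range (q + 1) := by
      rw [Finset.mem_range, Nat.lt_succ_iff]
      exact (Finset.card_le_univ _).trans (by simp)
    rw [Finset.sum_eq_single_of_mem _ hcard]
    · rw [Finset.sum_eq_single_of_mem (I ∪ M)ᶜ (by simp), if_pos ⟨hc.1, hc.2, rfl⟩, mul_one]
      · intro A _ hA
        rw [if_neg fun h => hA h.2.2]
    · intro k _ hk
      rw [Finset.sum_eq_zero, mul_zero]
      intro A hA
      rw [if_neg]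
      rintro ⟨_, _, rfl⟩
      exact hk (Finset.mem_powersetCard.1 hA).2.symm
  · rw [if_neg hc]
    rw [Finset.sum_eq_zero, mul_zero]
    intro k _
    rw [Finset.sum_eq_zero, mul_zero]
    intro A _
    rw [if_neg fun h => hc ⟨h.1, h.2.1⟩]

lemma xiProd_empty : xiProd (∅ : Finset (Fin q)) = 1 := by simp [xiProd]

lemma xiStarProd_empty : xiStarProd (∅ : Finset (Fin q)) = 1 := by simp [xiStarProd]

lemma val_ofCoeff (ψ : Finset (Fin q) → siegel n → ℂ) (z : siegel n) :
    (SuperFun.ofCoeff ψ).val z = ∑ N, ψ N z • xiProd N := by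
  refine Finset.sum_congr rfl fun N _ => ?_
  rw [Finset.sum_eq_single ∅]
  · simp [SuperFun.ofCoeff, xiStarProd_empty]
  · intro J _ hJ
    simp [SuperFun.ofCoeff, hJ]
  · simp

lemma val_adj_ofCoeff (φ : Finset (Fin q) → siegel n → ℂ) (z : siegel n) :
    (SuperFun.ofCoeff φ).adj.val z = ∑ M, conj (φ M z) • xiStarProd M := by
  rw [SuperFun.val, Finset.sum_eq_single ∅]
  · simp [SuperFun.adj, SuperFun.ofCoeff, xiProd_empty]
  · intro J _ hJ
    simp [SuperFun.adj, SuperFun.ofCoeff, hJ]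
  · simp

lemma val_of_diagonal {F : SuperFun n q} {z : siegel n} (hF : ∀ I J, I ≠ J → F I J z = 0) :
    F.val z = ∑ I, F I I z • (xiProd I * xiStarProd I) := by
  refine Finset.sum_congr rfl fun I _ => ?_
  rw [Finset.sum_eq_single I]
  · intro J _ hJ
    rw [hF I J hJ.symm, zero_smul]
  · simp

/-- The surviving binomial term lowers the exponent `ν + q - p - 1` by `q - |I| - |M|`. This is why
component `M` carries the weight of `ν + |M|`, with an extra factor `ρ^{|I|}`. -/
lemma pairing_mul {ν : ℝ} (hν : (n : ℝ) + 1 < ν) (φ ψ : Finset (Fin q) → siegel n → ℂ)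
    {F : SuperFun n q} {z : siegel n} (hF : ∀ I J, I ≠ J → F I J z = 0) :
    pairing ν φ (fun z => F.val z * (SuperFun.ofCoeff ψ).val z) z =
      ∑ M, ∑ I with Disjoint I M, (-1 : ℂ) ^ I.card * F I I z * (conj (φ M z) * ψ M z) *
        ((Real.Gamma (ν + q - (n + 1)) / Real.Gamma (ν + M.card + I.card - (n + 1)) *
          height z.1 ^ (ν + M.card + I.card - (n + 1) - 1) : ℝ) : ℂ) := by
  rw [pairing, val_ofCoeff, val_adj_ofCoeff, val_of_diagonal hF, mul_assoc]
  simp only [Finset.sum_mul, Finset.mul_sum, smul_mul_assoc, mul_smul_comm, map_sum, map_smul,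
    smul_eq_mul, berezin_superPow_mul]
  refine Finset.sum_congr rfl fun M _ => ?_
  rw [Finset.sum_filter]
  refine Finset.sum_congr rfl fun I _ => ?_
  rw [Finset.sum_eq_single M]
  · by_cases hd : Disjoint I M
    · have hc : (((I ∪ M)ᶜ).card : ℝ) = q - I.card - M.card := by
        have h1 := Finset.card_compl_add_card (I ∪ M)
        rw [Finset.card_union_of_disjoint hd, Fintype.card_fin] at h1
        have h2 : (((I ∪ M)ᶜ).card : ℝ) + (I.card + M.card) = q := by exact_mod_cast h1
        linarith
      have hpos : 0 < ν + q - (n + 1) - 1 + 1 - ((I ∪ M)ᶜ).card := by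
        rw [hc]
        have := I.card.cast_nonneg (α := ℝ)
        have := M.card.cast_nonneg (α := ℝ)
        linarith
      rw [if_pos ⟨rfl, hd⟩, if_pos hd, descPochhammer_eval_eq_Gamma _ hpos, hc]
      have e1 : ν + q - ((n : ℝ) + 1) - 1 + 1 = ν + q - (n + 1) := by ring
      have e2 : ν + q - ((n : ℝ) + 1) - (q - I.card - M.card) =
          ν + M.card + I.card - (n + 1) := by ring
      have e3 : ν + q - ((n : ℝ) + 1) - 1 - (q - I.card - M.card) =
          ν + M.card + I.card - (n + 1) - 1 := by ring
      rw [e1, e2, e3]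
      ring
    · rw [if_neg fun h => hd h.2, if_neg hd]
      ring
  · intro N _ hN
    rw [if_neg fun h => hN h.1]
    ring
  · simp

end Pairing

/-! ### Invariant super functions. -/

section Claims
variable {n q : ℕ}

lemma nilAct_zero (z : siegel n) : nilAct 0 0 z = z := by
  apply Subtype.ext
  simp [nilAct]

/-- For an index `j` in exactly one of `I`, `J`, the torus element with `-1` in place `j` changes
the sign of the coefficient. -/
lemma IsNilpotent.eq_zero {F : SuperFun n q} (hF : IsNilpotent F) {I J : Finset (Fin q)}
    (h : I ≠ J) (z : siegel n) : F I J z = 0 := by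
  obtain ⟨j, hj⟩ : ∃ j, ¬(j ∈ I ↔ j ∈ J) := by
    by_contra hc
    push Not at hc
    exact h (Finset.ext hc)
  have h1 := hF 0 0 (Function.update 1 j (-1)) I J z
  rw [nilAct_zero] at h1
  have e (A : Finset (Fin q)) : ∏ i ∈ A, ((Function.update (1 : Fin q → Circle) j (-1) i : Circle) : ℂ) =
      if j ∈ A then -1 else 1 := by
    rw [← Finset.prod_ite_eq' A j (fun _ => (-1 : ℂ))]
    refine Finset.prod_congr rfl fun i _ => ?_
    by_cases hi : i = j
    · subst hi; simp
    · simp [hi]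
  rw [← map_prod, e, e] at h1
  by_cases hI : j ∈ I <;> by_cases hJ : j ∈ J <;> simp [hI, hJ] at h1 hj
  · linear_combination (-1 / 2 : ℂ) * h1
  · linear_combination (-1 / 2 : ℂ) * h1

lemma profile_eq {F : SuperFun n q} (I : Finset (Fin q)) {y : HSp n} (hy : 0 < y.2) :
    profile F I y.1 y.2 = F I I (spt y 0) := by
  rw [profile, dif_pos hy]
  congr 1
  apply Subtype.ext
  rw [coe_spt hy]
  refine Prod.ext ?_ ?_
  · simp [tubeMap, cpt, par]
  · simp only [tubeMap, cpt, par]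
    have : ∑ k, ((((0 : HSp n).1 k : ℝ) : ℂ) + Complex.I * (y.1 k : ℂ)) ^ 2 =
        -∑ k, (y.1 k : ℂ) ^ 2 := by
      rw [← Finset.sum_neg_distrib]
      refine Finset.sum_congr rfl fun k _ => ?_
      simp [mul_pow]
    rw [this]
    push_cast
    simp
    ring

/-- In tube coordinates the group acts by real translations, hence transitively on each horizontal
slice; an invariant coefficient is determined by its value at `x = 0`. -/
lemma exists_nilAct (y x : HSp n) (hy : 0 < y.2) : ∃ b h, nilAct b h (spt y 0) = spt y x := by
  refine ⟨x.1, x.2, ?_⟩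
  apply Subtype.ext
  simp only [nilAct, coe_spt hy]
  refine Prod.ext ?_ ?_
  · ext k
    simp [tubeMap, cpt, par]
    ring
  · simp only [tubeMap, cpt, par]
    have e : ∀ k, ((x.1 k : ℂ) + Complex.I * (y.1 k : ℂ)) ^ 2 =
        (((0 : HSp n).1 k : ℝ) + Complex.I * (y.1 k : ℂ)) ^ 2 + (x.1 k : ℂ) ^ 2 +
          2 * ((((0 : HSp n).1 k : ℝ) + Complex.I * (y.1 k : ℂ)) * (x.1 k : ℂ)) := by
      intro k
      simp only [Prod.fst_zero, Pi.zero_apply, Complex.ofReal_zero]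
      ring
    simp only [e, Finset.sum_add_distrib, ← Finset.mul_sum]
    simp only [Prod.snd_zero, Complex.ofReal_zero]
    ring

lemma IsNilpotent.eq_profile {F : SuperFun n q} (hF : IsNilpotent F) (I : Finset (Fin q))
    (z : siegel n) : F I I z = profile F I (yc z.1).1 (yc z.1).2 := by
  obtain ⟨x, hx⟩ := exists_spt_yc z
  have hy := yc_pos z
  obtain ⟨b, h, hb⟩ := exists_nilAct (yc z.1) x hy
  rw [profile_eq I hy]
  have h1 := hF b h 1 I I (spt (yc z.1) 0)
  rw [hb, ← hx] at h1
  simpa using h1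

end Claims
end SuperSiegel

end

noncomputable section
namespace SuperSiegel
open Filter Topology

/-! ### Decoupling into weighted Bergman spaces. -/

section Symbol
variable {n q : ℕ}

lemma integrable_wSiegel_iff (l : ℝ) (g : siegel n → ℂ) : Integrable g (wSiegel n l) ↔
    Integrable (fun z => ((height z.1 ^ (l - (n + 1) - 1) : ℝ) : ℂ) * g z) (siegelMeasure n) := by
  rw [wSiegel, integrable_withDensity_iff_integrable_smul' (measurable_wdens_siegel l)
    (.of_forall fun _ => ENNReal.ofReal_lt_top)]
  refine integrable_congr (.of_forall fun z => ?_)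
  have h : 0 < height z.1 := z.2
  simp only
  rw [ENNReal.toReal_ofReal (by positivity), Complex.real_smul]

lemma integral_wSiegel (l : ℝ) (g : siegel n → ℂ) : ∫ z, g z ∂(wSiegel n l) =
    ∫ z, ((height z.1 ^ (l - (n + 1) - 1) : ℝ) : ℂ) * g z ∂(siegelMeasure n) := by
  rw [wSiegel, integral_withDensity_eq_integral_toReal_smul (measurable_wdens_siegel l)
    (.of_forall fun _ => ENNReal.ofReal_lt_top)]
  refine integral_congr_ae (.of_forall fun z => ?_)
  have h : 0 < height z.1 := z.2
  simp only
  rw [ENNReal.toReal_ofReal (by positivity), Complex.real_smul]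

/-- The symbol by which the component `M` of a super function is multiplied. -/
def sym (ν : ℝ) (F : SuperFun n q) (M : Finset (Fin q)) (y : HSp n) : ℂ :=
  ∑ I with Disjoint I M, (-1 : ℂ) ^ I.card *
    ((Real.Gamma (ν + M.card - (n + 1)) / Real.Gamma (ν + M.card + I.card - (n + 1)) : ℝ) : ℂ) *
    profile F I y.1 y.2 * ((y.2 ^ I.card : ℝ) : ℂ)

/-- The integrand over the Siegel domain with components `g`. -/
def superDensity (ν : ℝ) (g : Finset (Fin q) → siegel n → ℂ) (z : siegel n) : ℂ :=
  ∑ M, ((Real.Gamma (ν + q - (n + 1)) / Real.Gamma (ν + M.card - (n + 1)) : ℝ) : ℂ) *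
    (((height z.1 ^ (ν + M.card - (n + 1) - 1) : ℝ) : ℂ) * g M z)

lemma lt_add_card {ν : ℝ} (hν : (n : ℝ) + 1 < ν) (m : ℕ) : (n : ℝ) + 1 < ν + m := by
  have := m.cast_nonneg (α := ℝ)
  linarith

/-- The odd variables never mix components: `F` acts on component `M` as a scalar symbol, the powers
`ρ^{|I|}` being absorbed into `sym`. -/
lemma pairing_mul_eq {ν : ℝ} (hν : (n : ℝ) + 1 < ν) (φ ψ : Finset (Fin q) → siegel n → ℂ)
    {F : SuperFun n q} (hF : IsNilpotent F) :
    pairing ν φ (fun z => F.val z * (SuperFun.ofCoeff ψ).val z) =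
      superDensity ν fun M z => conj (φ M z) * (sym ν F M (yc z.1) * ψ M z) := by
  ext z
  rw [pairing_mul hν φ ψ fun I J h => hF.eq_zero h z, superDensity]
  refine Finset.sum_congr rfl fun M _ => ?_
  rw [sym, Finset.sum_mul, Finset.mul_sum, Finset.mul_sum, Finset.mul_sum]
  refine Finset.sum_congr rfl fun I _ => ?_
  have hz : 0 < height z.1 := z.2
  have h1 : (Real.Gamma (ν + M.card - (n + 1)) : ℂ) ≠ 0 :=
    Complex.ofReal_ne_zero.2 (Real.Gamma_pos_of_pos (by linarith [lt_add_card hν M.card])).ne'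
  have h2 : height z.1 ^ (ν + M.card + I.card - (n + 1) - 1) =
      height z.1 ^ (ν + M.card - (n + 1) - 1) * height z.1 ^ I.card := by
    rw [← Real.rpow_natCast, ← Real.rpow_add hz]
    congr 1; ring
  have h3 : (yc z.1).2 = height z.1 := rfl
  rw [hF.eq_profile I z, h2, h3]
  push_cast
  field_simp

lemma pairing_ofCoeff_eq {ν : ℝ} (hν : (n : ℝ) + 1 < ν) (φ ψ : Finset (Fin q) → siegel n → ℂ) :
    pairing ν φ (SuperFun.ofCoeff ψ).val = superDensity ν fun M z => conj (φ M z) * ψ M z := by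
  -- The constant super function `1`, so that the formula for products applies.
  set F : SuperFun n q := fun I J _ => if I = ∅ ∧ J = ∅ then 1 else 0 with hF
  ext z
  have hF1 : F.val = fun _ => 1 := by
    ext z
    rw [SuperFun.val, Finset.sum_eq_single ∅, Finset.sum_eq_single ∅]
    · simp [hF, xiProd_empty, xiStarProd_empty]
    · intro J _ hJ; simp [hF, hJ]
    · simp
    · intro I _ hI; simp [hF, hI]
    · simp
  have h1 := pairing_mul hν φ ψ (F := F) (z := z) (fun I J h => by
    rw [hF]; exact if_neg fun h' => h (h'.1.trans h'.2.symm))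
  simp only [hF1, one_mul] at h1
  change pairing ν φ (fun z => (SuperFun.ofCoeff ψ).val z) z = _
  rw [h1, superDensity]
  refine Finset.sum_congr rfl fun M _ => ?_
  rw [Finset.sum_eq_single ∅]
  · simp [hF]; ring
  · intro I _ hI; simp [hF, hI]
  · simp

lemma integrable_superDensity (ν : ℝ) {g : Finset (Fin q) → siegel n → ℂ}
    (hg : ∀ M, Integrable (g M) (wSiegel n (ν + (M.card : ℝ)))) :
    Integrable (superDensity ν g) (siegelMeasure n) :=
  integrable_finsetSum _ fun M _ => ((integrable_wSiegel_iff _ _).1 (hg M)).const_mul _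

lemma integral_superDensity {ν : ℝ} (hν : (n : ℝ) + 1 < ν) {g : Finset (Fin q) → siegel n → ℂ}
    (hg : ∀ M, Integrable (g M) (wSiegel n (ν + (M.card : ℝ)))) :
    ((Real.Gamma ν / (4 * Real.pi ^ (n + 1) * Real.Gamma (ν + q - (n + 1))) : ℝ) : ℂ) *
      ∫ z, superDensity ν g z ∂(siegelMeasure n) =
    ∑ M, ((Real.Gamma ν / Real.Gamma (ν + (M.card : ℝ)) : ℝ) : ℂ) *
      (((bergmanConst n (ν + (M.card : ℝ)) / 4 : ℝ) : ℂ) *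
        ∫ z, g M z ∂(wSiegel n (ν + (M.card : ℝ)))) := by
  simp only [superDensity]
  rw [integral_finsetSum _ fun M _ => ((integrable_wSiegel_iff _ _).1 (hg M)).const_mul _,
    Finset.mul_sum]
  refine Finset.sum_congr rfl fun M _ => ?_
  rw [integral_const_mul, integral_wSiegel, ← mul_assoc, ← mul_assoc, ← Complex.ofReal_mul,
    ← Complex.ofReal_mul]
  congr 2
  have h1 : Real.Gamma (ν + M.card) ≠ 0 :=
    (Real.Gamma_pos_of_pos (by linarith [lt_add_card hν M.card, n.cast_nonneg (α := ℝ)])).ne'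
  have h2 : Real.Gamma (ν + M.card - (n + 1)) ≠ 0 :=
    (Real.Gamma_pos_of_pos (by linarith [lt_add_card hν M.card])).ne'
  have h3 : Real.Gamma (ν + q - (n + 1)) ≠ 0 :=
    (Real.Gamma_pos_of_pos (by linarith [lt_add_card hν q])).ne'
  have := Real.pi_ne_zero
  rw [bergmanConst]
  field_simp

/-- Membership in the Toeplitz graph only provides integrability of the sum over all components;
test functions with one component separate them. -/
lemma integrable_of_superDensity_single {ν : ℝ} (hν : (n : ℝ) + 1 < ν) (M : Finset (Fin q))
    {g : Finset (Fin q) → siegel n → ℂ} (h0 : ∀ N, N ≠ M → g N = 0)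
    (h : Integrable (superDensity ν g) (siegelMeasure n)) :
    Integrable (g M) (wSiegel n (ν + (M.card : ℝ))) := by
  rw [integrable_wSiegel_iff]
  have h2 : (Real.Gamma (ν + M.card - (n + 1)) : ℂ) ≠ 0 :=
    Complex.ofReal_ne_zero.2 (Real.Gamma_pos_of_pos (by linarith [lt_add_card hν M.card])).ne'
  have h3 : (Real.Gamma (ν + q - (n + 1)) : ℂ) ≠ 0 :=
    Complex.ofReal_ne_zero.2 (Real.Gamma_pos_of_pos (by linarith [lt_add_card hν q])).ne'
  refine (h.const_mul ((Real.Gamma (ν + M.card - (n + 1)) / Real.Gamma (ν + q - (n + 1)) : ℝ) : ℂ)).congr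
    (.of_forall fun z => ?_)
  simp only [superDensity]
  rw [Finset.sum_eq_single M]
  · push_cast
    field_simp
  · intro N _ hN; simp [h0 N hN]
  · simp

lemma integrable_conj_mul_self {α : Type*} [MeasurableSpace α] {μ : Measure α} {f g : α → ℂ}
    (hf : MemLp f 2 μ) (hg : MemLp g 2 μ) : Integrable (fun z => conj (f z) * g z) μ :=
  (hf.star.integrable_mul hg)

/-- On the diagonal the density is a sum of nonnegative terms, so its integrability is that of each
term: no cancellation between components can occur. -/
lemma mem_bergman_iff {ν : ℝ} (hν : (n : ℝ) + 1 < ν) (ψ : Finset (Fin q) → siegel n → ℂ) :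
    ψ ∈ bergman n q ν ↔
      ∀ M, IsHolomorphic (ψ M) ∧ MemLp (ψ M) 2 (wSiegel n (ν + (M.card : ℝ))) := by
  rw [bergman, Set.mem_ofPred_eq, pairing_ofCoeff_eq hν]
  constructor
  · rintro ⟨h1, h2⟩ M
    refine ⟨h1 M, (memLp_two_iff_integrable_sq_norm (h1 M).continuous.aestronglyMeasurable).2 ?_⟩
    have h3 : Integrable (fun z => ((‖ψ M z‖ ^ 2 : ℝ) : ℂ)) (wSiegel n (ν + (M.card : ℝ))) := by
      rw [integrable_wSiegel_iff]
      have hG (N : Finset (Fin q)) : 0 < Real.Gamma (ν + N.card - (n + 1)) :=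
        Real.Gamma_pos_of_pos (by linarith [lt_add_card hν N.card])
      have hGq : 0 < Real.Gamma (ν + q - (n + 1)) :=
        Real.Gamma_pos_of_pos (by linarith [lt_add_card hν q])
      set c := Real.Gamma (ν + M.card - (n + 1)) / Real.Gamma (ν + q - (n + 1)) with hc
      have hc0 : 0 < c := div_pos (hG M) hGq
      have hcont : Continuous fun z : siegel n => height z.1 :=
        continuous_height.comp continuous_subtype_val
      refine (h2.norm.const_mul c).mono' ?_ (.of_forall fun z => ?_)
      · have h4 : Measurable fun z : siegel n => ‖ψ M z‖ := (h1 M).continuous.norm.measurable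
        have h5 := hcont.measurable
        exact Measurable.aestronglyMeasurable (by fun_prop)
      have hz : 0 < height z.1 := z.2
      set w : Finset (Fin q) → ℝ := fun N => Real.Gamma (ν + q - (n + 1)) /
        Real.Gamma (ν + N.card - (n + 1)) * (height z.1 ^ (ν + N.card - (n + 1) - 1) * ‖ψ N z‖ ^ 2)
        with hw
      have hw0 (N : Finset (Fin q)) : 0 ≤ w N := by
        have := hG N
        positivity
      have h6 : superDensity ν (fun M z => conj (ψ M z) * ψ M z) z = ((∑ N, w N : ℝ) : ℂ) := by
        rw [superDensity]
        push_cast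
        refine Finset.sum_congr rfl fun N _ => ?_
        rw [mul_comm (conj _), Complex.mul_conj, Complex.normSq_eq_norm_sq]
        simp only [hw]
        push_cast
        ring
      rw [h6, Complex.norm_real, Real.norm_of_nonneg (Finset.sum_nonneg fun N _ => hw0 N),
        ← Complex.ofReal_mul, Complex.norm_real, Real.norm_of_nonneg (by positivity)]
      calc height z.1 ^ (ν + M.card - (n + 1) - 1) * ‖ψ M z‖ ^ 2 = c * w M := by
            have := (hG M).ne'
            rw [hc, hw]
            field_simp
        _ ≤ _ := mul_le_mul_of_nonneg_left
            (Finset.single_le_sum (fun N _ => hw0 N) (Finset.mem_univ M)) hc0.le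
    simpa using h3.norm
  · intro h
    exact ⟨fun M => (h M).1, integrable_superDensity ν fun M =>
      integrable_conj_mul_self (h M).2 (h M).2⟩

lemma form_ofCoeff {ν : ℝ} (hν : (n : ℝ) + 1 < ν) {φ ψ : Finset (Fin q) → siegel n → ℂ}
    (hφ : φ ∈ bergman n q ν) (hψ : ψ ∈ bergman n q ν) :
    form ν φ (SuperFun.ofCoeff ψ).val =
    ∑ M, ((Real.Gamma ν / Real.Gamma (ν + (M.card : ℝ)) : ℝ) : ℂ) *
      (((bergmanConst n (ν + (M.card : ℝ)) / 4 : ℝ) : ℂ) *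
        ∫ z, conj (φ M z) * ψ M z ∂(wSiegel n (ν + (M.card : ℝ)))) := by
  rw [form, pairing_ofCoeff_eq hν]
  exact integral_superDensity hν fun M => integrable_conj_mul_self
    ((mem_bergman_iff hν φ).1 hφ M).2 ((mem_bergman_iff hν ψ).1 hψ M).2

lemma form_mul {ν : ℝ} (hν : (n : ℝ) + 1 < ν) {φ ψ : Finset (Fin q) → siegel n → ℂ}
    {F : SuperFun n q} (hF : IsNilpotent F)
    (h : ∀ M, Integrable (fun z => conj (φ M z) * (sym ν F M (yc z.1) * ψ M z))
      (wSiegel n (ν + (M.card : ℝ)))) :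
    form ν φ (fun z => F.val z * (SuperFun.ofCoeff ψ).val z) =
    ∑ M, ((Real.Gamma ν / Real.Gamma (ν + (M.card : ℝ)) : ℝ) : ℂ) *
      (((bergmanConst n (ν + (M.card : ℝ)) / 4 : ℝ) : ℂ) *
        ∫ z, conj (φ M z) * (sym ν F M (yc z.1) * ψ M z) ∂(wSiegel n (ν + (M.card : ℝ)))) := by
  rw [form, pairing_mul_eq hν _ _ hF]
  exact integral_superDensity hν h

end Symbol
end SuperSiegel

end

noncomputable section
namespace SuperSiegel
open Filter Topology

/-! ### Growth of the symbol, and the multiplier as its average. -/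

section SymbolBounds
variable {n q : ℕ}

lemma measurable_profile {F : SuperFun n q} (hFm : ∀ I J, Measurable (F I J))
    (I : Finset (Fin q)) : Measurable fun y : HSp n => profile F I y.1 y.2 := by
  have h : (fun y : HSp n => profile F I y.1 y.2) =
      {y : HSp n | 0 < y.2}.indicator fun y => F I I (spt y 0) := by
    ext y
    by_cases hy : 0 < y.2
    · rw [Set.indicator_of_mem (by exact hy), profile_eq I hy]
    · rw [Set.indicator_of_notMem (by exact hy), profile, dif_neg hy]
  rw [h]
  exact ((hFm I I).comp (measurable_spt.comp (measurable_id.prodMk measurable_const))).indicator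
    measurableSet_pos

lemma measurable_sym (ν : ℝ) {F : SuperFun n q} (hFm : ∀ I J, Measurable (F I J))
    (M : Finset (Fin q)) : Measurable (sym ν F M) := by
  unfold sym
  refine Finset.measurable_fun_sum _ fun I _ => ?_
  have := measurable_profile hFm I
  fun_prop

lemma norm_sym_le (ν : ℝ) (F : SuperFun n q) (M : Finset (Fin q)) {b : HSp n → ℝ}
    {C : Finset (Fin q) → ℝ} {y : HSp n} (hy : 0 < y.2)
    (hC : ∀ I, ‖profile F I y.1 y.2‖ * y.2 ^ I.card ≤ C I * b y) :
    ‖sym ν F M y‖ ≤ (∑ I with Disjoint I M,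
      |Real.Gamma (ν + M.card - (n + 1)) / Real.Gamma (ν + M.card + I.card - (n + 1))| * C I) * b y := by
  rw [Finset.sum_mul]
  refine (norm_sum_le _ _).trans (Finset.sum_le_sum fun I _ => ?_)
  rw [norm_mul, norm_mul, norm_mul, norm_pow, norm_neg, norm_one, one_pow, one_mul,
    Complex.norm_real, Complex.norm_real, Real.norm_eq_abs, Real.norm_of_nonneg (by positivity),
    mul_assoc, mul_assoc]
  exact mul_le_mul_of_nonneg_left (hC I) (abs_nonneg _)

/-- Bounded coefficients do not give a bounded symbol: the factors `ρ^{|I|}`, with `|I| ≤ q`, leave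
polynomial growth. -/
lemma exists_norm_sym_le (ν : ℝ) {F : SuperFun n q} (hFb : ∀ I J, ∃ C : ℝ, ∀ z, ‖F I J z‖ ≤ C)
    (M : Finset (Fin q)) : ∃ C : ℝ, ∀ y : HSp n, 0 < y.2 → ‖sym ν F M y‖ ≤ C * (1 + y.2 ^ q) := by
  choose C hC using hFb
  refine ⟨_, fun y hy => norm_sym_le ν F M (b := fun y => 1 + y.2 ^ q) (C := fun I => C I I) hy
    fun I => ?_⟩
  rw [profile_eq I hy]
  have h1 := hC I I (spt y 0)
  have h2 : y.2 ^ I.card ≤ 1 + y.2 ^ q := by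
    rcases le_total y.2 1 with h | h
    · have := pow_le_one₀ hy.le h (n := I.card)
      have : 0 ≤ y.2 ^ q := by positivity
      linarith
    · have := pow_le_pow_right₀ h ((Finset.card_le_univ I).trans (by simp) : I.card ≤ q)
      linarith
  exact mul_le_mul h1 h2 (by positivity) ((norm_nonneg _).trans h1)

lemma exists_norm_sym_le_of_bounded (ν : ℝ) {F : SuperFun n q}
    (hFb : ∀ I, ∃ C : ℝ, ∀ z : siegel n, height z.1 ^ I.card * ‖F I I z‖ ≤ C)
    (M : Finset (Fin q)) : ∃ C : ℝ, ∀ y : HSp n, 0 < y.2 → ‖sym ν F M y‖ ≤ C := by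
  choose C hC using hFb
  refine ⟨_, fun y hy => (norm_sym_le ν F M (b := fun _ => 1) (C := C) hy fun I => ?_).trans
    (mul_one _).le⟩
  have h1 := hC I (spt y 0)
  rw [height_spt hy] at h1
  rw [profile_eq I hy, mul_one, mul_comm]
  exact h1

lemma symbolL2_of_le {l : ℝ} {a f : HSp n → ℂ} {D : HSp n → ENNReal} {c : ENNReal} (hc : c ≠ ⊤)
    (hf : MemLp f 2 (halfMeasure n))
    (hD : ∀ t : HSp n, 0 < t.2 →
      ∫⁻ y, ‖a y‖ₑ ^ 2 * ENNReal.ofReal (kk l y t) ∂(wHalf n l) ≤ D t)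
    (hfD : ∀ t : HSp n, 0 < t.2 → f t ≠ 0 → D t ≤ c) : SymbolL2 l a f := by
  have h := ENNReal.mul_lt_top (lintegral_enorm_sq_lt_top hf) hc.lt_top
  rw [← lintegral_mul_const' _ _ hc] at h
  refine lt_of_le_of_lt (lintegral_mono_ae ?_) h
  filter_upwards [ae_half] with t ht
  by_cases h0 : f t = 0
  · simp [h0]
  · gcongr
    exact (hD t ht).trans (hfD t ht h0)

/-- The growth bound reduces the integral to the moments of order `0` and `2m` of the kernel. -/
lemma lintegral_sq_mul_kk_le {l C : ℝ} (hl : (n : ℝ) + 1 < l) {a : HSp n → ℂ} (m : ℕ)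
    (ha : ∀ y : HSp n, 0 < y.2 → ‖a y‖ ≤ C * (1 + y.2 ^ m)) {t : HSp n} (ht : 0 < t.2) :
    ∫⁻ y, ‖a y‖ₑ ^ 2 * ENNReal.ofReal (kk l y t) ∂(wHalf n l) ≤
      ENNReal.ofReal (2 * C ^ 2) * (ENNReal.ofReal (4 / bergmanConst n l) + ENNReal.ofReal
        (4 / cc n l * Real.Gamma (l - (n + 1) + (2 * m : ℕ)) * (2 * t.2) ^ (-((2 * m : ℕ) : ℝ)))) := by
  have hkm : Measurable fun y : HSp n => ENNReal.ofReal (kk l y t) :=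
    ((measurable_kk l).comp (measurable_id.prodMk measurable_const)).ennreal_ofReal
  rw [← lintegral_kk_wHalf hl ht, ← lintegral_pow_mul_kk_wHalf hl (Nat.cast_nonneg _) ht,
    ← lintegral_add_left hkm, ← lintegral_const_mul' _ _ ENNReal.ofReal_ne_top]
  refine lintegral_mono_ae ?_
  filter_upwards [ae_wHalf l] with y hy
  have h1 : ‖a y‖ ^ 2 ≤ 2 * C ^ 2 * (1 + y.2 ^ (2 * m)) := by
    have h2 := pow_le_pow_left₀ (norm_nonneg _) (ha y hy) 2
    have h3 : (1 + y.2 ^ m) ^ 2 ≤ 2 * (1 + y.2 ^ (2 * m)) := by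
      rw [mul_comm 2 m, pow_mul]
      nlinarith [sq_nonneg (1 - y.2 ^ m)]
    nlinarith [sq_nonneg C]
  have h4 : ‖a y‖ₑ ^ 2 ≤ ENNReal.ofReal (2 * C ^ 2) * (1 + ENNReal.ofReal (y.2 ^ ((2 * m : ℕ) : ℝ))) := by
    rw [← ofReal_norm, ← ENNReal.ofReal_pow (norm_nonneg _), ← ENNReal.ofReal_one,
      ← ENNReal.ofReal_add zero_le_one (by positivity), ← ENNReal.ofReal_mul (by positivity),
      Real.rpow_natCast]
    exact ENNReal.ofReal_le_ofReal h1
  calc _ ≤ ENNReal.ofReal (2 * C ^ 2) * (1 + ENNReal.ofReal (y.2 ^ ((2 * m : ℕ) : ℝ))) *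
        ENNReal.ofReal (kk l y t) := by gcongr
    _ = _ := by ring

/-- Symbols of polynomial growth act on functions supported away from `ξ = 0`. -/
lemma symbolL2_indicator {l C δ : ℝ} (hl : (n : ℝ) + 1 < l) (hδ : 0 < δ) {a f : HSp n → ℂ} (m : ℕ)
    (ha : ∀ y : HSp n, 0 < y.2 → ‖a y‖ ≤ C * (1 + y.2 ^ m)) (hf : MemLp f 2 (halfMeasure n))
    (hfδ : ∀ t, f t ≠ 0 → δ < t.2) : SymbolL2 l a f := by
  refine symbolL2_of_le (c := ENNReal.ofReal (2 * C ^ 2) * (ENNReal.ofReal (4 / bergmanConst n l) +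
    ENNReal.ofReal (4 / cc n l * Real.Gamma (l - (n + 1) + (2 * m : ℕ)) *
      (2 * δ) ^ (-((2 * m : ℕ) : ℝ))))) ?_ hf
    (fun t ht => lintegral_sq_mul_kk_le hl m ha ht) fun t ht h0 => ?_
  · exact ENNReal.mul_ne_top ENNReal.ofReal_ne_top (by simp)
  · have hcc := cc_pos hl
    have hG : 0 < Real.Gamma (l - (n + 1) + (2 * m : ℕ)) :=
      Real.Gamma_pos_of_pos (by have := (2 * m).cast_nonneg (α := ℝ); linarith)
    gcongr ENNReal.ofReal (2 * C ^ 2) * (_ + ENNReal.ofReal (_ * ?_))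
    exact Real.rpow_le_rpow_of_nonpos (by positivity) (by linarith [hfδ t h0]) (by simp)

lemma symbolL2_of_bounded {l C : ℝ} (hl : (n : ℝ) + 1 < l) {a f : HSp n → ℂ}
    (ha : ∀ y : HSp n, 0 < y.2 → ‖a y‖ ≤ C) (hf : MemLp f 2 (halfMeasure n)) : SymbolL2 l a f := by
  refine symbolL2_of_le (c := ENNReal.ofReal (2 * C ^ 2) * (ENNReal.ofReal (4 / bergmanConst n l) +
    ENNReal.ofReal (4 / cc n l * Real.Gamma (l - (n + 1)))))
    (ENNReal.mul_ne_top ENNReal.ofReal_ne_top (by simp)) hf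
    (fun t ht => lintegral_sq_mul_kk_le (C := C) hl 0 (fun y hy => (ha y hy).trans ?_) ht)
    (fun t ht _ => le_of_eq (by simp))
  have : 0 ≤ C := (norm_nonneg _).trans (ha y hy)
  simp only [pow_zero]
  linarith

lemma integral_half_affine {c : ℝ} (hc : 0 < c) (u : Fin n → ℝ) {H : HSp n → ℂ}
    (hH : Measurable H) : ∫ t, H t ∂(halfMeasure n) =
      ((c ^ n : ℝ) : ℂ) * ∫ y, H (u + c • y.1, y.2) ∂(halfMeasure n) := by
  have hm : Measurable fun y : Fin n → ℝ => u + c • y := by fun_prop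
  have hmap : Measure.map (fun y : Fin n → ℝ => u + c • y) volume =
      ENNReal.ofReal ((c ^ n)⁻¹) • (volume : Measure (Fin n → ℝ)) := by
    have h1 : (fun y : Fin n → ℝ => u + c • y) = (u + ·) ∘ (c • ·) := rfl
    rw [h1, ← Measure.map_map (by fun_prop) (by fun_prop), Measure.map_addHaar_smul _ hc.ne',
      Measure.map_smul, map_add_left_eq_self]
    congr 2
    rw [abs_of_pos (by positivity)]
    simp
  have hmap2 : Measure.map (fun y : HSp n => (u + c • y.1, y.2)) (halfMeasure n) =
      ENNReal.ofReal ((c ^ n)⁻¹) • halfMeasure n := by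
    rw [halfMeasure_eq_prod, ← Measure.prod_smul_left, ← hmap]
    exact (Measure.map_prod_map _ _ hm measurable_id).symm.trans (by rw [Measure.map_id])
  have h2 : ∫ t, H t ∂(ENNReal.ofReal ((c ^ n)⁻¹) • halfMeasure n) =
      ∫ y, H (u + c • y.1, y.2) ∂(halfMeasure n) := by
    rw [← hmap2, integral_map (by fun_prop) hH.aestronglyMeasurable]
  rw [← h2, integral_smul_measure, ENNReal.toReal_ofReal (by positivity), Complex.real_smul,
    ← mul_assoc, ← Complex.ofReal_mul, mul_inv_cancel₀ (by positivity), Complex.ofReal_one, one_mul]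

lemma integral_wHalf (l : ℝ) (g : HSp n → ℂ) : ∫ y, g y ∂(wHalf n l) =
    ∫ y, ((y.2 ^ (l - (n + 1) - 1) : ℝ) : ℂ) * g y ∂(halfMeasure n) := by
  rw [wHalf, integral_withDensity_eq_integral_toReal_smul (measurable_wdens l)
    (.of_forall fun _ => ENNReal.ofReal_lt_top)]
  refine integral_congr_ae ?_
  filter_upwards [ae_half] with y hy
  rw [ENNReal.toReal_ofReal (by positivity), Complex.real_smul]

lemma integrable_pow_mul_kk {l : ℝ} (hl : (n : ℝ) + 1 < l) (m : ℕ) {t : HSp n} (ht : 0 < t.2) :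
    Integrable (fun y => y.2 ^ m * kk l y t) (wHalf n l) := by
  have hkm : Measurable fun y : HSp n => kk l y t :=
    (measurable_kk l).comp (measurable_id.prodMk measurable_const)
  refine ⟨Measurable.aestronglyMeasurable (by fun_prop), ?_⟩
  rw [hasFiniteIntegral_iff_ofReal]
  · have h := lintegral_pow_mul_kk_wHalf hl (m := (m : ℝ)) (Nat.cast_nonneg _) ht
    refine lt_of_le_of_lt (lintegral_mono_ae ?_) (h.trans_lt ENNReal.ofReal_lt_top)
    filter_upwards [ae_wHalf l] with y hy
    rw [ENNReal.ofReal_mul (by positivity), Real.rpow_natCast]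
  · filter_upwards [ae_wHalf l] with y hy
    exact mul_nonneg (by positivity) (kk_nonneg _ _ _)

/-- The multiplier as an average of the symbol. -/
lemma gammaNil_eq {ν : ℝ} (hν : (n : ℝ) + 1 < ν) {F : SuperFun n q}
    (hFm : ∀ I J, Measurable (F I J)) (hFb : ∀ I J, ∃ C : ℝ, ∀ z, ‖F I J z‖ ≤ C)
    (M : Finset (Fin q)) {t : HSp n} (ht : 0 < t.2) :
    gammaNil ν F t.1 t.2 M = ((bergmanConst n (ν + (M.card : ℝ)) / 4 : ℝ) : ℂ) *
      ∫ y, sym ν F M y * (kk (ν + (M.card : ℝ)) y t : ℂ) ∂(wHalf n (ν + (M.card : ℝ))) := by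
  set l := ν + (M.card : ℝ) with hldef
  have hl : (n : ℝ) + 1 < l := lt_add_card hν M.card
  have hint (I : Finset (Fin q)) : Integrable (fun y : HSp n => profile F I y.1 y.2 *
      ((y.2 ^ I.card * kk l y t : ℝ) : ℂ)) (wHalf n l) := by
    obtain ⟨C, hC⟩ := hFb I I
    refine (integrable_pow_mul_kk hl I.card ht).ofReal.bdd_mul
      (measurable_profile hFm I).aestronglyMeasurable (c := C) ?_
    filter_upwards [ae_wHalf l] with y hy
    rw [profile_eq I hy]
    exact hC _
  have hsum : ∫ y, sym ν F M y * (kk l y t : ℂ) ∂(wHalf n l) =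
      ∑ I with Disjoint I M, (-1 : ℂ) ^ I.card *
        ((Real.Gamma (l - (n + 1)) / Real.Gamma (l + I.card - (n + 1)) : ℝ) : ℂ) *
        ∫ y, profile F I y.1 y.2 * ((y.2 ^ I.card * kk l y t : ℝ) : ℂ) ∂(wHalf n l) := by
    simp only [← integral_const_mul]
    rw [← integral_finsetSum _ fun I _ => (hint I).const_mul _]
    refine integral_congr_ae (.of_forall fun y => ?_)
    simp only [sym, Finset.sum_mul]
    refine Finset.sum_congr rfl fun I _ => ?_
    push_cast
    ring
  rw [hsum, gammaNil, Finset.mul_sum]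
  -- Sets `I` disjoint from `M` correspond to supersets `K = I ∪ M`, with `K \ M = I`.
  refine (Finset.sum_bij (fun I _ => I ∪ M) ?_ ?_ ?_ ?_).symm
  · intro I _; simp
  · intro I hI J hJ h
    have hI' : Disjoint I M := by simpa using hI
    have hJ' : Disjoint J M := by simpa using hJ
    rw [← Finset.union_sdiff_cancel_right hI', h, Finset.union_sdiff_cancel_right hJ']
  · intro K hK
    have hK' : M ⊆ K := by simpa using hK
    exact ⟨K \ M, by simpa using Finset.sdiff_disjoint, Finset.sdiff_union_of_subset hK'⟩
  · intro I hI
    have hI' : Disjoint I M := by simpa using hI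
    rw [Finset.union_sdiff_cancel_right hI', Finset.card_union_of_disjoint hI']
    have hs : 0 < Real.sqrt t.2 := Real.sqrt_pos.2 ht
    have hmeas : Measurable fun s : HSp n =>
        profile F I (fun k => 1 / (2 * Real.sqrt t.2) * (-t.1 k + s.1 k)) s.2 *
          ((Real.exp (-2 * t.2 * s.2 - ∑ k, s.1 k ^ 2) *
            s.2 ^ (ν + ((I.card + M.card : ℕ) : ℝ) - (n + 1) - 1) : ℝ) : ℂ) := by
      have h1 := (measurable_profile hFm I).comp (g := fun y : HSp n => profile F I y.1 y.2)
        (f := fun s : HSp n => (((fun k => 1 / (2 * Real.sqrt t.2) * (-t.1 k + s.1 k)), s.2) : HSp n))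
        (by fun_prop)
      have h2 : Measurable fun s : HSp n => ((Real.exp (-2 * t.2 * s.2 - ∑ k, s.1 k ^ 2) *
            s.2 ^ (ν + ((I.card + M.card : ℕ) : ℝ) - (n + 1) - 1) : ℝ) : ℂ) := by fun_prop
      exact h1.mul h2
    -- The substitution `v' = u' + 2√ξ y'` returns from the variables of the multiplier to those of
    -- the kernel.
    rw [integral_half_affine (c := 2 * Real.sqrt t.2) (by positivity) t.1 hmeas, integral_wHalf]
    have hG1 : Real.Gamma (l - (n + 1)) ≠ 0 := (Real.Gamma_pos_of_pos (by linarith)).ne'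
    have hb := (bergmanConst_pos hl).ne'
    have hcc := (cc_pos hl).ne'
    have hccb : cc n l = bergmanConst n l * Real.Gamma (l - (n + 1)) := rfl
    set κ : ℝ := (2 * Real.sqrt t.2) ^ n * (Real.pi ^ (-(n : ℝ) / 2) *
      (4 * (2 * t.2) ^ (l - (n + 1)) / cc n l)) with hκ
    have hcongr : ∫ y, ((y.2 ^ (l - (n + 1) - 1) : ℝ) : ℂ) *
          (profile F I y.1 y.2 * ((y.2 ^ I.card * kk l y t : ℝ) : ℂ)) ∂(halfMeasure n) =
        (κ : ℂ) * ∫ y : HSp n, profile F I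
          (fun k => 1 / (2 * Real.sqrt t.2) * (-t.1 k + (t.1 + (2 * Real.sqrt t.2) • y.1) k)) y.2 *
          ((Real.exp (-2 * t.2 * y.2 - ∑ k, (t.1 + (2 * Real.sqrt t.2) • y.1) k ^ 2) *
            y.2 ^ (ν + ((I.card + M.card : ℕ) : ℝ) - (n + 1) - 1) : ℝ) : ℂ) ∂(halfMeasure n) := by
      rw [← integral_const_mul]
      refine integral_congr_ae ?_
      filter_upwards [ae_half] with y hy
      have e1 : (fun k => 1 / (2 * Real.sqrt t.2) *
          (-t.1 k + (t.1 + (2 * Real.sqrt t.2) • y.1) k)) = y.1 := by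
        ext k
        simp only [Pi.add_apply, Pi.smul_apply, smul_eq_mul]
        field_simp
        ring
      have e2 : y.2 ^ (ν + ((I.card + M.card : ℕ) : ℝ) - (n + 1) - 1) =
          y.2 ^ (l - (n + 1) - 1) * y.2 ^ I.card := by
        rw [← Real.rpow_natCast, ← Real.rpow_add hy]
        congr 1
        push_cast
        ring
      have e3 : Real.exp (-2 * t.2 * y.2 - ∑ k, (t.1 + (2 * Real.sqrt t.2) • y.1) k ^ 2) =
          Real.exp (-(2 * t.2 * y.2)) *
            Real.exp (-∑ k, (t.1 k + 2 * Real.sqrt t.2 * y.1 k) ^ 2) := by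
        rw [← Real.exp_add]
        simp only [Pi.add_apply, Pi.smul_apply, smul_eq_mul]
        congr 1
        ring
      rw [e1, e2, e3, kk, bk_sq hl y ht, dens, hκ]
      push_cast
      ring
    rw [hcongr]
    have hπ : Real.pi ^ (-(n : ℝ) / 2) * Real.pi ^ ((n : ℝ) / 2) = 1 := pi_rpow_mul
    have hπ0 : Real.pi ^ ((n : ℝ) / 2) ≠ 0 := (Real.rpow_pos_of_pos Real.pi_pos _).ne'
    have e4 : ν + ((I.card + M.card : ℕ) : ℝ) - (n + 1) = l + I.card - (n + 1) := by
      push_cast; ring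
    have hconst : bergmanConst n l / 4 *
        (Real.Gamma (l - (n + 1)) / Real.Gamma (l + I.card - (n + 1)) * κ) =
        (2 * t.2) ^ (l - (n + 1)) / (Real.pi ^ ((n : ℝ) / 2) *
          Real.Gamma (ν + ((I.card + M.card : ℕ) : ℝ) - (n + 1))) * (2 * Real.sqrt t.2) ^ n := by
      have h3 : Real.pi ^ (-(n : ℝ) / 2) = (Real.pi ^ ((n : ℝ) / 2))⁻¹ :=
        eq_inv_of_mul_eq_one_left hπ
      rw [hκ, e4, h3, hccb]
      field_simp
    have hconst' := congrArg (fun r : ℝ => (r : ℂ)) hconst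
    simp only [Complex.ofReal_mul] at hconst'
    linear_combination (norm := skip) ((-1 : ℂ) ^ I.card * ∫ y : HSp n, profile F I
          (fun k => 1 / (2 * Real.sqrt t.2) * (-t.1 k + (t.1 + (2 * Real.sqrt t.2) • y.1) k)) y.2 *
          ((Real.exp (-2 * t.2 * y.2 - ∑ k, (t.1 + (2 * Real.sqrt t.2) • y.1) k ^ 2) *
            y.2 ^ (ν + ((I.card + M.card : ℕ) : ℝ) - (n + 1) - 1) : ℝ) : ℂ)
              ∂(halfMeasure n)) * hconst'
    ring

end SymbolBounds
end SuperSiegel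

end

noncomputable section
namespace SuperSiegel
open Filter Topology

/-! ### Unitarity of the super transform. -/

section Unitary
variable {n q : ℕ}

lemma superBargmannAdj_mem_bergman {ν : ℝ} (hν : (n : ℝ) + 1 < ν) (f : Target n q) :
    superBargmannAdj ν f ∈ bergman n q ν :=
  (mem_bergman_iff hν _).2 fun _ => ⟨isHolomorphic_bargmannAdj (lt_add_card hν _) (Lp.memLp _),
    memLp_bargmannAdj (lt_add_card hν _) (Lp.memLp _)⟩

lemma isLinearMap_superBargmannAdj {ν : ℝ} (hν : (n : ℝ) + 1 < ν) :
    IsLinearMap ℂ (superBargmannAdj (n := n) (q := q) ν) where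
  map_add f g := by
    ext M z
    simp only [superBargmannAdj, Pi.add_apply]
    rw [bargmannAdj_congr _ (Lp.coeFn_add (f M) (g M)) (Lp.aestronglyMeasurable _),
      bargmannAdj_add (lt_add_card hν _) (Lp.memLp _) (Lp.memLp _)]
  map_smul c f := by
    ext M z
    simp only [superBargmannAdj, Pi.smul_apply]
    rw [bargmannAdj_congr _ (Lp.coeFn_smul c (f M)) (Lp.aestronglyMeasurable _),
      bargmannAdj_smul _ c (Lp.aestronglyMeasurable _), smul_eq_mul]

lemma exists_superBargmannAdj_eq {ν : ℝ} (hν : (n : ℝ) + 1 < ν)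
    {ψ : Finset (Fin q) → siegel n → ℂ} (hψ : ψ ∈ bergman n q ν) :
    ∃ f : Target n q, superBargmannAdj ν f = ψ := by
  choose f hf using fun M => exists_bargmannAdj_eq (lt_add_card hν _)
    ((mem_bergman_iff hν ψ).1 hψ M).1 ((mem_bergman_iff hν ψ).1 hψ M).2
  exact ⟨f, funext hf⟩

lemma bijOn_superBargmannAdj {ν : ℝ} (hν : (n : ℝ) + 1 < ν) :
    Set.BijOn (superBargmannAdj (n := n) (q := q) ν) Set.univ (bergman n q ν) := by
  refine ⟨fun f _ => superBargmannAdj_mem_bergman hν f, fun f _ g _ h => ?_, fun ψ hψ => ?_⟩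
  · ext1 M
    exact bargmannAdj_injective (lt_add_card hν _) (congrFun h M)
  · obtain ⟨f, hf⟩ := exists_superBargmannAdj_eq hν hψ
    exact ⟨f, trivial, hf⟩

lemma integral_mul_bargmannAdj {l : ℝ} (hl : (n : ℝ) + 1 < l) {f g : HSp n → ℂ}
    (hf : MemLp f 2 (halfMeasure n)) (hg : MemLp g 2 (halfMeasure n)) :
    ((bergmanConst n l / 4 : ℝ) : ℂ) *
      ∫ z, conj (bargmannAdj l f z) * bargmannAdj l g z ∂(wSiegel n l) =
    ∫ t, conj (f t) * g t ∂(halfMeasure n) := by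
  have h := (integral_conj_bargmannAdj_mul hl hf hg (a := fun _ => 1) measurable_const
    (symbolL2_one hl hg)).2
  simp only [one_mul] at h
  rw [h, ← integral_const_mul]
  refine integral_congr_ae ?_
  filter_upwards [ae_half] with t ht
  have hb := bergmanConst_pos hl
  have h1 : ∫ y, (kk l y t : ℂ) ∂(wHalf n l) = ((4 / bergmanConst n l : ℝ) : ℂ) := by
    rw [integral_complex_ofReal, integral_eq_lintegral_of_nonneg_ae (.of_forall fun y => kk_nonneg l y t)
      ((measurable_kk l).comp (measurable_id.prodMk measurable_const)).aestronglyMeasurable,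
      lintegral_kk_wHalf hl ht, ENNReal.toReal_ofReal (by positivity)]
  have hb' : (bergmanConst n l : ℂ) ≠ 0 := Complex.ofReal_ne_zero.2 hb.ne'
  rw [h1]
  push_cast
  field_simp

lemma inner_eq_integral (f g : Lp ℂ 2 (halfMeasure n)) :
    inner ℂ f g = ∫ t, conj (f t) * g t ∂(halfMeasure n) := by
  rw [L2.inner_def]
  refine integral_congr_ae (.of_forall fun t => ?_)
  simp only [RCLike.inner_apply]
  exact mul_comm _ _

lemma form_superBargmannAdj {ν : ℝ} (hν : (n : ℝ) + 1 < ν) (f g : Target n q) :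
    form ν (superBargmannAdj ν f) (SuperFun.ofCoeff (superBargmannAdj ν g)).val =
      targetInner ν f g := by
  rw [form_ofCoeff hν (superBargmannAdj_mem_bergman hν f) (superBargmannAdj_mem_bergman hν g),
    targetInner]
  refine Finset.sum_congr rfl fun M _ => ?_
  rw [inner_eq_integral, ← integral_mul_bargmannAdj (lt_add_card hν M.card) (Lp.memLp _)
    (Lp.memLp _)]
  rfl

end Unitary

/-! ### The Toeplitz graph lies in the multiplication graph. -/

section Toeplitz
variable {n q : ℕ} {ν : ℝ} {F : SuperFun n q}

lemma integral_sym_bargmannAdj (hν : (n : ℝ) + 1 < ν) (hFm : ∀ I J, Measurable (F I J))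
    (hFb : ∀ I J, ∃ C : ℝ, ∀ z, ‖F I J z‖ ≤ C) (M : Finset (Fin q)) {f g : HSp n → ℂ}
    (hf : MemLp f 2 (halfMeasure n)) (hg : MemLp g 2 (halfMeasure n))
    (h : SymbolL2 (ν + (M.card : ℝ)) (sym ν F M) g) :
    Integrable (fun t => conj (f t) * (gammaNil ν F t.1 t.2 M * g t)) (halfMeasure n) ∧
    ((bergmanConst n (ν + (M.card : ℝ)) / 4 : ℝ) : ℂ) *
      ∫ z, conj (bargmannAdj (ν + (M.card : ℝ)) f z) *
        (sym ν F M (yc z.1) * bargmannAdj (ν + (M.card : ℝ)) g z) ∂(wSiegel n (ν + (M.card : ℝ))) =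
      ∫ t, conj (f t) * (gammaNil ν F t.1 t.2 M * g t) ∂(halfMeasure n) := by
  obtain ⟨h1, h2⟩ := integral_conj_bargmannAdj_mul (lt_add_card hν M.card) hf hg
    (measurable_sym ν hFm M) h
  have hcongr : (fun t => ((bergmanConst n (ν + (M.card : ℝ)) / 4 : ℝ) : ℂ) * (conj (f t) * g t *
      ∫ y, sym ν F M y * (kk (ν + (M.card : ℝ)) y t : ℂ) ∂(wHalf n (ν + (M.card : ℝ)))))
      =ᵐ[halfMeasure n] fun t => conj (f t) * (gammaNil ν F t.1 t.2 M * g t) := by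
    filter_upwards [ae_half] with t ht
    rw [gammaNil_eq hν hFm hFb M ht]
    ring
  refine ⟨(h1.const_mul _).congr hcongr, ?_⟩
  rw [h2, ← integral_const_mul]
  exact integral_congr_ae hcongr

/-- When the symbol keeps each component in `L²`, every pairing converges by Cauchy–Schwarz, and its
value is that of the multiplier. -/
lemma mem_toeplitzGraph (hν : (n : ℝ) + 1 < ν) (hFm : ∀ I J, Measurable (F I J))
    (hFb : ∀ I J, ∃ C : ℝ, ∀ z, ‖F I J z‖ ≤ C) (hF : IsNilpotent F) {x : Target n q × Target n q}
    (hx : x ∈ multGraph ν F)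
    (hsym : ∀ M, SymbolL2 (ν + (M.card : ℝ)) (sym ν F M) (x.1 M)) : x ∈ toeplitzGraph ν F := by
  refine ⟨superBargmannAdj_mem_bergman hν _, superBargmannAdj_mem_bergman hν _, fun Φ hΦ => ?_⟩
  obtain ⟨φ, rfl⟩ := exists_superBargmannAdj_eq hν hΦ
  have hint (M : Finset (Fin q)) : Integrable (fun z => conj (superBargmannAdj ν φ M z) *
      (sym ν F M (yc z.1) * superBargmannAdj ν x.1 M z)) (wSiegel n (ν + (M.card : ℝ))) :=
    integrable_conj_mul_symbol (lt_add_card hν M.card) (Lp.memLp _) (Lp.memLp _)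
      (measurable_sym ν hFm M) (hsym M)
  refine ⟨?_, ?_⟩
  · rw [pairing_mul_eq hν _ _ hF]
    exact integrable_superDensity ν hint
  · rw [form_mul hν hF hint, form_superBargmannAdj hν, targetInner]
    refine Finset.sum_congr rfl fun M _ => ?_
    congr 1
    refine (integral_sym_bargmannAdj hν hFm hFb M (Lp.memLp (φ M)) (Lp.memLp (x.1 M))
      (hsym M)).2.trans ?_
    rw [inner_eq_integral]
    refine integral_congr_ae ?_
    filter_upwards [hx M] with t ht
    rw [ht]

lemma SymbolL2.conj {l : ℝ} {a f : HSp n → ℂ} (h : SymbolL2 l a f) :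
    SymbolL2 l (fun y => conj (a y)) f := by
  have e (w : ℂ) : ‖conj w‖ₑ = ‖w‖ₑ := by
    rw [← ofReal_norm, ← ofReal_norm, RCLike.norm_conj]
  simpa only [SymbolL2, e] using h

/-- The symbol can also be moved to the first argument. -/
lemma integral_sym_bargmannAdj_left (hν : (n : ℝ) + 1 < ν) (hFm : ∀ I J, Measurable (F I J))
    (hFb : ∀ I J, ∃ C : ℝ, ∀ z, ‖F I J z‖ ≤ C) (M : Finset (Fin q)) {f g : HSp n → ℂ}
    (hf : MemLp f 2 (halfMeasure n)) (hg : MemLp g 2 (halfMeasure n))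
    (h : SymbolL2 (ν + (M.card : ℝ)) (sym ν F M) f) :
    Integrable (fun t => conj (f t) * (gammaNil ν F t.1 t.2 M * g t)) (halfMeasure n) ∧
    ((bergmanConst n (ν + (M.card : ℝ)) / 4 : ℝ) : ℂ) *
      ∫ z, conj (bargmannAdj (ν + (M.card : ℝ)) f z) *
        (sym ν F M (yc z.1) * bargmannAdj (ν + (M.card : ℝ)) g z) ∂(wSiegel n (ν + (M.card : ℝ))) =
      ∫ t, conj (f t) * (gammaNil ν F t.1 t.2 M * g t) ∂(halfMeasure n) := by
  -- The identity for the conjugate symbol with `f` and `g` exchanged, then conjugated. Only `f` has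
  -- to tolerate the symbol, which matters because a function in the Toeplitz domain need not.
  obtain ⟨h1, h2⟩ := integral_conj_bargmannAdj_mul (lt_add_card hν M.card) hg hf
    (Complex.continuous_conj.measurable.comp (measurable_sym ν hFm M)) h.conj
  have hcongr : (fun t => ((bergmanConst n (ν + (M.card : ℝ)) / 4 : ℝ) : ℂ) * conj (conj (g t) * f t *
      ∫ y, conj (sym ν F M y) * (kk (ν + (M.card : ℝ)) y t : ℂ) ∂(wHalf n (ν + (M.card : ℝ)))))
      =ᵐ[halfMeasure n] fun t => conj (f t) * (gammaNil ν F t.1 t.2 M * g t) := by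
    filter_upwards [ae_half] with t ht
    rw [gammaNil_eq hν hFm hFb M ht, map_mul, ← integral_conj]
    simp only [map_mul, Complex.conj_conj, Complex.conj_ofReal]
    ring
  have h1' : Integrable (fun t => conj (conj (g t) * f t *
      ∫ y, conj (sym ν F M y) * (kk (ν + (M.card : ℝ)) y t : ℂ) ∂(wHalf n (ν + (M.card : ℝ)))))
      (halfMeasure n) := by
    exact (Complex.conjLIE.toContinuousLinearEquiv.toContinuousLinearMap.integrable_comp h1)
  refine ⟨(h1'.const_mul _).congr hcongr, ?_⟩
  rw [← integral_congr_ae hcongr, integral_const_mul]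
  congr 1
  have h3 := congrArg conj h2
  rw [← integral_conj, ← integral_conj] at h3
  rw [show (∫ t, conj (conj (g t) * f t * ∫ y, conj (sym ν F M y) * (kk (ν + (M.card : ℝ)) y t : ℂ)
    ∂(wHalf n (ν + (M.card : ℝ)))) ∂(halfMeasure n)) = _ from h3.symm]
  refine integral_congr_ae (.of_forall fun z => ?_)
  simp only [Function.comp_apply, map_mul, Complex.conj_conj]
  ring

lemma superBargmannAdj_single_of_ne (ν : ℝ) {M N : Finset (Fin q)} (hN : N ≠ M)
    (φ : Lp ℂ 2 (halfMeasure n)) : superBargmannAdj ν (Pi.single M φ : Target n q) N = 0 := by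
  ext z
  simp only [superBargmannAdj, Pi.single_eq_of_ne hN]
  have := bargmannAdj_smul (ν + (N.card : ℝ)) 0
    (Lp.aestronglyMeasurable (0 : Lp ℂ 2 (halfMeasure n))) z
  rw [zero_mul] at this
  rw [Pi.zero_apply, ← this,
    bargmannAdj_congr _ _ (Lp.aestronglyMeasurable (0 : Lp ℂ 2 (halfMeasure n)))]
  filter_upwards [Lp.coeFn_zero ℂ 2 (halfMeasure n)] with t ht
  rw [ht, Pi.smul_apply, zero_smul]; rfl

/-- Testing the projection on functions with a single component. -/
lemma integral_conj_mul_gamma_eq (hν : (n : ℝ) + 1 < ν) (hFm : ∀ I J, Measurable (F I J))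
    (hFb : ∀ I J, ∃ C : ℝ, ∀ z, ‖F I J z‖ ≤ C) (hF : IsNilpotent F) {x : Target n q × Target n q}
    (hx : ∀ Φ ∈ bergman n q ν,
      Integrable (pairing ν Φ fun z => F.val z * (SuperFun.ofCoeff (superBargmannAdj ν x.1)).val z)
        (siegelMeasure n) ∧
      form ν Φ (fun z => F.val z * (SuperFun.ofCoeff (superBargmannAdj ν x.1)).val z) =
        form ν Φ (SuperFun.ofCoeff (superBargmannAdj ν x.2)).val)
    (M : Finset (Fin q)) (φ : Lp ℂ 2 (halfMeasure n))
    (hφ : SymbolL2 (ν + (M.card : ℝ)) (sym ν F M) φ) :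
    ∫ t, conj (φ t) * (gammaNil ν F t.1 t.2 M * x.1 M t) ∂(halfMeasure n) =
      ∫ t, conj (φ t) * x.2 M t ∂(halfMeasure n) := by
  set Φ := superBargmannAdj ν (Pi.single M φ : Target n q) with hΦ
  obtain ⟨h1, h2⟩ := hx Φ (superBargmannAdj_mem_bergman hν _)
  have h0 (N : Finset (Fin q)) (hN : N ≠ M) : Φ N = 0 := superBargmannAdj_single_of_ne ν hN φ
  have hM : Φ M = bargmannAdj (ν + (M.card : ℝ)) φ := by
    rw [hΦ, superBargmannAdj, Pi.single_eq_same]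
  set g : Finset (Fin q) → siegel n → ℂ := fun N z =>
    conj (Φ N z) * (sym ν F N (yc z.1) * superBargmannAdj ν x.1 N z) with hg
  have hg0 (N : Finset (Fin q)) (hN : N ≠ M) : g N = 0 := by
    ext z
    simp only [hg, h0 N hN, Pi.zero_apply, map_zero, zero_mul]
  have hint (N : Finset (Fin q)) : Integrable (g N) (wSiegel n (ν + (N.card : ℝ))) := by
    by_cases hN : N = M
    · subst hN
      rw [pairing_mul_eq hν _ _ hF] at h1
      exact integrable_of_superDensity_single hν N hg0 h1
    · rw [hg0 N hN]
      exact integrable_zero _ _ _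
  rw [form_mul hν hF hint, form_superBargmannAdj hν, targetInner, Finset.sum_eq_single M,
    Finset.sum_eq_single M, Pi.single_eq_same] at h2
  · have hG : ((Real.Gamma ν / Real.Gamma (ν + (M.card : ℝ)) : ℝ) : ℂ) ≠ 0 := by
      have h3 := Real.Gamma_pos_of_pos (show 0 < ν by linarith [n.cast_nonneg (α := ℝ)])
      have h4 := Real.Gamma_pos_of_pos (show 0 < ν + (M.card : ℝ) by
        linarith [n.cast_nonneg (α := ℝ), M.card.cast_nonneg (α := ℝ)])
      exact Complex.ofReal_ne_zero.2 (by positivity)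
    have h5 := mul_left_cancel₀ hG h2
    rw [inner_eq_integral] at h5
    rw [← h5, ← (integral_sym_bargmannAdj_left hν hFm hFb M (Lp.memLp φ) (Lp.memLp (x.1 M)) hφ).2,
      hM]
    rfl
  · intro N _ hN
    rw [Pi.single_eq_of_ne hN, inner_zero_left, mul_zero]
  · simp
  · intro N _ hN
    have : ∫ z, g N z ∂(wSiegel n (ν + (N.card : ℝ))) = 0 := by
      rw [hg0 N hN]; simp
    rw [this, mul_zero, mul_zero]
  · simp

/-- Indicators of sets of finite measure in `ξ > 1/(k+1)` tolerate any symbol of polynomial growth.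
Testing against them equates the integrals of `γ f_M` and `g_M` over all such sets, hence the
functions almost everywhere there; these regions exhaust the half space. -/
lemma toeplitzGraph_subset (hν : (n : ℝ) + 1 < ν) (hFm : ∀ I J, Measurable (F I J))
    (hFb : ∀ I J, ∃ C : ℝ, ∀ z, ‖F I J z‖ ≤ C) (hF : IsNilpotent F) :
    toeplitzGraph ν F ⊆ multGraph ν F := by
  rintro x ⟨-, -, hx⟩ M
  set l := ν + (M.card : ℝ) with hldef
  have hl : (n : ℝ) + 1 < l := lt_add_card hν M.card
  obtain ⟨C, hC⟩ := exists_norm_sym_le ν hFb M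
  have key (φ : Lp ℂ 2 (halfMeasure n)) (hφ : SymbolL2 l (sym ν F M) φ) :=
    integral_conj_mul_gamma_eq hν hFm hFb hF hx M φ hφ
  have hδ (k : ℕ) : ∀ᵐ t ∂((halfMeasure n).restrict {t | 1 / ((k : ℝ) + 1) < t.2}),
      gammaNil ν F t.1 t.2 M * x.1 M t = x.2 M t := by
    set D : Set (HSp n) := {t | 1 / ((k : ℝ) + 1) < t.2} with hD
    have hDm : MeasurableSet D := measurableSet_lt measurable_const measurable_snd
    have aux (s : Set (HSp n)) (hs : MeasurableSet s) (hsf : (halfMeasure n).restrict D s < ⊤) :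
        IntegrableOn (fun t => gammaNil ν F t.1 t.2 M * x.1 M t) s ((halfMeasure n).restrict D) ∧
        IntegrableOn (fun t => x.2 M t) s ((halfMeasure n).restrict D) ∧
        ∫ t in s, gammaNil ν F t.1 t.2 M * x.1 M t ∂((halfMeasure n).restrict D) =
        ∫ t in s, x.2 M t ∂((halfMeasure n).restrict D) := by
      rw [Measure.restrict_apply hs] at hsf
      have hsD := hs.inter hDm
      have hmem : MemLp ((s ∩ D).indicator fun _ => (1 : ℂ)) 2 (halfMeasure n) :=
        memLp_indicator_const 2 hsD 1 (Or.inr hsf.ne)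
      have hae := hmem.coeFn_toLp
      have hsy : SymbolL2 l (sym ν F M) ((s ∩ D).indicator fun _ => (1 : ℂ)) := by
        refine symbolL2_indicator (δ := 1 / ((k : ℝ) + 1)) hl (by positivity) q hC hmem fun t ht => ?_
        have : t ∈ s ∩ D := by
          by_contra hne
          exact ht (Set.indicator_of_notMem hne _)
        exact this.2
      have hsy' : SymbolL2 l (sym ν F M) (hmem.toLp _) := by
        refine lt_of_le_of_lt (le_of_eq (lintegral_congr_ae ?_)) hsy
        filter_upwards [hae] with t ht
        rw [ht]
      have e (g : HSp n → ℂ) : (fun t => conj (hmem.toLp _ t) * g t) =ᵐ[halfMeasure n]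
          (s ∩ D).indicator g := by
        filter_upwards [hae] with t ht
        rw [ht]
        by_cases h : t ∈ s ∩ D
        · simp [h]
        · simp [h]
      simp only [IntegrableOn, Measure.restrict_restrict hs]
      have i1 := (integral_sym_bargmannAdj_left hν hFm hFb M (Lp.memLp _) (Lp.memLp (x.1 M)) hsy').1
      have i2 := integrable_conj_mul_self (Lp.memLp (hmem.toLp _)) (Lp.memLp (x.2 M))
      have k1 := key _ hsy'
      rw [integral_congr_ae (e fun t => gammaNil ν F t.1 t.2 M * x.1 M t),
        integral_congr_ae (e fun t => x.2 M t), integral_indicator hsD, integral_indicator hsD] at k1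
      exact ⟨(integrable_indicator_iff hsD).1 (i1.congr (e _)),
        (integrable_indicator_iff hsD).1 (i2.congr (e _)), k1⟩
    exact ae_eq_of_forall_setIntegral_eq_of_sigmaFinite (fun s hs hsf => (aux s hs hsf).1)
      (fun s hs hsf => (aux s hs hsf).2.1) (fun s hs hsf => (aux s hs hsf).2.2)
  have hδ' : ∀ k : ℕ, ∀ᵐ t ∂(halfMeasure n), 1 / ((k : ℝ) + 1) < t.2 →
      gammaNil ν F t.1 t.2 M * x.1 M t = x.2 M t := fun k =>
    (ae_restrict_iff' (measurableSet_lt measurable_const measurable_snd)).1 (hδ k)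
  filter_upwards [ae_all_iff.2 hδ', ae_half] with t ht ht0
  obtain ⟨k, hk⟩ := exists_nat_one_div_lt ht0
  exact (ht k hk).symm

end Toeplitz
end SuperSiegel

end

noncomputable section
namespace SuperSiegel
open Filter Topology

/-! ### The closure is the maximal multiplication operator. -/

section Closure
variable {n q : ℕ} {ν : ℝ} {F : SuperFun n q}

/-- Convergence in `L²` yields almost everywhere convergence along a subsequence, taken twice to
serve both entries, and the graph relation is pointwise. No regularity of the multiplier is used. -/
lemma isClosed_multGraph : IsClosed (multGraph (n := n) (q := q) ν F) := by
  refine isClosed_of_closure_subset fun x hx M => ?_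
  obtain ⟨u, hu, hlim⟩ := mem_closure_iff_seq_limit.1 hx
  have h1 : Tendsto (fun k => (u k).1 M) atTop (𝓝 (x.1 M)) :=
    ((continuous_apply M).comp continuous_fst).continuousAt.tendsto.comp hlim
  have h2 : Tendsto (fun k => (u k).2 M) atTop (𝓝 (x.2 M)) :=
    ((continuous_apply M).comp continuous_snd).continuousAt.tendsto.comp hlim
  obtain ⟨a, ha, h3⟩ := (tendstoInMeasure_of_tendsto_Lp h1).exists_seq_tendsto_ae
  obtain ⟨b, hb, h4⟩ := (tendstoInMeasure_of_tendsto_Lp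
    (h2.comp ha.tendsto_atTop)).exists_seq_tendsto_ae
  have h5 : ∀ᵐ t ∂(halfMeasure n), ∀ k, (u k).2 M t = gammaNil ν F t.1 t.2 M * (u k).1 M t :=
    ae_all_iff.2 fun k => hu k M
  filter_upwards [h3, h4, h5] with t h3 h4 h5
  have h6 := (h3.comp hb.tendsto_atTop).const_mul (gammaNil ν F t.1 t.2 M)
  refine tendsto_nhds_unique h4 (h6.congr fun k => ?_)
  exact (h5 _).symm

/-- Cutting off near `ξ = 0`. -/
def cutoff (k : ℕ) (f : Lp ℂ 2 (halfMeasure n)) : Lp ℂ 2 (halfMeasure n) :=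
  ((Lp.memLp f).indicator (measurableSet_lt measurable_const measurable_snd :
    MeasurableSet {t : HSp n | 1 / ((k : ℝ) + 1) < t.2})).toLp _

lemma cutoff_coeFn (k : ℕ) (f : Lp ℂ 2 (halfMeasure n)) : cutoff k f =ᵐ[halfMeasure n]
    {t : HSp n | 1 / ((k : ℝ) + 1) < t.2}.indicator f :=
  MemLp.coeFn_toLp _

lemma tendsto_cutoff (f : Lp ℂ 2 (halfMeasure n)) :
    Tendsto (fun k => cutoff k f) atTop (𝓝 f) := by
  conv_rhs => rw [← Lp.toLp_coeFn f (Lp.memLp f)]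
  refine tendsto_toLp_of_norm_le _ _ (fun k => .of_forall fun t => norm_indicator_le_norm_self _ _) ?_
  filter_upwards [ae_half] with t ht
  obtain ⟨k₀, hk₀⟩ := exists_nat_one_div_lt ht
  refine tendsto_const_nhds.congr' ?_
  filter_upwards [eventually_ge_atTop k₀] with k hk
  rw [Set.indicator_of_mem]
  refine lt_of_le_of_lt ?_ hk₀
  have : (k₀ : ℝ) ≤ k := by exact_mod_cast hk
  gcongr

lemma SymbolL2.congr_ae {l : ℝ} {a f g : HSp n → ℂ} (h : SymbolL2 l a f)
    (hfg : f =ᵐ[halfMeasure n] g) : SymbolL2 l a g := by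
  refine lt_of_le_of_lt (le_of_eq (lintegral_congr_ae ?_)) h
  filter_upwards [hfg] with t ht
  rw [ht]

/-- Cutoffs commute with multiplication. So cutting both entries of a pair stays in the
multiplication graph, puts the first entry where the symbol is harmless, and converges to the
original pair. -/
lemma closure_toeplitzGraph (hν : (n : ℝ) + 1 < ν) (hFm : ∀ I J, Measurable (F I J))
    (hFb : ∀ I J, ∃ C : ℝ, ∀ z, ‖F I J z‖ ≤ C) (hF : IsNilpotent F) :
    closure (toeplitzGraph ν F) = multGraph ν F := by
  refine Set.Subset.antisymm
    (closure_minimal (toeplitzGraph_subset hν hFm hFb hF) isClosed_multGraph) fun x hx => ?_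
  refine mem_closure_iff_seq_limit.2
    ⟨fun k => (fun M => cutoff k (x.1 M), fun M => cutoff k (x.2 M)), fun k => ?_, ?_⟩
  · refine mem_toeplitzGraph hν hFm hFb hF (fun M => ?_) fun M => ?_
    · filter_upwards [hx M, cutoff_coeFn k (x.1 M), cutoff_coeFn k (x.2 M)] with t h1 h2 h3
      rw [h2, h3]
      by_cases h : t ∈ {t : HSp n | 1 / ((k : ℝ) + 1) < t.2}
      · rw [Set.indicator_of_mem h, Set.indicator_of_mem h, h1]
      · rw [Set.indicator_of_notMem h, Set.indicator_of_notMem h, mul_zero]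
    · obtain ⟨C, hC⟩ := exists_norm_sym_le ν hFb M
      refine SymbolL2.congr_ae ?_ (cutoff_coeFn k (x.1 M)).symm
      refine symbolL2_indicator (δ := 1 / ((k : ℝ) + 1)) (lt_add_card hν _) (by positivity) q hC
        ((Lp.memLp (x.1 M)).indicator (measurableSet_lt measurable_const measurable_snd :
          MeasurableSet {t : HSp n | 1 / ((k : ℝ) + 1) < t.2})) fun t ht => ?_
      have : t ∈ {t : HSp n | 1 / ((k : ℝ) + 1) < t.2} := by
        by_contra hne
        exact ht (Set.indicator_of_notMem hne _)
      exact this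
  · refine Prod.tendsto_iff _ _ |>.2 ⟨tendsto_pi_nhds.2 fun M => ?_, tendsto_pi_nhds.2 fun M => ?_⟩
    · exact tendsto_cutoff (x.1 M)
    · exact tendsto_cutoff (x.2 M)

/-- A bounded symbol gives a bounded multiplier. -/
lemma memLp_gammaNil_mul (hν : (n : ℝ) + 1 < ν) (hFm : ∀ I J, Measurable (F I J))
    (hFb : ∀ I J, ∃ C : ℝ, ∀ z, ‖F I J z‖ ≤ C) (M : Finset (Fin q)) {C : ℝ}
    (hC : ∀ y : HSp n, 0 < y.2 → ‖sym ν F M y‖ ≤ C) {f : HSp n → ℂ}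
    (hf : MemLp f 2 (halfMeasure n)) :
    MemLp (fun t => gammaNil ν F t.1 t.2 M * f t) 2 (halfMeasure n) := by
  set l := ν + (M.card : ℝ) with hldef
  have hl : (n : ℝ) + 1 < l := lt_add_card hν M.card
  have hb := bergmanConst_pos hl
  -- The averaged form of the multiplier, equal to it for `ξ > 0`; its measurability follows from
  -- that of parametric integrals.
  set G : HSp n → ℂ := fun t => ((bergmanConst n l / 4 : ℝ) : ℂ) *
    ∫ y, sym ν F M y * (kk l y t : ℂ) ∂(wHalf n l) with hG
  have hGm : AEStronglyMeasurable G (halfMeasure n) := by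
    refine AEStronglyMeasurable.const_mul ?_ _
    have h1 : Measurable fun p : HSp n × HSp n => sym ν F M p.2 * (kk l p.2 p.1 : ℂ) := by
      have h2 : Measurable fun p : HSp n × HSp n => sym ν F M p.2 :=
        (measurable_sym ν hFm M).comp measurable_snd
      have h3 : Measurable fun p : HSp n × HSp n => kk l p.2 p.1 :=
        (measurable_kk (n := n) l).comp measurable_swap
      exact h2.mul (Complex.measurable_ofReal.comp h3)
    exact h1.stronglyMeasurable.integral_prod_right.aestronglyMeasurable
  -- The normalized kernel `(c_l / 4) kk` is a probability density in `y` for `wHalf`, so the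
  -- average inherits the bound of the symbol.
  have hGb : ∀ᵐ t ∂(halfMeasure n), ‖G t‖ ≤ C := by
    filter_upwards [ae_half] with t ht
    have h4 : ‖∫ y, sym ν F M y * (kk l y t : ℂ) ∂(wHalf n l)‖ ≤ C * (4 / bergmanConst n l) := by
      have h5 : ∫ y, kk l y t ∂(wHalf n l) = 4 / bergmanConst n l := by
        rw [integral_eq_lintegral_of_nonneg_ae (.of_forall fun y => kk_nonneg l y t)
          ((measurable_kk l).comp (measurable_id.prodMk measurable_const)).aestronglyMeasurable,
          lintegral_kk_wHalf hl ht, ENNReal.toReal_ofReal (by positivity)]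
      rw [← h5, ← integral_const_mul]
      refine norm_integral_le_of_norm_le ?_ ?_
      · have := integrable_pow_mul_kk hl 0 ht
        simp only [pow_zero, one_mul] at this
        exact this.const_mul C
      · filter_upwards [ae_wHalf l] with y hy
        rw [norm_mul, Complex.norm_real, Real.norm_of_nonneg (kk_nonneg _ _ _)]
        exact mul_le_mul_of_nonneg_right (hC y hy) (kk_nonneg _ _ _)
    rw [hG]
    simp only
    rw [norm_mul, Complex.norm_real, Real.norm_of_nonneg (by positivity)]
    calc _ ≤ bergmanConst n l / 4 * (C * (4 / bergmanConst n l)) := by gcongr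
      _ = C := by field_simp
  have h6 : MemLp (fun t => G t * f t) 2 (halfMeasure n) := by
    refine (hf.const_mul (C : ℂ)).mono (hGm.mul hf.1) ?_
    filter_upwards [hGb] with t ht
    have h7 : ‖G t * f t‖ = ‖G t‖ * ‖f t‖ := norm_mul _ _
    rw [h7, norm_mul (C : ℂ) (f t), Complex.norm_real]
    exact mul_le_mul_of_nonneg_right (ht.trans (le_abs_self C)) (norm_nonneg (f t))
  refine (memLp_congr_ae ?_).1 h6
  filter_upwards [ae_half] with t ht
  rw [gammaNil_eq hν hFm hFb M ht]

/-- A bounded symbol is tolerated by every `L²` function, so the whole multiplication graph consists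
of Toeplitz pairs; the multiplier is bounded too, hence everywhere defined. -/
lemma toeplitzGraph_of_bounded (hν : (n : ℝ) + 1 < ν) (hFm : ∀ I J, Measurable (F I J))
    (hFb : ∀ I J, ∃ C : ℝ, ∀ z, ‖F I J z‖ ≤ C) (hF : IsNilpotent F)
    (hb : ∀ I, ∃ C : ℝ, ∀ z : siegel n, height z.1 ^ I.card * ‖F I I z‖ ≤ C) :
    (∀ f, ∃ g, (f, g) ∈ toeplitzGraph ν F) ∧ toeplitzGraph ν F = multGraph ν F := by
  have hle : multGraph ν F ⊆ toeplitzGraph ν F := fun x hx =>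
    mem_toeplitzGraph hν hFm hFb hF hx fun M => by
      obtain ⟨C, hC⟩ := exists_norm_sym_le_of_bounded ν hb M
      exact symbolL2_of_bounded (lt_add_card hν _) hC (Lp.memLp _)
  refine ⟨fun f => ?_, Set.Subset.antisymm (toeplitzGraph_subset hν hFm hFb hF) hle⟩
  choose C hC using exists_norm_sym_le_of_bounded (F := F) ν hb
  exact ⟨fun M => (memLp_gammaNil_mul hν hFm hFb M (hC M) (Lp.memLp (f M))).toLp _,
    hle fun M => (memLp_gammaNil_mul hν hFm hFb M (hC M) (Lp.memLp (f M))).coeFn_toLp⟩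

end Closure
end SuperSiegel

end

theorem mainTheorem3 (n q : ℕ) (ν : ℝ) (hν : (n : ℝ) + 1 < ν)
    (F : SuperSiegel.SuperFun n q)
    (hFm : ∀ I J, Measurable (F I J))
    (hFb : ∀ I J, ∃ C : ℝ, ∀ z, ‖F I J z‖ ≤ C)
    (hF : SuperSiegel.IsNilpotent F) :
    -- `F = ∑_I F_I(Im z', Im z_p - |z'|²) ξ_I ξ_I^*`
    (∀ I J z, F I J z =
      if I = J then
        SuperSiegel.profile F I (fun k => (z.1.1 k).im) (SuperSiegel.height z.1)
      else 0) ∧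
    -- `R_{ν,(p|q)}^*` is a unitary operator onto the super Bergman space
    IsLinearMap ℂ (SuperSiegel.superBargmannAdj (n := n) (q := q) ν) ∧
    Set.BijOn (SuperSiegel.superBargmannAdj (n := n) (q := q) ν) Set.univ
      (SuperSiegel.bergman n q ν) ∧
    (∀ f g : SuperSiegel.Target n q,
      SuperSiegel.form ν (SuperSiegel.superBargmannAdj ν f)
          (SuperSiegel.SuperFun.ofCoeff (SuperSiegel.superBargmannAdj ν g)).val
        = SuperSiegel.targetInner ν f g) ∧
    -- `R T_F R^*` is multiplication by `γ` on its domain, with closure the maximal multiplication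
    -- operator
    SuperSiegel.toeplitzGraph ν F ⊆ SuperSiegel.multGraph ν F ∧
    closure (SuperSiegel.toeplitzGraph ν F) = SuperSiegel.multGraph ν F ∧
    -- no closure is needed, and the domain is the whole space, if `T_F` is given by bounded
    -- functions
    ((∀ I, ∃ C : ℝ, ∀ z : SuperSiegel.siegel n,
        SuperSiegel.height z.1 ^ I.card * ‖F I I z‖ ≤ C) →
      (∀ f, ∃ g, (f, g) ∈ SuperSiegel.toeplitzGraph ν F) ∧
      SuperSiegel.toeplitzGraph ν F = SuperSiegel.multGraph ν F) := by
  exact ⟨fun I J z => by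
      split_ifs with h
      · subst h
        exact hF.eq_profile I z
      · exact hF.eq_zero h z,
    SuperSiegel.isLinearMap_superBargmannAdj hν, SuperSiegel.bijOn_superBargmannAdj hν,
    SuperSiegel.form_superBargmannAdj hν, SuperSiegel.toeplitzGraph_subset hν hFm hFb hF,
    SuperSiegel.closure_toeplitzGraph hν hFm hFb hF,
    SuperSiegel.toeplitzGraph_of_bounded hν hFm hFb hF⟩
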